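/- **Setting.** Let $u_0>1$, $u_F\in[u_0,+\infty]$, $v_0\in\mathbb R$. On a measurable domain $\mathcal Q\subset\{u_0\le u\le u_F,\ v\ge v_0\}$ (for instance the whole rectangle) that contains $\{u_0\}\times[v_0,\infty)$ and, for some $R_1$, every $(u,v)$ with $u_0\le u\le u_F$, $v-u\ge R_1$, consider $g=-\Omega^2(u,v)\,du\,dv+r^2(u,v)\,d\sigma_{\mathbb S^2}$ with $r,\Omega^2>0$, $r\in C^3$, $\Omega^2\in C^1$, and real functions $w_0,w_1,q,W_0,W_1,Q$ of class $C^1$. Here $O(\cdot)$, $o(\cdot)$ mean: as $v-u\to\infty$ in $\mathcal Q$, uniformly. Assume that $r$ is comparable to $v-u$ wherever $r$ or $v-u$ is large, that $$|1+\partial_ur|,\ |1-\partial_vr|,\ |\Omega^2-4|,\ r|\partial_v\Omega^2|=O(r^{-1}),\qquad |\partial_v^2r|,\ |\partial_u\partial_vr|,\ |\partial_u\partial_v^2r|=O(r^{-2}),$$ that $w_0,w_1,q,\ r\partial_vw_0,\ r^2\partial_vq=O(1)$, and that $W_0,W_1,Q,\ r\partial_vW_0,\ r^2\partial_vW_1,\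 r^2\partial_vQ=o(1)$. For $\epsilon\in\mathbb R$ consider $$\Box_g\phi=\frac1{r^2}\Big((\epsilon w_0+W_0)\phi+(\epsilon w_1+W_1)\partial_u\phi+(\epsilon q+Q)\,r\partial_v\phi\Big)\quad\text{on }\mathcal Q\times\mathbb S^2.$$ For $R\in\mathbb R$ put $$E[\phi](u)=\int_{u+R}^\infty\!\int_{\mathbb S^2}\big(r^2|\partial_v\phi|^2+|\nabla_{\mathbb S^2}\phi|^2\big)(u,v,\omega)\,d\omega\,dv+\int_{\{u'\ge u,\ (u',u+R)\in\mathcal Q\}}\int_{\mathbb S^2}\big(r^2|\partial_u\phi|^2+|\nabla_{\mathbb S^2}\phi|^2\big)(u',u+R,\omega)\,d\omega\,du',$$ $$E_p[\psi](u)=\int_{u+R}^\infty\int_{\mathbb S^2}r^p|\partial_v\psi|^2(u,v,\omega)\,d\omega\,dv,\qquad \tilde E_p[\phi](u)=E_p[r\phi](u)+E[\phi](u),$$ and let $\phi_0(u,v)$ be the average of $\phi(u,v,\cdot)$ over $\mathbb S^2$. Fix $k\in\{3,4,\dots,\infty\}$. An *admissible solution* is a real $C^k$ solution $\phi$ with $E[\phi](u)<\infty$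 for all $u\in[u_0,u_F]$, $u<\infty$, such that for all $0\le p<3$ $$\sum_{|\beta|\le2}\int_{v_0}^\infty\!\int_{\mathbb S^2}r^{p+|\beta|}|\partial_v(r\nabla_{\mathbb S^2}^\beta\phi)|^2(u_0,v,\omega)\,d\omega\,dv+\sum_{j=0}^1\int_{v_0}^\infty\!\int_{\mathbb S^2}r^{p+2j}|\partial_v^{1+j}(r\phi)|^2(u_0,v,\omega)\,d\omega\,dv<\infty .$$ **Proposition.** Let $p_{low}(\epsilon)<2$ (for $\epsilon\ne0$) be any function with $2-p_{low}(\epsilon)=O(\sqrt{|\epsilon|})$ as $\epsilon\to0$. There are $\epsilon_0>0$ and functions $p_{high},\delta,R_0$ of $\epsilon$, with $3-p_{high}(\epsilon)=O(\sqrt{|\epsilon|})$ and $\delta(\epsilon)=O(\sqrt{|\epsilon|})$ as $\epsilon\to0$ and $2<p_{high}(\epsilon)\le1+p_{low}(\epsilon)<3$ for $0<|\epsilon|<\epsilon_0$, such that for all $R\in\mathbb R$, $D>0$, $\sigma>1$, $C_\sigma>0$ there is $C>0$, independent of $\epsilon$, with the following property. Let $0<|\epsilon|<\epsilon_0$ and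 $R\ge R_0(\epsilon)$, and assume that every admissible solution $\phi$ satisfies $E[\phi](u_2)\le D\,E[\phi](u_1)$ for all finite $u_0\le u_1<u_2\le u_F$ and $$\int_{\mathcal Q\cap\{u\ge u_1,\ v\ge u_1+R\}}\int_{\mathbb S^2}\frac{|\phi|^2+r^2|\partial_u\phi|^2+r^2|\partial_v\phi|^2}{(1+r)^\sigma}\,d\omega\,du\,dv\le C_\sigma E[\phi](u_1)\qquad(u_0\le u_1\le u_F,\ u_1<\infty).$$ Then for every admissible solution $\phi$ one has $\tilde E_{p_{high}}[\phi_0](u_0)<\infty$ and, for all finite $u$ with $u_0\le u\le u_F$ and all $0\le q\le p_{high}-1$, $$\tilde E_{p_{high}}[\phi_0](u)\le C\,\tilde E_{p_{high}}[\phi_0](u_0)\,u^{2\delta},\qquad \tilde E_q[\phi_0](u)\le C\,\tilde E_{p_{high}}[\phi_0](u_0)\,u^{-p_{high}+2\delta+q}.$$ -/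

import Mathlib

open MeasureTheory Filter Topology Asymptotics Set
open scoped ENNReal Manifold

noncomputable section

namespace CriticalWave

/-- Euclidean three-space. -/
abbrev E3 : Type := EuclideanSpace ℝ (Fin 3)

/-- The unit sphere `S²`, with Mathlib's manifold structure. -/
abbrev S2 : Type := Metric.sphere (0 : E3) 1

/-- The area measure `dσ` of the round unit sphere. -/
def areaS2 : Measure S2 := (volume : Measure E3).toSphere

/-! ### Angular derivatives -/

/-- Rotation of three-space by the angle `t` about the `i`-th coordinate axis. -/
def rotVec (i : Fin 3) (t : ℝ) (x : E3) : E3 :=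
  WithLp.toLp 2 fun m =>
    if m = i + 1 then Real.cos t * x (i + 1) - Real.sin t * x (i + 2)
    else if m = i + 2 then Real.sin t * x (i + 1) + Real.cos t * x (i + 2)
    else x m

theorem norm_rotVec (i : Fin 3) (t : ℝ) (x : E3) : ‖rotVec i t x‖ = ‖x‖ := by
  have h := Real.sin_sq_add_cos_sq t
  rw [EuclideanSpace.norm_eq, EuclideanSpace.norm_eq]
  congr 1
  fin_cases i <;> simp [Fin.sum_univ_three, rotVec]
  · linear_combination (x 1 ^ 2 + x 2 ^ 2) * h
  · linear_combination (x 2 ^ 2 + x 0 ^ 2) * h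
  · linear_combination (x 0 ^ 2 + x 1 ^ 2) * h

/-- The rotation acting on the sphere. -/
def rot (i : Fin 3) (t : ℝ) (θ : S2) : S2 :=
  ⟨rotVec i t θ, by
    have h := θ.2
    rw [mem_sphere_zero_iff_norm] at h ⊢
    rw [norm_rotVec, h]⟩

/-- The `i`-th rotation vector field of the sphere, applied to the function `f`. -/
def rotD (i : Fin 3) (f : S2 → ℝ) (θ : S2) : ℝ :=
  deriv (fun t : ℝ => f (rot i t θ)) 0

/-- The Laplace-Beltrami operator of the unit sphere: the sum of the squares of the three
rotation vector fields. -/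
def lapS2 (f : S2 → ℝ) (θ : S2) : ℝ := ∑ i : Fin 3, rotD i (rotD i f) θ

/-- The square `|∇f|²` of the length of the gradient on the unit sphere: at each point, the sum
of the squares of the derivatives along the three rotation fields. -/
def gradSqS2 (f : S2 → ℝ) (θ : S2) : ℝ := ∑ i : Fin 3, (rotD i f θ) ^ 2

/-- Iterated rotation derivatives; the words `β` of length `m` span the angular derivatives of
order `m`. -/
def rotDs (β : List (Fin 3)) (f : S2 → ℝ) : S2 → ℝ := β.foldr rotD f

/-! ### Functions of `(u, v)` and of `(u, v, θ)` -/

/-- `∂_u` of a function of `(u, v)`. -/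
def pu (f : ℝ → ℝ → ℝ) (u v : ℝ) : ℝ := deriv (fun s => f s v) u

/-- `∂_v` of a function of `(u, v)`. -/
def pv (f : ℝ → ℝ → ℝ) (u v : ℝ) : ℝ := deriv (fun s => f u s) v

/-- The function `(u, v) ↦ φ(u, v, θ)` for a fixed `θ`. -/
def atAngle (φ : ℝ → ℝ → S2 → ℝ) (θ : S2) (u v : ℝ) : ℝ := φ u v θ

/-- The spherical average `φ₀`, as a function that does not depend on `θ`. -/
def sphAvg (φ : ℝ → ℝ → S2 → ℝ) : ℝ → ℝ → S2 → ℝ := fun u v _ => ⨍ θ, φ u v θ ∂areaS2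

/-- The domain, the metric `g = -Ω² du dv + r² dσ`, and the coefficients of the wave equation.
`dom` is the domain in the `(u, v)` plane, lying in `u₀ ≤ u ≤ u_F`, `v ≥ v₀`; it is the whole
rectangle in the simplest case, but may also stop at a centre of symmetry. -/
structure Background where
  u0 : ℝ
  uF : EReal
  v0 : ℝ
  dom : Set (ℝ × ℝ)
  r : ℝ → ℝ → ℝ
  Om2 : ℝ → ℝ → ℝ
  w0 : ℝ → ℝ → ℝ
  w1 : ℝ → ℝ → ℝ
  q : ℝ → ℝ → ℝ
  W0 : ℝ → ℝ → ℝ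
  W1 : ℝ → ℝ → ℝ
  Q : ℝ → ℝ → ℝ

/-- `f = O(1)` as `v - u → ∞` in the domain. -/
def Background.Bdd (B : Background) (f : ℝ → ℝ → ℝ) : Prop :=
  ∃ C R : ℝ, ∀ u v : ℝ, (u, v) ∈ B.dom → R ≤ v - u → |f u v| ≤ C

/-- `f = o(1)` as `v - u → ∞` in the domain. -/
def Background.Small (B : Background) (f : ℝ → ℝ → ℝ) : Prop :=
  ∀ κ : ℝ, 0 < κ → ∃ R : ℝ, ∀ u v : ℝ, (u, v) ∈ B.dom → R ≤ v - u → |f u v| ≤ κ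

/-- The domain contains the outgoing initial cone and the region of large `v - u`, and the
coefficients are regular. -/
structure Background.Regular (B : Background) : Prop where
  one_lt_u0 : 1 < B.u0
  dom_meas : MeasurableSet B.dom
  dom_sub : ∀ u v : ℝ, (u, v) ∈ B.dom → B.u0 ≤ u ∧ (u : EReal) ≤ B.uF ∧ B.v0 ≤ v
  dom_cone : ∀ v : ℝ, B.v0 ≤ v → (B.u0, v) ∈ B.dom
  dom_far : ∃ R : ℝ, ∀ u v : ℝ, B.u0 ≤ u → (u : EReal) ≤ B.uF → R ≤ v - u → (u, v) ∈ B.dom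
  r_pos : ∀ u v : ℝ, (u, v) ∈ B.dom → 0 < B.r u v
  Om2_pos : ∀ u v : ℝ, (u, v) ∈ B.dom → 0 < B.Om2 u v
  r_reg : ∀ x ∈ B.dom, ContDiffAt ℝ 3 (fun y : ℝ × ℝ => B.r y.1 y.2) x
  Om2_reg : ∀ x ∈ B.dom, ContDiffAt ℝ 1 (fun y : ℝ × ℝ => B.Om2 y.1 y.2) x
  coeff_reg : ∀ f ∈ [B.w0, B.w1, B.q, B.W0, B.W1, B.Q], ∀ x ∈ B.dom,
    ContDiffAt ℝ 1 (fun y : ℝ × ℝ => f y.1 y.2) x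

/-- Asymptotic flatness. The first field says that `r` is comparable to `v - u` wherever one of
the two is large. -/
structure Background.AsympFlat (B : Background) : Prop where
  r_comparable : ∃ c R : ℝ, 0 < c ∧ ∀ u v : ℝ, (u, v) ∈ B.dom → (R ≤ B.r u v ∨ R ≤ v - u) →
    v - u ≤ c * B.r u v ∧ B.r u v ≤ c * (v - u)
  pu_r : B.Bdd fun u v => B.r u v * (1 + pu B.r u v)
  pv_r : B.Bdd fun u v => B.r u v * (1 - pv B.r u v)
  Om2_four : B.Bdd fun u v => B.r u v * (B.Om2 u v - 4)
  pv_Om2 : B.Bdd fun u v => B.r u v ^ 2 * pv B.Om2 u v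
  pvv_r : B.Bdd fun u v => B.r u v ^ 2 * pv (pv B.r) u v
  puv_r : B.Bdd fun u v => B.r u v ^ 2 * pu (pv B.r) u v
  puvv_r : B.Bdd fun u v => B.r u v ^ 2 * pu (pv (pv B.r)) u v

/-- The coefficients are scale-critical. -/
structure Background.ScaleCritical (B : Background) : Prop where
  w0_bdd : B.Bdd B.w0
  w1_bdd : B.Bdd B.w1
  q_bdd : B.Bdd B.q
  pv_w0 : B.Bdd fun u v => B.r u v * pv B.w0 u v
  pv_q : B.Bdd fun u v => B.r u v ^ 2 * pv B.q u v
  W0_small : B.Small B.W0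
  W1_small : B.Small B.W1
  Q_small : B.Small B.Q
  pv_W0 : B.Small fun u v => B.r u v * pv B.W0 u v
  pv_W1 : B.Small fun u v => B.r u v ^ 2 * pv B.W1 u v
  pv_Q : B.Small fun u v => B.r u v ^ 2 * pv B.Q u v

/-- The wave operator of `g = -Ω² du dv + r² dσ`, in divergence form. -/
def Background.box (B : Background) (φ : ℝ → ℝ → S2 → ℝ) (u v : ℝ) (θ : S2) : ℝ :=
  -(2 / (B.Om2 u v * B.r u v ^ 2)) *
      (pu (fun u' v' => B.r u' v' ^ 2 * pv (atAngle φ θ) u' v') u v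
        + pv (fun u' v' => B.r u' v' ^ 2 * pu (atAngle φ θ) u' v') u v)
    + lapS2 (φ u v) θ / B.r u v ^ 2

/-- The right-hand side of the wave equation. -/
def Background.source (B : Background) (ε : ℝ) (φ : ℝ → ℝ → S2 → ℝ) (u v : ℝ) (θ : S2) : ℝ :=
  1 / B.r u v ^ 2 *
    ((ε * B.w0 u v + B.W0 u v) * φ u v θ
      + (ε * B.w1 u v + B.W1 u v) * pu (atAngle φ θ) u v
      + (ε * B.q u v + B.Q u v) * (B.r u v * pv (atAngle φ θ) u v))

/-! ### Energies -/

/-- The energy `E[φ](u)` on the V-shaped hypersurface made of the outgoing cone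
`{u} × {v ≥ u + R}` and the ingoing cone `{u' ≥ u, v = u + R}` (inside the domain). -/
def Background.energy (B : Background) (R : ℝ) (φ : ℝ → ℝ → S2 → ℝ) (u : ℝ) : ℝ≥0∞ :=
  (∫⁻ v in Ici (u + R), ∫⁻ θ, ENNReal.ofReal
      (B.r u v ^ 2 * pv (atAngle φ θ) u v ^ 2 + gradSqS2 (φ u v) θ) ∂areaS2)
  + ∫⁻ u' in {u' : ℝ | u ≤ u' ∧ (u', u + R) ∈ B.dom}, ∫⁻ θ, ENNReal.ofReal
      (B.r u' (u + R) ^ 2 * pu (atAngle φ θ) u' (u + R) ^ 2 + gradSqS2 (φ u' (u + R)) θ) ∂areaS2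

/-- The radiation field `ψ = r φ`. -/
def Background.rad (B : Background) (φ : ℝ → ℝ → S2 → ℝ) : ℝ → ℝ → S2 → ℝ :=
  fun u v θ => B.r u v * φ u v θ

/-- The `r^p`-weighted energy `E_p[ψ](u)` on the outgoing cone. -/
def Background.rpEnergy (B : Background) (R p : ℝ) (ψ : ℝ → ℝ → S2 → ℝ) (u : ℝ) : ℝ≥0∞ :=
  ∫⁻ v in Ici (u + R), ∫⁻ θ, ENNReal.ofReal
    (B.r u v ^ p * pv (atAngle ψ θ) u v ^ 2) ∂areaS2

/-- `Ẽ_p[φ](u) = E_p[r φ](u) + E[φ](u)`. -/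
def Background.totEnergy (B : Background) (R p : ℝ) (φ : ℝ → ℝ → S2 → ℝ) (u : ℝ) : ℝ≥0∞ :=
  B.rpEnergy R p (B.rad φ) u + B.energy R φ u

/-! ### Solutions and the two black-box estimates -/

/-- `φ` is a `C^k` solution on the domain, of finite energy, whose data on the outgoing initial
cone have finite weighted norms for all `0 ≤ p < 3`. -/
structure Background.IsSolution (B : Background) (k : ℕ∞) (ε R : ℝ) (φ : ℝ → ℝ → S2 → ℝ) :
    Prop where
  reg : ∀ u v : ℝ, (u, v) ∈ B.dom → ∀ θ : S2,
    ContMDiffAt (𝓘(ℝ, ℝ × ℝ).prod (𝓡 2)) 𝓘(ℝ, ℝ) k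
      (fun x : (ℝ × ℝ) × S2 => φ x.1.1 x.1.2 x.2) ((u, v), θ)
  eqn : ∀ u v : ℝ, (u, v) ∈ B.dom → ∀ θ : S2, B.box φ u v θ = B.source ε φ u v θ
  finite : ∀ u : ℝ, B.u0 ≤ u → (u : EReal) ≤ B.uF → B.energy R φ u < ⊤
  data_angular : ∀ p : ℝ, 0 ≤ p → p < 3 → ∀ β : List (Fin 3), β.length ≤ 2 →
    (∫⁻ v in Ici B.v0, ∫⁻ θ, ENNReal.ofReal (B.r B.u0 v ^ (p + β.length) *
      deriv (fun v' => B.r B.u0 v' * rotDs β (φ B.u0 v') θ) v ^ 2) ∂areaS2) < ⊤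
  data_radial : ∀ p : ℝ, 0 ≤ p → p < 3 → ∀ j : ℕ, j ≤ 1 →
    (∫⁻ v in Ici B.v0, ∫⁻ θ, ENNReal.ofReal (B.r B.u0 v ^ (p + 2 * j) *
      iteratedDeriv (1 + j) (fun v' => B.r B.u0 v' * φ B.u0 v' θ) v ^ 2) ∂areaS2) < ⊤

/-- Boundedness of the energy with constant `D`. -/
def Background.EnergyBounded (B : Background) (R D : ℝ) (φ : ℝ → ℝ → S2 → ℝ) : Prop :=
  ∀ u₁ u₂ : ℝ, B.u0 ≤ u₁ → u₁ < u₂ → (u₂ : EReal) ≤ B.uF →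
    B.energy R φ u₂ ≤ ENNReal.ofReal D * B.energy R φ u₁

/-- Integrated local energy decay with weight `(1 + r)^{-σ}` and constant `Cσ`, on the part
`u ≥ u₁`, `v ≥ u₁ + R` of the domain, which is the future of the hypersurface carrying the energy
at `u₁`. -/
def Background.LocalDecay (B : Background) (R σ Cσ : ℝ) (φ : ℝ → ℝ → S2 → ℝ) : Prop :=
  ∀ u₁ : ℝ, B.u0 ≤ u₁ → (u₁ : EReal) ≤ B.uF →
    (∫⁻ x in {x : ℝ × ℝ | x ∈ B.dom ∧ u₁ ≤ x.1 ∧ u₁ + R ≤ x.2}, ∫⁻ θ, ENNReal.ofReal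
      ((φ x.1 x.2 θ ^ 2 + B.r x.1 x.2 ^ 2 * pu (atAngle φ θ) x.1 x.2 ^ 2
          + B.r x.1 x.2 ^ 2 * pv (atAngle φ θ) x.1 x.2 ^ 2) / (1 + B.r x.1 x.2) ^ σ) ∂areaS2)
      ≤ ENNReal.ofReal Cσ * B.energy R φ u₁

end CriticalWave

end

/-! The metric and the coefficients do not depend on the angle. Averaging the equation over the
sphere therefore kills the angular Laplacian and leaves φ₀ solving the same equation, while Jensen's
inequality transfers finiteness of energy and data (`IsSolution.sphAvg`). Both black-box estimates
thus apply to φ₀ itself, and the problem becomes one for ψ = rφ₀ in the (u,v) plane. For v - u ≥ R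
one has ∂_u∂_vψ = F with |F| ≤ a(|ψ_v|/r + |ψ|/r² + |ψ_u|/r²), where a is a fixed multiple of |ε|:
the o(1) coefficients and the curvature of r are absorbed into |ε| by taking R₀(ε) large
(`exists_farBounds`, `abs_mixed_le`).

The engine is the r^q method: ∂_u(r^q ψ_v²) = q r^{q-1} r_u ψ_v² + 2r^q ψ_v F, and the first term is
a negative bulk term since r_u is close to -1. For q = 2-m, weighted Hardy inequalities for ψ, and
for ψ_u whose v-derivative is again F, absorb the error once a is small compared with m. For q = 3-m
the same splitting would produce ψ² with weight r^{-m}, out of reach of Hardy. Young's inequality at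
the scale u produces instead (a/u) r^{3-m} ψ_v² and u times a quantity controlled by the q = 2-m
estimate. Hence 2E_{3-m} + u E_{2-m} closes up to a Grönwall factor u^γ with γ ≥ a (`top_estimate`).
The Hardy constant is of size m^{-2}, so a ≲ m² is needed, and this is where the loss √|ε| comes
from. On the curve v = u + R the flux has a sign (`transport`), and traces are bounded by the energy
in a strip of unit width, which local decay controls.

For decay, the q = 1 estimate with weight u^b and the tail form of the local decay estimate bound ∫
u^b E du by integrals with weight u^{b-1}. Climbing through b = 0, 1-m, 2-m (`growth`) and using
that the energy is almost nonincreasing gives E(U) ≲ U^{-(3-m)+γ} (`energy_decay`). Interpolating at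
r ~ U between E_0 and E_{2-m} ≲ U^{-1+γ} yields all 0 ≤ q ≤ 2-m. Here E_0 is recovered from the flux
of φ₀ by a Hardy inequality whose boundary term at infinity vanishes because E_2 is finite
(`coneEnergy_zero_le`). The parameters m and γ enter only through exponents, so the final constant
is independent of ε. -/

noncomputable section

namespace CriticalWave

/-! ### Smooth functions on the sphere with parameters -/

section
variable {X V : Type} [NormedAddCommGroup X] [NormedSpace ℝ X]
  [NormedAddCommGroup V] [NormedSpace ℝ V]

/-- `Φ` is jointly `C^n` at every point of `{x} × S²`. -/
def SmoothAlong (n : WithTop ℕ∞) (Φ : X → S2 → V) (x : X) : Prop :=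
  ∀ θ : S2, ContMDiffAt (𝓘(ℝ, X).prod (𝓡 2)) 𝓘(ℝ, V) n (fun p : X × S2 => Φ p.1 p.2) (x, θ)

/-- Only the linear variable is differentiated; the angle is carried along as the parameter of
`ContMDiffAt.mfderiv`, and tangent coordinates on a vector space are trivial. -/
theorem SmoothAlong.fderiv {n m : WithTop ℕ∞} {Φ : X → S2 → V} {x : X}
    (h : SmoothAlong n Φ x) (hmn : m + 1 ≤ n) :
    SmoothAlong m (fun y θ => fderiv ℝ (fun z => Φ z θ) y) x := by
  intro θ
  have := ContMDiffAt.mfderiv (I := 𝓘(ℝ, X)) (I' := 𝓘(ℝ, V)) (J := 𝓘(ℝ, X).prod (𝓡 2))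
    (N := X × S2) (M := X) (M' := V) (m := m) (n := n) (x₀ := (x, θ))
    (fun p z => Φ z p.2) (fun p => p.1) ?_ contMDiffAt_fst hmn
  · simp only [inTangentCoordinates_model_space, mfderiv_eq_fderiv] at this
    exact this
  · exact ContMDiffAt.comp (x := ((x, θ), x)) (I' := 𝓘(ℝ, X).prod (𝓡 2)) (f := fun q : (X × S2) × X => (q.2, q.1.2)) (h θ)
      (contMDiffAt_snd.prodMk (contMDiffAt_snd.comp _ contMDiffAt_fst))

theorem SmoothAlong.of_le {n m : WithTop ℕ∞} {Φ : X → S2 → V} {x : X}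
    (h : SmoothAlong n Φ x) (hmn : m ≤ n) : SmoothAlong m Φ x := fun θ => (h θ).of_le hmn

/-- Compactness of the sphere makes the neighbourhoods of the points (x, θ) uniform in θ. The order
is finite because smoothness of infinite order at a point need not spread to a neighbourhood. -/
theorem SmoothAlong.eventually {n : ℕ} {Φ : X → S2 → V} {x : X}
    (h : SmoothAlong n Φ x) : ∀ᶠ y in 𝓝 x, SmoothAlong n Φ y := by
  have := isCompact_univ.eventually_forall_of_forall_eventually (X := X) (Y := S2) (x₀ := x)
    (P := fun y θ => ContMDiffAt (𝓘(ℝ, X).prod (𝓡 2)) 𝓘(ℝ, V) n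
      (fun p : X × S2 => Φ p.1 p.2) (y, θ)) fun θ _ =>
      (contMDiffAt_iff_contMDiffAt_nhds (by simp)).1 (h θ)
  filter_upwards [this] with y hy θ using hy θ (mem_univ θ)

theorem SmoothAlong.continuous {n : WithTop ℕ∞} {Φ : X → S2 → V} {x : X}
    (h : SmoothAlong n Φ x) : Continuous (Φ x) :=
  continuous_iff_continuousAt.2 fun θ =>
    ContinuousAt.comp (f := fun θ : S2 => (x, θ)) (h θ).continuousAt (by fun_prop)

theorem SmoothAlong.contDiffAt {n : WithTop ℕ∞} {Φ : X → S2 → V} {x : X}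
    (h : SmoothAlong n Φ x) (θ : S2) : ContDiffAt ℝ n (fun y => Φ y θ) x :=
  contMDiffAt_iff_contDiffAt.1 (ContMDiffAt.comp (x := x) (I' := 𝓘(ℝ, X).prod (𝓡 2))
    (f := fun y : X => (y, θ)) (h θ) (contMDiffAt_id.prodMk contMDiffAt_const))

instance : IsFiniteMeasure areaS2 := by unfold areaS2; infer_instance

omit [NormedSpace ℝ V] in
theorem integrable_of_continuous_S2 {g : S2 → V} (hg : Continuous g) : Integrable g areaS2 :=
  hg.integrable_of_hasCompactSupport (HasCompactSupport.of_compactSpace g)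

theorem SmoothAlong.eventually_norm_le {Φ : X → S2 → V} {x : X} (h : SmoothAlong 0 Φ x) :
    ∃ C : ℝ, ∀ᶠ y in 𝓝 x, ∀ θ, ‖Φ y θ‖ ≤ C := by
  obtain ⟨C, hC⟩ := isCompact_univ.exists_bound_of_continuousOn (f := Φ x) h.continuous.continuousOn
  refine ⟨C + 1, ?_⟩
  have := isCompact_univ.eventually_forall_of_forall_eventually (X := X) (Y := S2) (x₀ := x)
    (P := fun y θ => ‖Φ y θ‖ ≤ C + 1) fun θ _ => by
      have := (h θ).continuousAt.norm.eventually_lt_const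
        (show ‖Φ x θ‖ < C + 1 by linarith [hC θ (mem_univ θ)])
      filter_upwards [this] with z hz using hz.le
  filter_upwards [this] with y hy θ using hy θ (mem_univ θ)

theorem SmoothAlong.hasFDerivAt_integral {Φ : X → S2 → V} {x : X}
    (h : SmoothAlong 1 Φ x) : HasFDerivAt (fun y => ∫ θ, Φ y θ ∂areaS2)
      (∫ θ, _root_.fderiv ℝ (fun z => Φ z θ) x ∂areaS2) x := by
  have h0 : SmoothAlong 0 (fun y θ => _root_.fderiv ℝ (fun z => Φ z θ) y) x :=
    h.fderiv (by simp)
  obtain ⟨C, hC⟩ := h0.eventually_norm_le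
  have h1 : ∀ᶠ y in 𝓝 x, SmoothAlong 1 Φ y := SmoothAlong.eventually (n := 1) (by simpa using h)
  refine hasFDerivAt_integral_of_dominated_of_fderiv_le (bound := fun _ => C) (hC.and h1) ?_
    (integrable_of_continuous_S2 h.continuous) ?_ (ae_of_all _ fun θ y hy => hy.1 θ)
    (integrable_const _) (ae_of_all _ fun θ y hy =>
      ((hy.2.contDiffAt θ).differentiableAt (by simp)).hasFDerivAt)
  · filter_upwards [h1] with y hy using (integrable_of_continuous_S2 hy.continuous).1
  · exact (integrable_of_continuous_S2 h0.continuous).1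

/-- Differentiation under the integral sign, by induction on the order. The target space is
quantified inside the induction because the derivative takes values in a space of linear maps. -/
theorem SmoothAlong.contDiffAt_integral_nat (n : ℕ) : ∀ {V : Type} [NormedAddCommGroup V]
    [NormedSpace ℝ V] {Φ : X → S2 → V} {x : X}, SmoothAlong n Φ x →
    ContDiffAt ℝ n (fun y => ∫ θ, Φ y θ ∂areaS2) x := by
  induction n with
  | zero =>
    intro V _ _ Φ x h
    have h1 : ∀ᶠ y in 𝓝 x, SmoothAlong 0 Φ y :=
      SmoothAlong.eventually (n := 0) (by simpa using h)
    simp only [Nat.cast_zero]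
    rw [contDiffAt_zero]
    refine ⟨_, h1, fun y hy => ContinuousAt.continuousWithinAt ?_⟩
    obtain ⟨C, hC⟩ := SmoothAlong.eventually_norm_le (Φ := Φ) (x := y) hy
    refine continuousAt_of_dominated (bound := fun _ => C) ?_
      (hC.mono fun z hz => ae_of_all _ hz) (integrable_const _)
      (ae_of_all _ fun θ => (SmoothAlong.contDiffAt hy θ).continuousAt)
    filter_upwards [SmoothAlong.eventually (n := 0) (Φ := Φ) (x := y) (by simpa using hy)] with z hz
    exact (integrable_of_continuous_S2 hz.continuous).1
  | succ n ih =>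
    intro V _ _ Φ x h
    rw [Nat.cast_add, Nat.cast_one, contDiffAt_succ_iff_hasFDerivAt]
    refine ⟨fun y => ∫ θ, _root_.fderiv ℝ (fun z => Φ z θ) y ∂areaS2,
      ⟨_, h.eventually, fun y hy => SmoothAlong.hasFDerivAt_integral ?_⟩, ih (h.fderiv (by simp))⟩
    exact SmoothAlong.of_le hy (by simp)

theorem SmoothAlong.contDiffAt_integral {k : ℕ∞} {Φ : X → S2 → V} {x : X}
    (h : SmoothAlong k Φ x) : ContDiffAt ℝ k (fun y => ∫ θ, Φ y θ ∂areaS2) x := by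
  rw [← contDiffWithinAt_univ, contDiffWithinAt_iff_forall_nat_le]
  intro m hm
  rw [contDiffWithinAt_univ]
  exact SmoothAlong.contDiffAt_integral_nat m (h.of_le (by exact_mod_cast hm))

/-! ### Rotations -/

theorem contDiff_rotVec (i : Fin 3) : ContDiff ℝ ⊤ (fun p : ℝ × E3 => rotVec i p.1 p.2) := by
  rw [contDiff_euclidean]
  intro m
  simp only [rotVec]
  have h (j : Fin 3) : ContDiff ℝ ⊤ (fun p : ℝ × E3 => p.2 j) := by fun_prop
  have h1 := Real.contDiff_cos (n := ⊤) |>.comp (contDiff_fst : ContDiff ℝ ⊤ (fun p : ℝ × E3 => p.1))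
  have h2 := Real.contDiff_sin (n := ⊤) |>.comp (contDiff_fst : ContDiff ℝ ⊤ (fun p : ℝ × E3 => p.1))
  split_ifs
  · exact (h1.mul (h _)).sub (h2.mul (h _))
  · exact (h2.mul (h _)).add (h1.mul (h _))
  · exact h _

theorem rotVec_add (i : Fin 3) (s t : ℝ) (x : E3) :
    rotVec i (s + t) x = rotVec i s (rotVec i t x) := by
  ext m
  fin_cases i <;> fin_cases m <;> simp [rotVec, Real.cos_add, Real.sin_add] <;> ring

theorem rotVec_zero (i : Fin 3) (x : E3) : rotVec i 0 x = x := by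
  ext m
  fin_cases i <;> fin_cases m <;> simp [rotVec]

def rotIso (i : Fin 3) (t : ℝ) : E3 ≃ₗᵢ[ℝ] E3 where
  toFun := rotVec i t
  invFun := rotVec i (-t)
  map_add' x y := by
    ext m
    fin_cases i <;> fin_cases m <;> simp [rotVec] <;> ring
  map_smul' c x := by
    ext m
    fin_cases i <;> fin_cases m <;> simp [rotVec] <;> ring
  left_inv x := by rw [← rotVec_add, neg_add_cancel, rotVec_zero]
  right_inv x := by rw [← rotVec_add, add_neg_cancel, rotVec_zero]
  norm_map' := norm_rotVec i t

theorem contMDiff_prod_coe (n : WithTop ℕ∞) :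
    ContMDiff (𝓘(ℝ, ℝ).prod (𝓡 2)) 𝓘(ℝ, ℝ × E3) n (fun p : ℝ × S2 => (p.1, (p.2 : E3))) := by
  have : Fact (Module.finrank ℝ E3 = 2 + 1) := ⟨by simp⟩
  have h : ContMDiff (𝓡 2) 𝓘(ℝ, E3) n ((↑) : S2 → E3) := contMDiff_coe_sphere
  exact contMDiff_fst.prodMk_space (h.comp contMDiff_snd)

theorem contMDiff_rotVec_coe (n : WithTop ℕ∞) (i : Fin 3) :
    ContMDiff (𝓘(ℝ, ℝ).prod (𝓡 2)) 𝓘(ℝ, E3) n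
      (fun p : ℝ × S2 => rotVec i p.1 (p.2 : E3)) :=
  ContMDiff.comp (g := fun p : ℝ × E3 => rotVec i p.1 p.2)
    (f := fun p : ℝ × S2 => (p.1, (p.2 : E3)))
    ((contDiff_rotVec i).of_le le_top).contMDiff (contMDiff_prod_coe n)

theorem contMDiff_rot (n : WithTop ℕ∞) (i : Fin 3) :
    ContMDiff (𝓘(ℝ, ℝ).prod (𝓡 2)) (𝓡 2) n (fun p : ℝ × S2 => rot i p.1 p.2) := by
  have : Fact (Module.finrank ℝ E3 = 2 + 1) := ⟨by simp⟩
  exact ContMDiff.codRestrict_sphere (contMDiff_rotVec_coe n i) fun p => (rot i p.1 p.2).2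

open scoped Pointwise in
-- The sphere measure of a set is, up to a factor, the volume of the cone over it. A rotation is a
-- linear isometry, so it maps cones to cones and preserves their volume.
theorem measurePreserving_rot (i : Fin 3) (t : ℝ) :
    MeasurePreserving (rot i t) areaS2 areaS2 := by
  have hc : Continuous (rot i t) := by
    have := (contMDiff_rot 0 i).continuous
    exact this.comp (f := fun θ => (t, θ)) (by fun_prop)
  refine ⟨hc.measurable, ?_⟩
  ext s hs
  rw [Measure.map_apply hc.measurable hs, areaS2, Measure.toSphere_apply' _ (hc.measurable hs),
    Measure.toSphere_apply' _ hs]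
  congr 1
  have key := (rotIso i t).measurePreserving.measure_preimage_equiv
    (f := (rotIso i t).toMeasurableEquiv) (Ioo (0 : ℝ) 1 • (((↑) : S2 → E3) '' s))
  refine Eq.trans ?_ key
  congr 1
  ext x
  simp only [Set.mem_smul, mem_image, mem_preimage]
  constructor
  · rintro ⟨c, hc, y, ⟨θ, hθ, rfl⟩, rfl⟩
    exact ⟨c, hc, _, ⟨_, hθ, rfl⟩, ((rotIso i t).map_smul c (θ : E3)).symm⟩
  · rintro ⟨c, hc, y, ⟨θ, hθ, rfl⟩, h⟩
    have h2 : rot i t (rot i (-t) θ) = θ := Subtype.ext (by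
      change rotVec i t (rotVec i (-t) θ) = θ
      rw [← rotVec_add, add_neg_cancel, rotVec_zero])
    refine ⟨c, hc, _, ⟨rot i (-t) θ, by rwa [h2], rfl⟩, ?_⟩
    apply (rotIso i t).injective
    rw [(rotIso i t).map_smul]
    have h3 : (rotIso i t) (rot i (-t) θ : E3) = θ := congrArg Subtype.val h2
    rw [h3]; exact h

theorem rotD_eq_fderiv (i : Fin 3) (g : S2 → ℝ) (θ : S2) :
    rotD i g θ = fderiv ℝ (fun t : ℝ => g (rot i t θ)) 0 1 := by
  rw [rotD, fderiv_apply_one_eq_deriv]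

theorem smoothAlong_rot {n : WithTop ℕ∞} {g : S2 → ℝ} (hg : ContMDiff (𝓡 2) 𝓘(ℝ, ℝ) n g)
    (i : Fin 3) (t : ℝ) : SmoothAlong n (fun (t : ℝ) θ => g (rot i t θ)) t := fun _ =>
  (hg.comp (contMDiff_rot n i)).contMDiffAt

theorem contMDiff_rotD {n m : WithTop ℕ∞} {g : S2 → ℝ} (hg : ContMDiff (𝓡 2) 𝓘(ℝ, ℝ) n g)
    (hmn : m + 1 ≤ n) (i : Fin 3) : ContMDiff (𝓡 2) 𝓘(ℝ, ℝ) m (rotD i g) := by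
  intro θ
  have h1 := (smoothAlong_rot hg i 0).fderiv hmn θ
  have h2 : ContMDiffAt (𝓡 2) 𝓘(ℝ, ℝ →L[ℝ] ℝ) m
      (fun θ => fderiv ℝ (fun t : ℝ => g (rot i t θ)) 0) θ :=
    ContMDiffAt.comp (x := θ) (I' := 𝓘(ℝ, ℝ).prod (𝓡 2))
      (f := fun θ : S2 => ((0 : ℝ), θ)) h1 (contMDiffAt_const.prodMk contMDiffAt_id)
  have h3 : ContMDiffAt (𝓡 2) 𝓘(ℝ, ℝ) m
      (fun θ => fderiv ℝ (fun t : ℝ => g (rot i t θ)) 0 1) θ :=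
    h2.clm_apply contMDiffAt_const
  exact h3.congr_of_eventuallyEq (Eventually.of_forall fun θ => rotD_eq_fderiv i g θ)

/-- By rotation invariance, t ↦ ∫ g(rot t θ) is constant; its derivative at 0 is the integral in
question. -/
theorem integral_rotD {g : S2 → ℝ} (hg : ContMDiff (𝓡 2) 𝓘(ℝ, ℝ) 1 g) (i : Fin 3) :
    ∫ θ, rotD i g θ ∂areaS2 = 0 := by
  have h := smoothAlong_rot hg i 0
  have h1 := h.hasFDerivAt_integral
  have h2 : (fun t : ℝ => ∫ θ, g (rot i t θ) ∂areaS2) = fun _ => ∫ θ, g θ ∂areaS2 := by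
    ext t
    have hm := measurePreserving_rot i t
    rw [← integral_map (μ := areaS2) hm.measurable.aemeasurable (f := g)
      (hg.continuous.aestronglyMeasurable), hm.map_eq]
  rw [h2] at h1
  have h4 := h1.unique (hasFDerivAt_const _ _)
  have h5 := congrArg (fun L : ℝ →L[ℝ] ℝ => L 1) h4
  simp only [_root_.zero_apply] at h5
  rw [ContinuousLinearMap.integral_apply] at h5
  · simpa only [rotD_eq_fderiv] using h5
  · exact integrable_of_continuous_S2 (h.fderiv (m := 0) (by simp)).continuous

theorem integral_lapS2 {g : S2 → ℝ} (hg : ContMDiff (𝓡 2) 𝓘(ℝ, ℝ) 2 g) :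
    ∫ θ, lapS2 g θ ∂areaS2 = 0 := by
  have h (i : Fin 3) : ContMDiff (𝓡 2) 𝓘(ℝ, ℝ) 1 (rotD i g) := contMDiff_rotD hg (by norm_num) i
  simp only [lapS2]
  rw [integral_finsetSum]
  · exact Finset.sum_eq_zero fun i _ => integral_rotD (h i) i
  · exact fun i _ => integrable_of_continuous_S2 (contMDiff_rotD (h i) (m := 0) (by simp) i).continuous

theorem continuous_lapS2 {g : S2 → ℝ} (hg : ContMDiff (𝓡 2) 𝓘(ℝ, ℝ) 2 g) :
    Continuous (lapS2 g) := by
  have h (i : Fin 3) : ContMDiff (𝓡 2) 𝓘(ℝ, ℝ) 1 (rotD i g) := contMDiff_rotD hg (by norm_num) i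
  exact continuous_finsetSum _ fun i _ => (contMDiff_rotD (h i) (m := 0) (by simp) i).continuous

end

/-! ### Partial derivatives of functions of `(u, v)` -/

/-- `f` is jointly `C^n` at `(u, v)`. -/
def CD (n : WithTop ℕ∞) (f : ℝ → ℝ → ℝ) (u v : ℝ) : Prop :=
  ContDiffAt ℝ n (fun y : ℝ × ℝ => f y.1 y.2) (u, v)

section
variable {n m : WithTop ℕ∞} {f g : ℝ → ℝ → ℝ} {u v : ℝ}

theorem CD.of_le (h : CD n f u v) (hmn : m ≤ n) : CD m f u v := ContDiffAt.of_le h hmn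

theorem CD.hasFDerivAt (h : CD n f u v) (hn : n ≠ 0) :
    HasFDerivAt (fun y : ℝ × ℝ => f y.1 y.2) (fderiv ℝ (fun y : ℝ × ℝ => f y.1 y.2) (u, v)) (u, v) :=
  (ContDiffAt.differentiableAt h hn).hasFDerivAt

theorem hasDerivAt_mk_left (u v : ℝ) : HasDerivAt (fun s : ℝ => (s, v)) ((1, 0) : ℝ × ℝ) u :=
  (hasDerivAt_id u).prodMk (hasDerivAt_const u v)

theorem hasDerivAt_mk_right (u v : ℝ) : HasDerivAt (fun s : ℝ => (u, s)) ((0, 1) : ℝ × ℝ) v :=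
  (hasDerivAt_const v u).prodMk (hasDerivAt_id v)

theorem pu_eq_of_hasFDerivAt {L : ℝ × ℝ →L[ℝ] ℝ}
    (h : HasFDerivAt (fun y : ℝ × ℝ => f y.1 y.2) L (u, v)) : pu f u v = L (1, 0) :=
  (h.comp_hasDerivAt (f := fun s : ℝ => (s, v)) u (hasDerivAt_mk_left u v)).deriv

theorem pv_eq_of_hasFDerivAt {L : ℝ × ℝ →L[ℝ] ℝ}
    (h : HasFDerivAt (fun y : ℝ × ℝ => f y.1 y.2) L (u, v)) : pv f u v = L (0, 1) :=
  (h.comp_hasDerivAt v (hasDerivAt_mk_right u v)).deriv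

theorem CD.hasDerivAt_pu (h : CD n f u v) (hn : n ≠ 0) :
    HasDerivAt (fun s => f s v) (pu f u v) u :=
  ((h.hasFDerivAt hn).comp_hasDerivAt (f := fun s : ℝ => (s, v)) u
    (hasDerivAt_mk_left u v)).differentiableAt.hasDerivAt

theorem CD.hasDerivAt_pv (h : CD n f u v) (hn : n ≠ 0) :
    HasDerivAt (fun s => f u s) (pv f u v) v :=
  ((h.hasFDerivAt hn).comp_hasDerivAt v (hasDerivAt_mk_right u v)).differentiableAt.hasDerivAt

theorem CD.eventually {n : ℕ} (h : CD n f u v) : ∀ᶠ y : ℝ × ℝ in 𝓝 (u, v), CD n f y.1 y.2 :=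
  ContDiffAt.eventually h (by simp)

theorem CD.eventually_one (h : CD n f u v) (hn : 1 ≤ n) :
    ∀ᶠ y : ℝ × ℝ in 𝓝 (u, v), CD 1 f y.1 y.2 :=
  CD.eventually (n := 1) (h.of_le (by simpa using hn))

theorem CD.pu_eventuallyEq (h : CD n f u v) (hn : 1 ≤ n) :
    (fun y : ℝ × ℝ => pu f y.1 y.2) =ᶠ[𝓝 (u, v)]
      fun y => fderiv ℝ (fun y : ℝ × ℝ => f y.1 y.2) y (1, 0) := by
  filter_upwards [h.eventually_one hn] with y hy
  exact pu_eq_of_hasFDerivAt (hy.hasFDerivAt one_ne_zero)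

theorem CD.pv_eventuallyEq (h : CD n f u v) (hn : 1 ≤ n) :
    (fun y : ℝ × ℝ => pv f y.1 y.2) =ᶠ[𝓝 (u, v)]
      fun y => fderiv ℝ (fun y : ℝ × ℝ => f y.1 y.2) y (0, 1) := by
  filter_upwards [h.eventually_one hn] with y hy
  exact pv_eq_of_hasFDerivAt (hy.hasFDerivAt one_ne_zero)

theorem CD.pu (h : CD n f u v) (hmn : m + 1 ≤ n) : CD m (pu f) u v :=
  ((ContDiffAt.fderiv_right h hmn).clm_apply contDiffAt_const).congr_of_eventuallyEq
    (h.pu_eventuallyEq (le_trans (by simp) hmn))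

theorem CD.pv (h : CD n f u v) (hmn : m + 1 ≤ n) : CD m (pv f) u v :=
  ((ContDiffAt.fderiv_right h hmn).clm_apply contDiffAt_const).congr_of_eventuallyEq
    (h.pv_eventuallyEq (le_trans (by simp) hmn))

theorem pu_congr (h : ∀ᶠ y : ℝ × ℝ in 𝓝 (u, v), f y.1 y.2 = g y.1 y.2) :
    CriticalWave.pu f u v = CriticalWave.pu g u v :=
  Filter.EventuallyEq.deriv_eq ((hasDerivAt_mk_left u v).continuousAt.eventually h)

theorem CD.pv_pu (h : CD n f u v) (hn : 2 ≤ n) :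
    CriticalWave.pv (CriticalWave.pu f) u v = CriticalWave.pu (CriticalWave.pv f) u v := by
  have h1 : (1 : WithTop ℕ∞) ≤ n := le_trans (by norm_num) hn
  have hs := ContDiffAt.isSymmSndFDerivAt h (by simpa using hn)
  have hd : DifferentiableAt ℝ (fderiv ℝ (fun y : ℝ × ℝ => f y.1 y.2)) (u, v) :=
    (ContDiffAt.fderiv_right (m := 1) h (by simpa [one_add_one_eq_two] using hn)).differentiableAt
      one_ne_zero
  have e (w : ℝ × ℝ) : HasFDerivAt (fun y => fderiv ℝ (fun y : ℝ × ℝ => f y.1 y.2) y w)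
      ((fderiv ℝ (fderiv ℝ (fun y : ℝ × ℝ => f y.1 y.2)) (u, v)).flip w) (u, v) := by
    simpa using hd.hasFDerivAt.clm_apply (hasFDerivAt_const w (u, v))
  rw [pv_eq_of_hasFDerivAt ((e (1, 0)).congr_of_eventuallyEq (h.pu_eventuallyEq h1)),
    pu_eq_of_hasFDerivAt ((e (0, 1)).congr_of_eventuallyEq (h.pv_eventuallyEq h1))]
  exact hs (0, 1) (1, 0)

end

/-- The wave operator in terms of mixed derivatives. -/
theorem Background.box_eq (B : Background) {φ : ℝ → ℝ → S2 → ℝ} {u v : ℝ} {θ : S2}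
    (hr : CD 2 B.r u v) (hφ : CD 2 (atAngle φ θ) u v) (hr0 : B.r u v ≠ 0) :
    B.box φ u v θ = -(4 / (B.Om2 u v * B.r u v)) * (B.r u v * pu (pv (atAngle φ θ)) u v
      + pu B.r u v * pv (atAngle φ θ) u v + pv B.r u v * pu (atAngle φ θ) u v)
      + lapS2 (φ u v) θ / B.r u v ^ 2 := by
  have h1 : pu (fun u' v' => B.r u' v' ^ 2 * pv (atAngle φ θ) u' v') u v
      = 2 * B.r u v * pu B.r u v * pv (atAngle φ θ) u v
        + B.r u v ^ 2 * pu (pv (atAngle φ θ)) u v := by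
    have := ((hr.hasDerivAt_pu two_ne_zero).fun_pow 2).fun_mul
      ((hφ.pv (m := 1) (by norm_num)).hasDerivAt_pu one_ne_zero)
    rw [pu, this.deriv]; simp
  have h2 : pv (fun u' v' => B.r u' v' ^ 2 * pu (atAngle φ θ) u' v') u v
      = 2 * B.r u v * pv B.r u v * pu (atAngle φ θ) u v
        + B.r u v ^ 2 * pv (pu (atAngle φ θ)) u v := by
    have := ((hr.hasDerivAt_pv two_ne_zero).fun_pow 2).fun_mul
      ((hφ.pu (m := 1) (by norm_num)).hasDerivAt_pv one_ne_zero)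
    rw [pv, this.deriv]; simp
  rw [Background.box, h1, h2, hφ.pv_pu le_rfl]
  congr 1
  by_cases hO : B.Om2 u v = 0
  · simp [hO]
  · field_simp
    ring

/-! ### Spherical averages -/

/-- Jensen's inequality, read off from the nonnegativity of the variance ∫ (g - m)². The constant is
left under the integral so that both sides match energy densities. -/
theorem average_S2_sq_le {g : S2 → ℝ} (hg : Continuous g) {w : ℝ} (hw : 0 ≤ w) :
    ∫⁻ _, ENNReal.ofReal (w * (⨍ θ, g θ ∂areaS2) ^ 2) ∂areaS2
      ≤ ∫⁻ θ, ENNReal.ofReal (w * g θ ^ 2) ∂areaS2 := by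
  have hi {f : S2 → ℝ} (hf : Continuous f) := integrable_of_continuous_S2 hf
  set m := ⨍ θ, g θ ∂areaS2 with hm
  rw [← ofReal_integral_eq_lintegral_ofReal (hi (by fun_prop)) (ae_of_all _ fun _ => by positivity),
    ← ofReal_integral_eq_lintegral_ofReal (hi (by fun_prop)) (ae_of_all _ fun _ => by positivity)]
  apply ENNReal.ofReal_le_ofReal
  rw [integral_const_mul, integral_const_mul]
  refine mul_le_mul_of_nonneg_left ?_ hw
  have h0 : 0 ≤ ∫ θ, (g θ - m) ^ 2 ∂areaS2 := integral_nonneg fun _ => sq_nonneg _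
  have h1 : ∫ θ, (g θ - m) ^ 2 ∂areaS2
      = ∫ θ, g θ ^ 2 ∂areaS2 - 2 * m * ∫ θ, g θ ∂areaS2 + ∫ _, m ^ 2 ∂areaS2 := by
    rw [← integral_const_mul, ← integral_sub (hi (by fun_prop)) (hi (by fun_prop)),
      ← integral_add (hi (by fun_prop)) (hi (by fun_prop))]
    exact integral_congr_ae (ae_of_all _ fun θ => by ring)
  have h2 : ∫ θ, g θ ∂areaS2 = areaS2.real univ * m := by
    rw [hm, ← smul_eq_mul, measure_smul_average]
  have h3 : ∫ _ : S2, m ^ 2 ∂areaS2 = areaS2.real univ * m ^ 2 := by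
    rw [integral_const, smul_eq_mul]
  rw [h1, h2, h3] at h0
  rw [h3]
  nlinarith

theorem hasFDerivAt_average {X : Type} [NormedAddCommGroup X] [NormedSpace ℝ X] {Φ : X → S2 → ℝ}
    {x : X} (h : SmoothAlong 1 Φ x) (w : X) :
    ∃ L : X →L[ℝ] ℝ, HasFDerivAt (fun y => ⨍ θ, Φ y θ ∂areaS2) L x ∧
      L w = ⨍ θ, fderiv ℝ (fun z => Φ z θ) x w ∂areaS2 := by
  simp only [average_eq]
  refine ⟨_, h.hasFDerivAt_integral.const_smul (areaS2.real univ)⁻¹, ?_⟩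
  rw [_root_.smul_apply, ContinuousLinearMap.integral_apply]
  exact integrable_of_continuous_S2 (h.fderiv (m := 0) (by simp)).continuous

section
variable {φ : ℝ → ℝ → S2 → ℝ} {u v : ℝ} {n m : WithTop ℕ∞}

theorem SmoothAlong.cd (h : SmoothAlong n (fun x : ℝ × ℝ => φ x.1 x.2) (u, v)) (θ : S2) :
    CD n (atAngle φ θ) u v := h.contDiffAt θ

theorem pu_average (h : SmoothAlong 1 (fun x : ℝ × ℝ => φ x.1 x.2) (u, v)) :
    pu (fun u v => ⨍ θ, φ u v θ ∂areaS2) u v = ⨍ θ, pu (atAngle φ θ) u v ∂areaS2 := by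
  obtain ⟨L, hL, e⟩ := hasFDerivAt_average h (1, 0)
  rw [pu_eq_of_hasFDerivAt hL, e]
  congr 1; ext θ
  exact (pu_eq_of_hasFDerivAt ((h.cd θ).hasFDerivAt one_ne_zero)).symm

theorem pv_average (h : SmoothAlong 1 (fun x : ℝ × ℝ => φ x.1 x.2) (u, v)) :
    pv (fun u v => ⨍ θ, φ u v θ ∂areaS2) u v = ⨍ θ, pv (atAngle φ θ) u v ∂areaS2 := by
  obtain ⟨L, hL, e⟩ := hasFDerivAt_average h (0, 1)
  rw [pv_eq_of_hasFDerivAt hL, e]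
  congr 1; ext θ
  exact (pv_eq_of_hasFDerivAt ((h.cd θ).hasFDerivAt one_ne_zero)).symm

theorem SmoothAlong.eventually_one {X : Type} [NormedAddCommGroup X] [NormedSpace ℝ X]
    {Φ : X → S2 → ℝ} {x : X} (h : SmoothAlong n Φ x) (hn : 1 ≤ n) :
    ∀ᶠ y in 𝓝 x, SmoothAlong 1 Φ y :=
  SmoothAlong.eventually (n := 1) (h.of_le (by simpa using hn))

theorem SmoothAlong.congr {X : Type} [NormedAddCommGroup X] [NormedSpace ℝ X]
    {Φ Ψ : X → S2 → ℝ} {x : X} (h : SmoothAlong n Φ x) (he : ∀ᶠ y in 𝓝 x, ∀ θ, Ψ y θ = Φ y θ) :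
    SmoothAlong n Ψ x := fun θ => (h θ).congr_of_eventuallyEq (by
  have : ∀ᶠ p : X × S2 in 𝓝 (x, θ), ∀ θ, Ψ p.1 θ = Φ p.1 θ :=
    (continuousAt_fst (p := (x, θ))).eventually he
  filter_upwards [this] with p hp using hp p.2)

theorem SmoothAlong.fderiv_apply {X : Type} [NormedAddCommGroup X] [NormedSpace ℝ X]
    {Φ : X → S2 → ℝ} {x : X} (h : SmoothAlong n Φ x) (hmn : m + 1 ≤ n) (w : X) :
    SmoothAlong m (fun y θ => _root_.fderiv ℝ (fun z => Φ z θ) y w) x := fun θ =>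
  ContMDiffAt.clm_apply (h.fderiv hmn θ) contMDiffAt_const

theorem SmoothAlong.pu (h : SmoothAlong n (fun x : ℝ × ℝ => φ x.1 x.2) (u, v)) (hmn : m + 1 ≤ n) :
    SmoothAlong m (fun x : ℝ × ℝ => fun θ => pu (atAngle φ θ) x.1 x.2) (u, v) := by
  refine (h.fderiv_apply hmn (1, 0)).congr ?_
  filter_upwards [h.eventually_one (le_trans (by simp) hmn)] with y hy θ
  exact pu_eq_of_hasFDerivAt ((hy.cd θ).hasFDerivAt one_ne_zero)

theorem SmoothAlong.pv (h : SmoothAlong n (fun x : ℝ × ℝ => φ x.1 x.2) (u, v)) (hmn : m + 1 ≤ n) :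
    SmoothAlong m (fun x : ℝ × ℝ => fun θ => pv (atAngle φ θ) x.1 x.2) (u, v) := by
  refine (h.fderiv_apply hmn (0, 1)).congr ?_
  filter_upwards [h.eventually_one (le_trans (by simp) hmn)] with y hy θ
  exact pv_eq_of_hasFDerivAt ((hy.cd θ).hasFDerivAt one_ne_zero)

theorem pu_pv_average (h : SmoothAlong 2 (fun x : ℝ × ℝ => φ x.1 x.2) (u, v)) :
    CriticalWave.pu (CriticalWave.pv (fun u v => ⨍ θ, φ u v θ ∂areaS2)) u v
      = ⨍ θ, CriticalWave.pu (CriticalWave.pv (atAngle φ θ)) u v ∂areaS2 := by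
  rw [pu_congr (g := fun u v => ⨍ θ, CriticalWave.pv (atAngle φ θ) u v ∂areaS2)]
  · exact pu_average (φ := fun u v θ => CriticalWave.pv (atAngle φ θ) u v)
      (h.pv (m := 1) (by norm_num))
  · filter_upwards [h.eventually_one (by norm_num)] with y hy using pv_average hy

end

theorem deriv_average {Φ : ℝ → S2 → ℝ} {x : ℝ} (h : SmoothAlong 1 Φ x) :
    deriv (fun y => ⨍ θ, Φ y θ ∂areaS2) x = ⨍ θ, deriv (fun y => Φ y θ) x ∂areaS2 := by
  obtain ⟨L, hL, e⟩ := hasFDerivAt_average h 1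
  rw [hL.hasDerivAt.deriv, e]
  simp

theorem SmoothAlong.deriv {n m : WithTop ℕ∞} {Φ : ℝ → S2 → ℝ} {x : ℝ} (h : SmoothAlong n Φ x)
    (hmn : m + 1 ≤ n) : SmoothAlong m (fun y θ => _root_.deriv (fun z => Φ z θ) y) x := by
  simpa using h.fderiv_apply hmn 1

/-- The induction peels off the innermost derivative, so it has to run over all families Φ.
Continuity of the differentiated family is carried along for use in `average_S2_sq_le`. -/
theorem iteratedDeriv_average {Φ : ℝ → S2 → ℝ} {x : ℝ} (j : ℕ) (h : SmoothAlong j Φ x) :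
    SmoothAlong 0 (fun y θ => iteratedDeriv j (fun z => Φ z θ) y) x ∧
    iteratedDeriv j (fun y => ⨍ θ, Φ y θ ∂areaS2) x
      = ⨍ θ, iteratedDeriv j (fun y => Φ y θ) x ∂areaS2 := by
  induction j generalizing Φ with
  | zero => simpa using h
  | succ j ih =>
    have h1 := ih (Φ := fun y θ => _root_.deriv (fun z => Φ z θ) y) (h.deriv (by simp))
    simp only [iteratedDeriv_succ']
    refine ⟨h1.1, ?_⟩
    rw [← h1.2]
    refine Filter.EventuallyEq.iteratedDeriv_eq j ?_
    filter_upwards [h.eventually_one (by simp)] with y hy using deriv_average hy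

theorem rotD_const (i : Fin 3) (c : ℝ) : rotD i (fun _ => c) = fun _ => 0 := by
  ext θ; simp [rotD]

theorem rotDs_const (β : List (Fin 3)) (c : ℝ) :
    rotDs β (fun _ => c) = fun _ => if β = [] then c else 0 := by
  cases β with
  | nil => simp [rotDs]
  | cons i β =>
    have : ∃ d : ℝ, rotDs β (fun _ => c) = fun _ => d := by
      induction β with
      | nil => exact ⟨c, rfl⟩
      | cons j β ih =>
        obtain ⟨d, hd⟩ := ih
        refine ⟨0, ?_⟩
        change rotD j (rotDs β fun _ => c) = _
        rw [hd, rotD_const]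
    obtain ⟨d, hd⟩ := this
    change rotD i (rotDs β fun _ => c) = _
    rw [hd, rotD_const]
    simp

theorem lapS2_const (c : ℝ) (θ : S2) : lapS2 (fun _ => c) θ = 0 := by
  simp [lapS2, rotD_const]

theorem gradSqS2_const (c : ℝ) (θ : S2) : gradSqS2 (fun _ => c) θ = 0 := by
  simp [gradSqS2, rotD_const]

theorem gradSqS2_nonneg (f : S2 → ℝ) (θ : S2) : 0 ≤ gradSqS2 f θ :=
  Finset.sum_nonneg fun _ _ => sq_nonneg _

instance : NeZero areaS2 := ⟨by
  unfold areaS2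
  exact Measure.toSphere_ne_zero _⟩

section
variable {B : Background} {k : ℕ∞} {ε R : ℝ} {φ : ℝ → ℝ → S2 → ℝ} {u v : ℝ}

theorem Background.IsSolution.smoothAlong (h : B.IsSolution k ε R φ) (hd : (u, v) ∈ B.dom) :
    SmoothAlong k (fun x : ℝ × ℝ => φ x.1 x.2) (u, v) := h.reg u v hd

theorem Background.IsSolution.smoothAlong_three (h : B.IsSolution k ε R φ) (hk : 3 ≤ k)
    (hd : (u, v) ∈ B.dom) : SmoothAlong 3 (fun x : ℝ × ℝ => φ x.1 x.2) (u, v) :=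
  (h.smoothAlong hd).of_le (WithTop.coe_le_coe.2 hk)

theorem Background.Regular.cd_r (h : B.Regular) (hd : (u, v) ∈ B.dom) : CD 3 B.r u v :=
  h.r_reg _ hd

/-- At fixed (u,v) the wave equation is a linear relation, with coefficients constant on the sphere,
between ψ-type functions of the angle: the mixed derivative, the two first derivatives, the
Laplacian and the function itself. -/
theorem average_zero_of_linear {f₁ f₂ f₃ f₄ f₅ : S2 → ℝ} {c₁ c₂ c₃ c₄ c₅ : ℝ}
    (h₁ : Continuous f₁) (h₂ : Continuous f₂) (h₃ : Continuous f₃) (h₄ : Continuous f₄)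
    (h₅ : Continuous f₅)
    (h : ∀ θ, c₁ * f₁ θ + c₂ * f₂ θ + c₃ * f₃ θ + c₄ * f₄ θ + c₅ * f₅ θ = 0) :
    c₁ * ⨍ θ, f₁ θ ∂areaS2 + c₂ * ⨍ θ, f₂ θ ∂areaS2 + c₃ * ⨍ θ, f₃ θ ∂areaS2
      + c₄ * ⨍ θ, f₄ θ ∂areaS2 + c₅ * ⨍ θ, f₅ θ ∂areaS2 = 0 := by
  have hi {f : S2 → ℝ} (hf : Continuous f) := integrable_of_continuous_S2 hf
  have h0 : ∫ θ, (c₁ * f₁ θ + c₂ * f₂ θ + c₃ * f₃ θ + c₄ * f₄ θ + c₅ * f₅ θ) ∂areaS2 = 0 := by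
    simp [h]
  rw [integral_add (hi (by fun_prop)) (hi (by fun_prop)),
    integral_add (hi (by fun_prop)) (hi (by fun_prop)),
    integral_add (hi (by fun_prop)) (hi (by fun_prop)),
    integral_add (hi (by fun_prop)) (hi (by fun_prop))] at h0
  simp only [integral_const_mul] at h0
  simp only [average_eq, smul_eq_mul]
  linear_combination (areaS2.real univ)⁻¹ * h0

theorem Background.IsSolution.sphAvg_eqn (h : B.IsSolution k ε R φ) (hreg : B.Regular)
    (hk : 3 ≤ k) (hd : (u, v) ∈ B.dom) (θ : S2) :
    B.box (sphAvg φ) u v θ = B.source ε (sphAvg φ) u v θ := by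
  have hs := h.smoothAlong_three hk hd
  have hs2 := hs.of_le (m := 2) (by norm_num)
  have hs1 := hs.of_le (m := 1) (by norm_num)
  have hr := (hreg.cd_r hd).of_le (m := 2) (by norm_num)
  have hr0 := (hreg.r_pos u v hd).ne'
  have hA : CD 2 (atAngle (sphAvg φ) θ) u v := by
    have := (hs2.contDiffAt_integral (k := 2)).const_smul (areaS2.real univ)⁻¹
    simpa only [CD, atAngle, sphAvg, average_eq] using! this
  rw [B.box_eq hr hA hr0, Background.source]
  have e0 : atAngle (sphAvg φ) θ = fun u v => ⨍ θ, φ u v θ ∂areaS2 := rfl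
  have e1 : sphAvg φ u v = fun _ => ⨍ θ, φ u v θ ∂areaS2 := rfl
  rw [e0, e1, lapS2_const, pu_pv_average hs2, pu_average hs1, pv_average hs1]
  -- The only term of the equation that is not radial has mean zero, while the Laplacian of the
  -- average vanishes identically.
  have hlap : ⨍ θ, lapS2 (φ u v) θ ∂areaS2 = 0 := by
    rw [average_eq, integral_lapS2, smul_zero]
    exact fun θ => ContMDiffAt.comp (x := θ) (I' := 𝓘(ℝ, ℝ × ℝ).prod (𝓡 2))
      (f := fun θ : S2 => ((u, v), θ)) (hs2 θ) (contMDiffAt_const.prodMk contMDiffAt_id)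
  have hcont : Continuous (lapS2 (φ u v)) := continuous_lapS2
    fun θ => ContMDiffAt.comp (x := θ) (I' := 𝓘(ℝ, ℝ × ℝ).prod (𝓡 2))
      (f := fun θ : S2 => ((u, v), θ)) (hs2 θ) (contMDiffAt_const.prodMk contMDiffAt_id)
  have key := average_zero_of_linear (f₁ := fun θ => pu (pv (atAngle φ θ)) u v)
    (f₂ := fun θ => pv (atAngle φ θ) u v) (f₃ := fun θ => pu (atAngle φ θ) u v)
    (f₄ := fun θ => lapS2 (φ u v) θ) (f₅ := fun θ => φ u v θ)
    (c₁ := -(4 / (B.Om2 u v * B.r u v)) * B.r u v)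
    (c₂ := -(4 / (B.Om2 u v * B.r u v)) * pu B.r u v
      - 1 / B.r u v ^ 2 * ((ε * B.q u v + B.Q u v) * B.r u v))
    (c₃ := -(4 / (B.Om2 u v * B.r u v)) * pv B.r u v
      - 1 / B.r u v ^ 2 * (ε * B.w1 u v + B.W1 u v))
    (c₄ := 1 / B.r u v ^ 2) (c₅ := -(1 / B.r u v ^ 2 * (ε * B.w0 u v + B.W0 u v)))
    (SmoothAlong.continuous (x := (u, v)) (n := 0) ((hs2.pv (m := 1) (by norm_num)).pu
      (φ := fun u v θ => pv (atAngle φ θ) u v) (m := 0) (by norm_num)))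
    (hs1.pv (m := 0) (by norm_num)).continuous (hs1.pu (m := 0) (by norm_num)).continuous
    hcont hs1.continuous (fun θ => by
      have he := h.eqn u v hd θ
      rw [B.box_eq hr (hs2.cd θ) hr0, Background.source] at he
      linear_combination he)
  rw [hlap] at key
  linear_combination key

theorem Background.IsSolution.data_radial_average (h : B.IsSolution k ε R φ) (hreg : B.Regular)
    (hk : 3 ≤ k) (j : ℕ) (hj : j ≤ 1) (p : ℝ) (hp0 : 0 ≤ p) (hp3 : p < 3) :
    (∫⁻ v in Ici B.v0, ∫⁻ θ, ENNReal.ofReal (B.r B.u0 v ^ (p + 2 * j) *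
      iteratedDeriv (1 + j) (fun v' => B.r B.u0 v' * CriticalWave.sphAvg φ B.u0 v' θ) v ^ 2)
        ∂areaS2) < ⊤ := by
  refine lt_of_le_of_lt (setLIntegral_mono' measurableSet_Ici fun v hv => ?_)
    (h.data_radial p hp0 hp3 j hj)
  have hd := hreg.dom_cone v hv
  have hs : SmoothAlong 3 (fun v θ => B.r B.u0 v * φ B.u0 v θ) v := fun θ => by
    have h1 : ContDiffAt ℝ 3 (fun v => B.r B.u0 v) v :=
      ContDiffAt.comp (f := fun v : ℝ => (B.u0, v)) v (hreg.cd_r hd) (by fun_prop)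
    have h2 : ContMDiffAt (𝓘(ℝ, ℝ).prod (𝓡 2)) 𝓘(ℝ, ℝ) 3 (fun q : ℝ × S2 => B.r B.u0 q.1) (v, θ) :=
      ContMDiffAt.comp (x := (v, θ)) (I' := 𝓘(ℝ, ℝ)) (f := fun q : ℝ × S2 => q.1)
        h1.contMDiffAt contMDiffAt_fst
    have h3 : ContMDiffAt (𝓘(ℝ, ℝ).prod (𝓡 2)) 𝓘(ℝ, ℝ) 3 (fun q : ℝ × S2 => φ B.u0 q.1 q.2) (v, θ) :=
      ContMDiffAt.comp (x := (v, θ)) (I' := 𝓘(ℝ, ℝ × ℝ).prod (𝓡 2))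
        (f := fun q : ℝ × S2 => ((B.u0, q.1), q.2)) (h.smoothAlong_three hk hd θ)
        ((contMDiffAt_const.prodMk_space contMDiffAt_fst).prodMk contMDiffAt_snd)
    exact h2.mul h3
  have hs' : SmoothAlong (1 + j : ℕ) (fun v θ => B.r B.u0 v * φ B.u0 v θ) v :=
    hs.of_le (by exact_mod_cast (by omega : 1 + j ≤ 3))
  obtain ⟨h1, h2⟩ := iteratedDeriv_average (1 + j) hs'
  have e (θ : S2) : (fun v' => B.r B.u0 v' * CriticalWave.sphAvg φ B.u0 v' θ)
      = fun v' => ⨍ θ, B.r B.u0 v' * φ B.u0 v' θ ∂areaS2 := by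
    ext v'
    simp only [CriticalWave.sphAvg, average_eq, integral_const_mul, smul_eq_mul]
    ring
  simp only [e, h2]
  exact average_S2_sq_le h1.continuous (Real.rpow_nonneg (hreg.r_pos _ _ hd).le _)

/-- The spherical average of an admissible solution is an admissible solution. -/
theorem Background.IsSolution.sphAvg (h : B.IsSolution k ε R φ) (hreg : B.Regular) (hk : 3 ≤ k)
    (hR : ∀ u v : ℝ, B.u0 ≤ u → (u : EReal) ≤ B.uF → R ≤ v - u → (u, v) ∈ B.dom) :
    B.IsSolution k ε R (sphAvg φ) where
  reg u v hd θ := by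
    have h1 := ((h.smoothAlong hd).contDiffAt_integral).const_smul (areaS2.real univ)⁻¹
    have h2 : ContDiffAt ℝ k (fun x : ℝ × ℝ => ⨍ θ, φ x.1 x.2 θ ∂areaS2) (u, v) := by
      simpa only [average_eq] using h1
    exact ContMDiffAt.comp (x := ((u, v), θ)) (I' := 𝓘(ℝ, ℝ × ℝ))
      (f := fun p : (ℝ × ℝ) × S2 => p.1) h2.contMDiffAt contMDiffAt_fst
  eqn u v hd θ := h.sphAvg_eqn hreg hk hd θ
  finite u hu huF := by
    refine lt_of_le_of_lt ?_ (h.finite u hu huF)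
    have hs {u v : ℝ} (hd : (u, v) ∈ B.dom) :=
      (h.smoothAlong_three hk hd).of_le (m := 1) (by norm_num)
    refine add_le_add (setLIntegral_mono' measurableSet_Ici fun v hv => ?_)
      (setLIntegral_mono' ?_ fun u' hu' => ?_)
    · have hd := hR u v hu huF (by linarith [mem_Ici.1 hv])
      have e : ∀ θ, pv (atAngle (CriticalWave.sphAvg φ) θ) u v
          = ⨍ θ, pv (atAngle φ θ) u v ∂areaS2 := fun θ => pv_average (hs hd)
      have e1 : CriticalWave.sphAvg φ u v = fun _ => ⨍ θ, φ u v θ ∂areaS2 := rfl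
      -- Averaging removes the angular gradient, so the nonnegative gradient term of the original
      -- energy may be discarded.
      simp only [e, e1, gradSqS2_const, add_zero]
      refine (average_S2_sq_le ((hs hd).pv (m := 0) (by norm_num)).continuous
        (sq_nonneg _)).trans (lintegral_mono fun θ => ENNReal.ofReal_le_ofReal ?_)
      exact le_add_of_nonneg_right (gradSqS2_nonneg _ _)
    · exact (measurableSet_Ici (a := u)).inter
        ((by fun_prop : Measurable fun u' : ℝ => (u', u + R)) hreg.dom_meas)
    · have hd := hu'.2
      have e : ∀ θ, pu (atAngle (CriticalWave.sphAvg φ) θ) u' (u + R)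
          = ⨍ θ, pu (atAngle φ θ) u' (u + R) ∂areaS2 := fun θ => pu_average (hs hd)
      have e1 : CriticalWave.sphAvg φ u' (u + R) = fun _ => ⨍ θ, φ u' (u + R) θ ∂areaS2 := rfl
      simp only [e, e1, gradSqS2_const, add_zero]
      refine (average_S2_sq_le ((hs hd).pu (m := 0) (by norm_num)).continuous
        (sq_nonneg _)).trans (lintegral_mono fun θ => ENNReal.ofReal_le_ofReal ?_)
      exact le_add_of_nonneg_right (gradSqS2_nonneg _ _)
  data_angular p hp0 hp3 β hβ := by
    have e : ∀ v', CriticalWave.sphAvg φ B.u0 v' = fun _ => ⨍ θ, φ B.u0 v' θ ∂areaS2 :=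
      fun _ => rfl
    simp only [e, rotDs_const]
    by_cases hb : β = []
    · subst hb
      have := h.data_radial_average hreg hk 0 zero_le_one p hp0 hp3
      simpa [CriticalWave.sphAvg] using this
    · simp [hb]
  data_radial p hp0 hp3 j hj := h.data_radial_average hreg hk j hj p hp0 hp3

end

/-! ### Estimates on a single outgoing cone -/

/-- The restriction of a radial wave to the part `α ≤ v ≤ V` of an outgoing cone. -/
structure Slice (a α V : ℝ) (r ru rv ψ ψu ψv F : ℝ → ℝ) : Prop where
  le : α + 1 ≤ V
  a_nonneg : 0 ≤ a
  cont_r : ContinuousOn r (Icc α V)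
  cont_ru : ContinuousOn ru (Icc α V)
  cont_ψ : ContinuousOn ψ (Icc α V)
  cont_ψu : ContinuousOn ψu (Icc α V)
  cont_ψv : ContinuousOn ψv (Icc α V)
  cont_F : ContinuousOn F (Icc α V)
  dr : ∀ v ∈ Icc α V, HasDerivAt r (rv v) v
  dψ : ∀ v ∈ Icc α V, HasDerivAt ψ (ψv v) v
  dψu : ∀ v ∈ Icc α V, HasDerivAt ψu (F v) v
  one_le : ∀ v ∈ Icc α V, 1 ≤ r v
  ru_le : ∀ v ∈ Icc α V, ru v ≤ -(9 / 10)
  le_rv : ∀ v ∈ Icc α V, 9 / 10 ≤ rv v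
  F_le : ∀ v ∈ Icc α V, |F v| ≤ a * (|ψv v| / r v + |ψ v| / r v ^ 2 + |ψu v| / r v ^ 2)

namespace Slice
variable {a α V m : ℝ} {r ru rv ψ ψu ψv F : ℝ → ℝ}

theorem mono (h : Slice a α V r ru rv ψ ψu ψv F) {W : ℝ} (h1 : α + 1 ≤ W) (h2 : W ≤ V) :
    Slice a α W r ru rv ψ ψu ψv F := by
  have hs : Icc α W ⊆ Icc α V := Icc_subset_Icc_right h2
  exact ⟨h1, h.a_nonneg, h.cont_r.mono hs, h.cont_ru.mono hs, h.cont_ψ.mono hs, h.cont_ψu.mono hs,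
    h.cont_ψv.mono hs, h.cont_F.mono hs, fun v hv => h.dr v (hs hv), fun v hv => h.dψ v (hs hv),
    fun v hv => h.dψu v (hs hv), fun v hv => h.one_le v (hs hv), fun v hv => h.ru_le v (hs hv),
    fun v hv => h.le_rv v (hs hv), fun v hv => h.F_le v (hs hv)⟩

theorem cont_rpow (h : Slice a α V r ru rv ψ ψu ψv F) (q : ℝ) :
    ContinuousOn (fun v => r v ^ q) (Icc α V) :=
  h.cont_r.rpow_const fun v hv => Or.inl (by linarith [h.one_le v hv])

theorem intervalIntegrable (h : Slice a α V r ru rv ψ ψu ψv F) {f : ℝ → ℝ}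
    (hf : ContinuousOn f (Icc α V)) : IntervalIntegrable f volume α V :=
  ContinuousOn.intervalIntegrable_of_Icc (by linarith [h.le]) hf

/-- Only the majorant k has to be continuous, not the derivative. A `Slice` contains no continuity
of r_v, so the fundamental theorem is used in this one-sided form. -/
theorem le_integral_of_hasDerivAt {α V : ℝ} (hle : α ≤ V) {f f' k : ℝ → ℝ}
    (hf : ∀ v ∈ Icc α V, HasDerivAt f (f' v) v) (hk : ContinuousOn k (Icc α V))
    (hfk : ∀ v ∈ Icc α V, f' v ≤ k v) : f V - f α ≤ ∫ v in α..V, k v :=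
  intervalIntegral.sub_le_integral_of_hasDeriv_right_of_le hle
    (fun v hv => (hf v hv).continuousAt.continuousWithinAt)
    (fun v hv => (hf v (Ioo_subset_Icc_self hv)).hasDerivWithinAt)
    hk.integrableOn_Icc (fun v hv => hfk v (Ioo_subset_Icc_self hv))

/-- Powers of `r` in terms of the lowest one. -/
theorem rpow_eq {x : ℝ} (hx : 0 < x) (m : ℝ) : x ^ (-m) = x ^ (-m - 1) * x ∧
    x ^ (1 - m) = x ^ (-m - 1) * x ^ 2 ∧ x ^ (2 - m) = x ^ (-m - 1) * x ^ 3 ∧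
    x ^ (3 - m) = x ^ (-m - 1) * x ^ 4 := by
  refine ⟨?_, ?_, ?_, ?_⟩
  · rw [← Real.rpow_add_one hx.ne']; congr 1; ring
  · rw [← Real.rpow_add_natCast hx.ne']; congr 1; push_cast; ring
  · rw [← Real.rpow_add_natCast hx.ne']; congr 1; push_cast; ring
  · rw [← Real.rpow_add_natCast hx.ne']; congr 1; push_cast; ring

theorem hasDerivAt_weighted {r f : ℝ → ℝ} {r' f' v : ℝ} (hr : HasDerivAt r r' v) (h0 : 0 < r v)
    (hf : HasDerivAt f f' v) (q : ℝ) : HasDerivAt (fun v => r v ^ q * f v ^ 2)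
      (q * r v ^ (q - 1) * r' * f v ^ 2 + r v ^ q * (2 * f v * f')) v := by
  refine ((hr.rpow_const (p := q) (Or.inl h0.ne')).mul (hf.fun_pow 2)).congr_deriv ?_
  push_cast
  ring

/-- Integrate the derivative of r^{-m}ψ², which contains the good term -m r_v r^{-m-1}ψ². Half of m
absorbs the cross term by completing a square, and r_v ≥ 9/10 leaves 9/10 - 1/2 = 2/5. -/
theorem hardy_psi (h : Slice a α V r ru rv ψ ψu ψv F) (hm : 0 < m) :
    ∫ v in α..V, r v ^ (-m - 1) * ψ v ^ 2 ≤
      5 / m ^ 2 * (∫ v in α..V, r v ^ (1 - m) * ψv v ^ 2) + 5 / (2 * m) * ψ α ^ 2 := by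
  have hle : α ≤ V := by linarith [h.le]
  have c0 := h.cont_rpow (-m - 1)
  have c1 := h.cont_rpow (1 - m)
  have cp := h.cont_ψ
  have cq := h.cont_ψv
  have key := le_integral_of_hasDerivAt hle (f := fun v => r v ^ (-m) * ψ v ^ 2)
    (k := fun v => -(2 / 5) * m * (r v ^ (-m - 1) * ψ v ^ 2)
      + 2 / m * (r v ^ (1 - m) * ψv v ^ 2))
    (fun v hv => hasDerivAt_weighted (h.dr v hv) (by linarith [h.one_le v hv]) (h.dψ v hv) (-m))
    (by fun_prop) (fun v hv => by
      have hr := h.one_le v hv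
      have hrv := h.le_rv v hv
      obtain ⟨e1, e2, -, -⟩ := rpow_eq (x := r v) (by linarith) m
      have hz : 0 < r v ^ (-m - 1) := Real.rpow_pos_of_pos (by linarith) _
      simp only [e1, e2]
      set z := r v ^ (-m - 1)
      have h1 : 0 ≤ z * (m / 2 * ψ v ^ 2 - 2 * r v * ψ v * ψv v + 2 / m * r v ^ 2 * ψv v ^ 2) := by
        have : m / 2 * ψ v ^ 2 - 2 * r v * ψ v * ψv v + 2 / m * r v ^ 2 * ψv v ^ 2
          = m / 2 * (ψ v - 2 / m * r v * ψv v) ^ 2 := by field_simp; ring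
        rw [this]; positivity
      have h2 : 0 ≤ m * z * ψ v ^ 2 * (rv v - 9 / 10) :=
        mul_nonneg (by positivity) (by linarith)
      linarith)
  rw [intervalIntegral.integral_add (h.intervalIntegrable (by fun_prop))
    (h.intervalIntegrable (by fun_prop)), intervalIntegral.integral_const_mul,
    intervalIntegral.integral_const_mul] at key
  have hV : 0 ≤ r V ^ (-m) * ψ V ^ 2 :=
    mul_nonneg (Real.rpow_nonneg (by linarith [h.one_le V ⟨hle, le_rfl⟩]) _) (sq_nonneg _)
  have hα : r α ^ (-m) * ψ α ^ 2 ≤ ψ α ^ 2 :=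
    mul_le_of_le_one_left (sq_nonneg _)
      (Real.rpow_le_one_of_one_le_of_nonpos (h.one_le α ⟨le_rfl, hle⟩) (by linarith))
  set X := ∫ v in α..V, r v ^ (-m - 1) * ψ v ^ 2
  set Y := ∫ v in α..V, r v ^ (1 - m) * ψv v ^ 2
  have h3 : 2 / 5 * m * X ≤ ψ α ^ 2 + 2 / m * Y := by linarith
  have h4 : X = 5 / (2 * m) * (2 / 5 * m * X) := by field_simp
  have h5 : 5 / m ^ 2 * Y + 5 / (2 * m) * ψ α ^ 2 = 5 / (2 * m) * (ψ α ^ 2 + 2 / m * Y) := by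
    field_simp; ring
  rw [h4, h5]
  exact mul_le_mul_of_nonneg_left h3 (by positivity)

theorem F_le_weighted (h : Slice a α V r ru rv ψ ψu ψv F) {v : ℝ} (hv : v ∈ Icc α V) :
    |F v| * r v ^ 2 ≤ a * (r v * |ψv v| + |ψ v| + |ψu v|) := by
  have hr : 0 < r v := by linarith [h.one_le v hv]
  have := mul_le_mul_of_nonneg_right (h.F_le v hv) (sq_nonneg (r v))
  refine this.trans (le_of_eq ?_)
  field_simp

/-- The Hardy argument for ψ_u: its v-derivative is F, so the cross term is already quadratic in the
quantities at hand and small with a. The condition a ≤ m/50 costs 4m/50 of the good term 9m/10. -/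
theorem hardy_psiu (h : Slice a α V r ru rv ψ ψu ψv F) (hm : 0 < m) (ha : a ≤ m / 50) :
    ∫ v in α..V, r v ^ (-m - 1) * ψu v ^ 2 ≤
      1 / 40 * ((∫ v in α..V, r v ^ (1 - m) * ψv v ^ 2) + ∫ v in α..V, r v ^ (-m - 1) * ψ v ^ 2)
        + 5 / (4 * m) * ψu α ^ 2 := by
  have hle : α ≤ V := by linarith [h.le]
  have ha0 := h.a_nonneg
  have c0 := h.cont_rpow (-m - 1)
  have c1 := h.cont_rpow (1 - m)
  have cp := h.cont_ψ
  have cq := h.cont_ψv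
  have cu := h.cont_ψu
  have key := le_integral_of_hasDerivAt hle (f := fun v => r v ^ (-m) * ψu v ^ 2)
    (k := fun v => -(4 / 5) * m * (r v ^ (-m - 1) * ψu v ^ 2)
      + m / 50 * (r v ^ (1 - m) * ψv v ^ 2 + r v ^ (-m - 1) * ψ v ^ 2))
    (fun v hv => hasDerivAt_weighted (h.dr v hv) (by linarith [h.one_le v hv]) (h.dψu v hv) (-m))
    (by fun_prop) (fun v hv => by
      have hr := h.one_le v hv
      have hrv := h.le_rv v hv
      have hr0 : 0 < r v := by linarith
      obtain ⟨e1, e2, -, -⟩ := rpow_eq (x := r v) (by linarith) m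
      have hz : 0 < r v ^ (-m - 1) := Real.rpow_pos_of_pos (by linarith) _
      have hF := h.F_le_weighted hv
      simp only [e1, e2]
      set z := r v ^ (-m - 1)
      have h2 : 0 ≤ m * z * ψu v ^ 2 * (rv v - 9 / 10) :=
        mul_nonneg (by positivity) (by linarith)
      have h3 : r v * (2 * ψu v * F v) ≤ m / 50 * (r v ^ 2 * ψv v ^ 2 + ψ v ^ 2 + 4 * ψu v ^ 2) := by
        have hF2 : r v * |F v| ≤ a * (r v * |ψv v| + |ψ v| + |ψu v|) := by
          refine le_trans ?_ hF
          nlinarith [abs_nonneg (F v), mul_nonneg (mul_nonneg hr0.le (abs_nonneg (F v)))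
            (by linarith : 0 ≤ r v - 1)]
        have h4 : r v * (2 * ψu v * F v) ≤ 2 * |ψu v| * (r v * |F v|) := by
          have := le_abs_self (ψu v * F v)
          rw [abs_mul] at this
          nlinarith
        have h5 : 2 * |ψu v| * (r v * |F v|) ≤
            2 * |ψu v| * (a * (r v * |ψv v| + |ψ v| + |ψu v|)) :=
          mul_le_mul_of_nonneg_left hF2 (by positivity)
        have h6 : 2 * |ψu v| * (r v * |ψv v| + |ψ v| + |ψu v|)
            ≤ r v ^ 2 * ψv v ^ 2 + ψ v ^ 2 + 4 * ψu v ^ 2 := by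
          rw [← sq_abs (ψv v), ← sq_abs (ψ v), ← sq_abs (ψu v)]
          nlinarith [sq_nonneg (|ψu v| - r v * |ψv v|), sq_nonneg (|ψu v| - |ψ v|)]
        have h7 : a * (2 * |ψu v| * (r v * |ψv v| + |ψ v| + |ψu v|))
            ≤ m / 50 * (r v ^ 2 * ψv v ^ 2 + ψ v ^ 2 + 4 * ψu v ^ 2) :=
          mul_le_mul ha h6 (by positivity) (by positivity)
        linarith
      have h8 := mul_le_mul_of_nonneg_left h3 hz.le
      have h9 : 0 ≤ m * z * ψu v ^ 2 := by positivity
      linarith)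
  rw [intervalIntegral.integral_add (h.intervalIntegrable (by fun_prop))
    (h.intervalIntegrable (by fun_prop)), intervalIntegral.integral_const_mul,
    intervalIntegral.integral_const_mul, intervalIntegral.integral_add
    (h.intervalIntegrable (by fun_prop)) (h.intervalIntegrable (by fun_prop))] at key
  have hV : 0 ≤ r V ^ (-m) * ψu V ^ 2 :=
    mul_nonneg (Real.rpow_nonneg (by linarith [h.one_le V ⟨hle, le_rfl⟩]) _) (sq_nonneg _)
  have hα : r α ^ (-m) * ψu α ^ 2 ≤ ψu α ^ 2 :=
    mul_le_of_le_one_left (sq_nonneg _)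
      (Real.rpow_le_one_of_one_le_of_nonpos (h.one_le α ⟨le_rfl, hle⟩) (by linarith))
  set X := ∫ v in α..V, r v ^ (-m - 1) * ψ v ^ 2
  set G := ∫ v in α..V, r v ^ (-m - 1) * ψu v ^ 2
  set Y := ∫ v in α..V, r v ^ (1 - m) * ψv v ^ 2
  have h3 : 4 / 5 * m * G ≤ ψu α ^ 2 + m / 50 * (Y + X) := by linarith
  have h4 : G = 5 / (4 * m) * (4 / 5 * m * G) := by field_simp
  have h5 : 1 / 40 * (Y + X) + 5 / (4 * m) * ψu α ^ 2
      = 5 / (4 * m) * (ψu α ^ 2 + m / 50 * (Y + X)) := by field_simp; ring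
  rw [h4, h5]
  exact mul_le_mul_of_nonneg_left h3 (by positivity)

/-- The multiplier v - (α + 1) vanishes at the right end and equals -1 at the left end, so only the
trace at α survives. -/
theorem trace_le {α : ℝ} {f f' : ℝ → ℝ} (hf : ∀ v ∈ Icc α (α + 1), HasDerivAt f (f' v) v)
    (hf' : ContinuousOn f' (Icc α (α + 1))) :
    f α ^ 2 ≤ ∫ v in α..α + 1, (2 * f v ^ 2 + f' v ^ 2) := by
  have hc : ContinuousOn f (Icc α (α + 1)) := fun v hv => (hf v hv).continuousAt.continuousWithinAt
  have key := le_integral_of_hasDerivAt (α := α) (V := α + 1) (by linarith)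
    (f := fun v => (v - (α + 1)) * f v ^ 2) (k := fun v => 2 * f v ^ 2 + f' v ^ 2)
    (fun v hv => ((hasDerivAt_id v).sub_const (α + 1)).mul ((hf v hv).fun_pow 2)) (by fun_prop)
    (fun v hv => by
      simp only [id, mem_Icc] at hv ⊢
      push_cast
      have h1 : 0 ≤ α + 1 - v := by linarith
      have h2 : α + 1 - v ≤ 1 := by linarith
      have h3 : -(2 * f v * f' v) ≤ f v ^ 2 + f' v ^ 2 := by nlinarith [sq_nonneg (f v + f' v)]
      have h4 : (α + 1 - v) * -(2 * f v * f' v) ≤ (α + 1 - v) * (f v ^ 2 + f' v ^ 2) :=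
        mul_le_mul_of_nonneg_left h3 h1
      have h5 : (α + 1 - v) * (f v ^ 2 + f' v ^ 2) ≤ 1 * (f v ^ 2 + f' v ^ 2) :=
        mul_le_mul_of_nonneg_right h2 (by positivity)
      simp only [pow_one]
      linarith)
  simp only [sub_self, zero_mul] at key
  linarith

theorem F_sq_le (h : Slice a α V r ru rv ψ ψu ψv F) (ha : a ≤ 1 / 50) {v : ℝ} (hv : v ∈ Icc α V) :
    F v ^ 2 ≤ ψ v ^ 2 + ψu v ^ 2 + ψv v ^ 2 := by
  have hr := h.one_le v hv
  have h1 : |F v| ≤ 1 / 50 * (|ψv v| + |ψ v| + |ψu v|) := by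
    refine (h.F_le v hv).trans (mul_le_mul ha ?_ (by positivity) (by norm_num))
    gcongr
    · exact div_le_self (abs_nonneg _) hr
    · exact div_le_self (abs_nonneg _) (one_le_pow₀ hr)
    · exact div_le_self (abs_nonneg _) (one_le_pow₀ hr)
  have h2 := pow_le_pow_left₀ (abs_nonneg _) h1 2
  rw [sq_abs] at h2
  rw [← sq_abs (ψv v), ← sq_abs (ψ v), ← sq_abs (ψu v)]
  nlinarith [sq_nonneg (|ψv v| - |ψ v|), sq_nonneg (|ψv v| - |ψu v|), sq_nonneg (|ψ v| - |ψu v|)]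

/-- Local energy decay controls spacetime integrals, not traces on v = u + R. The Hardy boundary
terms are therefore traded for an integral over a strip of unit width. -/
theorem boundary_le (h : Slice a α V r ru rv ψ ψu ψv F) (ha : a ≤ 1 / 50) :
    ψ α ^ 2 + ψu α ^ 2 ≤ 3 * ∫ v in α..α + 1, (ψ v ^ 2 + ψu v ^ 2 + ψv v ^ 2) := by
  have h' := h.mono le_rfl h.le
  have cp := h'.cont_ψ
  have cq := h'.cont_ψv
  have cu := h'.cont_ψu
  have cF := h'.cont_F
  have h1 := trace_le h'.dψ h'.cont_ψv
  have h2 := trace_le h'.dψu h'.cont_F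
  rw [← intervalIntegral.integral_const_mul]
  refine (add_le_add h1 h2).trans ?_
  rw [← intervalIntegral.integral_add (h'.intervalIntegrable (by fun_prop))
    (h'.intervalIntegrable (by fun_prop))]
  refine intervalIntegral.integral_mono_on (by linarith) (h'.intervalIntegrable (by fun_prop))
    (h'.intervalIntegrable (by fun_prop)) fun v hv => ?_
  have := h'.F_sq_le ha hv
  nlinarith [sq_nonneg (ψ v), sq_nonneg (ψu v), sq_nonneg (ψv v)]

/-- Weighted Hardy inequality for `ψ` and `ψ_u` together. -/
theorem hardy (h : Slice a α V r ru rv ψ ψu ψv F) (hm : 0 < m) (hm1 : m ≤ 1) (ha : a ≤ m / 50) :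
    (∫ v in α..V, r v ^ (-m - 1) * (ψ v ^ 2 + ψu v ^ 2)) ≤
      6 / m ^ 2 * (∫ v in α..V, r v ^ (1 - m) * ψv v ^ 2)
        + 9 / m * ∫ v in α..α + 1, (ψ v ^ 2 + ψu v ^ 2 + ψv v ^ 2) := by
  have h1 := h.hardy_psi hm
  have h2 := h.hardy_psiu hm ha
  have h3 := h.boundary_le (by linarith)
  have c0 := h.cont_rpow (-m - 1)
  have cp := h.cont_ψ
  have cu := h.cont_ψu
  have e : (∫ v in α..V, r v ^ (-m - 1) * (ψ v ^ 2 + ψu v ^ 2)) =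
      (∫ v in α..V, r v ^ (-m - 1) * ψ v ^ 2) + ∫ v in α..V, r v ^ (-m - 1) * ψu v ^ 2 := by
    rw [← intervalIntegral.integral_add (h.intervalIntegrable (by fun_prop))
      (h.intervalIntegrable (by fun_prop))]
    simp only [mul_add]
  have hY : 0 ≤ ∫ v in α..V, r v ^ (1 - m) * ψv v ^ 2 :=
    intervalIntegral.integral_nonneg (by linarith [h.le]) fun v hv =>
      mul_nonneg (Real.rpow_nonneg (by linarith [h.one_le v hv]) _) (sq_nonneg _)
  rw [e]
  set X := ∫ v in α..V, r v ^ (-m - 1) * ψ v ^ 2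
  set G := ∫ v in α..V, r v ^ (-m - 1) * ψu v ^ 2
  set Y := ∫ v in α..V, r v ^ (1 - m) * ψv v ^ 2
  set L := ∫ v in α..α + 1, (ψ v ^ 2 + ψu v ^ 2 + ψv v ^ 2)
  have i1 : 1 ≤ 1 / m := by rw [le_div_iff₀ hm]; linarith
  have i2 : 1 ≤ 1 / m ^ 2 := by
    rw [le_div_iff₀ (by positivity)]; nlinarith
  have e1 : 5 / m ^ 2 = 5 * (1 / m ^ 2) := by ring
  have e2 : 6 / m ^ 2 = 6 * (1 / m ^ 2) := by ring
  have e3 : 5 / (2 * m) = 5 / 2 * (1 / m) := by field_simp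
  have e4 : 5 / (4 * m) = 5 / 4 * (1 / m) := by field_simp
  have e5 : 9 / m = 9 * (1 / m) := by ring
  rw [e1, e3] at h1
  rw [e4] at h2
  rw [e2, e5]
  have h4 : 1 * Y ≤ 1 / m ^ 2 * Y := mul_le_mul_of_nonneg_right i2 hY
  have h5 : 1 / m * (ψ α ^ 2 + ψu α ^ 2) ≤ 1 / m * (3 * L) :=
    mul_le_mul_of_nonneg_left h3 (by positivity)
  have h6 : 0 ≤ 1 / m * ψu α ^ 2 := by positivity
  have h7 : 0 ≤ 1 / m * ψ α ^ 2 := by positivity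
  linarith

end Slice

/-! ### The `r^q` bulk term on one cone -/

namespace Slice
variable {a α V m : ℝ} {r ru rv ψ ψu ψv F : ℝ → ℝ}

/-- The `u`-derivative of the `r^q`-weighted energy density. -/
def rate (q : ℝ) (r ru ψv F : ℝ → ℝ) (v : ℝ) : ℝ :=
  q * r v ^ (q - 1) * ru v * ψv v ^ 2 + r v ^ q * (2 * ψv v * F v)

theorem cont_rate (h : Slice a α V r ru rv ψ ψu ψv F) (q : ℝ) :
    ContinuousOn (rate q r ru ψv F) (Icc α V) := by
  have c0 := h.cont_rpow (q - 1)
  have c1 := h.cont_rpow q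
  have cr := h.cont_ru
  have cq := h.cont_ψv
  have cF := h.cont_F
  unfold rate
  fun_prop

/-- Young's inequality with a free length l: it is taken proportional to r in the range q < 2 and
equal to the retarded time in the range q < 3. -/
theorem two_mul_le (h : Slice a α V r ru rv ψ ψu ψv F) {v : ℝ} (hv : v ∈ Icc α V) {l : ℝ}
    (hl : 0 < l) : r v ^ 2 * (2 * ψv v * F v) ≤ 2 * a * r v * ψv v ^ 2 + a / l * r v ^ 2 * ψv v ^ 2
      + 2 * a * l / r v ^ 2 * (ψ v ^ 2 + ψu v ^ 2) := by
  have hr0 : 0 < r v := by linarith [h.one_le v hv]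
  have hF := h.F_le_weighted hv
  have ha := h.a_nonneg
  have h1 : r v ^ 2 * (2 * ψv v * F v) ≤ 2 * |ψv v| * (|F v| * r v ^ 2) := by
    have := le_abs_self (ψv v * F v)
    rw [abs_mul] at this
    nlinarith [sq_nonneg (r v)]
  have h2 : 2 * |ψv v| * (|F v| * r v ^ 2) ≤ 2 * |ψv v| * (a * (r v * |ψv v| + |ψ v| + |ψu v|)) :=
    mul_le_mul_of_nonneg_left hF (by positivity)
  have h3 : 2 * |ψv v| * (|ψ v| + |ψu v|) ≤ 1 / l * r v ^ 2 * ψv v ^ 2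
      + 2 * l / r v ^ 2 * (ψ v ^ 2 + ψu v ^ 2) := by
    rw [← sq_abs (ψv v), ← sq_abs (ψ v), ← sq_abs (ψu v)]
    have e : 1 / l * r v ^ 2 * |ψv v| ^ 2 + 2 * l / r v ^ 2 * (|ψ v| ^ 2 + |ψu v| ^ 2)
        - 2 * |ψv v| * (|ψ v| + |ψu v|)
        = 1 / l * (r v * |ψv v| - l / r v * (|ψ v| + |ψu v|)) ^ 2
          + l / r v ^ 2 * (|ψ v| - |ψu v|) ^ 2 := by
      field_simp
      ring
    have : 0 ≤ 1 / l * (r v * |ψv v| - l / r v * (|ψ v| + |ψu v|)) ^ 2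
          + l / r v ^ 2 * (|ψ v| - |ψu v|) ^ 2 := by positivity
    linarith
  have h4 := mul_le_mul_of_nonneg_left h3 ha
  have e1 : 2 * |ψv v| * (a * (r v * |ψv v| + |ψ v| + |ψu v|))
      = 2 * a * r v * |ψv v| ^ 2 + a * (2 * |ψv v| * (|ψ v| + |ψu v|)) := by ring
  rw [e1, sq_abs] at h2
  have e2 : a * (1 / l * r v ^ 2 * ψv v ^ 2 + 2 * l / r v ^ 2 * (ψ v ^ 2 + ψu v ^ 2))
    = a / l * r v ^ 2 * ψv v ^ 2 + 2 * a * l / r v ^ 2 * (ψ v ^ 2 + ψu v ^ 2) := by ring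
  linarith

/-- The `r^q`-weighted energy density for `1 ≤ q < 2`. -/
theorem integral_rate_le (h : Slice a α V r ru rv ψ ψu ψv F) (hm : 0 < m) (hm1 : m ≤ 1)
    (ha : a ≤ m / 100) : ∫ v in α..V, rate (2 - m) r ru ψv F v ≤
      -(1 / 2) * (∫ v in α..V, r v ^ (1 - m) * ψv v ^ 2)
        + ∫ v in α..α + 1, (ψ v ^ 2 + ψu v ^ 2 + ψv v ^ 2) := by
  have c0 := h.cont_rpow (-m - 1)
  have c1 := h.cont_rpow (1 - m)
  have cp := h.cont_ψ
  have cq := h.cont_ψv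
  have cu := h.cont_ψu
  have ha0 := h.a_nonneg
  have hH := h.hardy hm hm1 (by linarith)
  have hle : α ≤ V := by linarith [h.le]
  have hY : 0 ≤ ∫ v in α..V, r v ^ (1 - m) * ψv v ^ 2 :=
    intervalIntegral.integral_nonneg hle fun v hv =>
      mul_nonneg (Real.rpow_nonneg (by linarith [h.one_le v hv]) _) (sq_nonneg _)
  have hL : 0 ≤ ∫ v in α..α + 1, (ψ v ^ 2 + ψu v ^ 2 + ψv v ^ 2) :=
    intervalIntegral.integral_nonneg (by linarith) fun v hv => by positivity
  have key : ∫ v in α..V, rate (2 - m) r ru ψv F v ≤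
      ∫ v in α..V, ((-(9 / 10) + 2 * a + 2 * a / m) * (r v ^ (1 - m) * ψv v ^ 2)
        + a * m * (r v ^ (-m - 1) * (ψ v ^ 2 + ψu v ^ 2))) := by
    refine intervalIntegral.integral_mono_on hle (h.intervalIntegrable (h.cont_rate _))
      (h.intervalIntegrable (by fun_prop)) fun v hv => ?_
    have hr := h.one_le v hv
    have hru := h.ru_le v hv
    have hr0 : 0 < r v := by linarith
    obtain ⟨-, e2, e3, -⟩ := rpow_eq hr0 m
    have e4 : 2 - m - 1 = 1 - m := by ring
    rw [rate, e4, e3, e2]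
    have hz : 0 < r v ^ (-m - 1) := Real.rpow_pos_of_pos hr0 _
    set z := r v ^ (-m - 1)
    -- With l proportional to r both errors carry the Hardy weights r^{1-m} and r^{-m-1}. The factor
    -- m balances 2a/m in front of ψ_v² against am · 6/m² after Hardy, so a ≲ m is enough.
    have h1 := h.two_mul_le hv (l := m * r v / 2) (by positivity)
    have h2 := mul_le_mul_of_nonneg_left h1 (mul_nonneg hz.le hr0.le)
    have e5 : z * r v * (2 * a * r v * ψv v ^ 2 + a / (m * r v / 2) * r v ^ 2 * ψv v ^ 2
        + 2 * a * (m * r v / 2) / r v ^ 2 * (ψ v ^ 2 + ψu v ^ 2))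
        = (2 * a + 2 * a / m) * (z * r v ^ 2 * ψv v ^ 2) + a * m * (z * (ψ v ^ 2 + ψu v ^ 2)) := by
      field_simp
    have h3 : (2 - m) * ru v ≤ -(9 / 10) := by nlinarith
    have h4 := mul_le_mul_of_nonneg_right h3 (by positivity : 0 ≤ z * r v ^ 2 * ψv v ^ 2)
    linarith
  rw [intervalIntegral.integral_add (h.intervalIntegrable (by fun_prop))
    (h.intervalIntegrable (by fun_prop)), intervalIntegral.integral_const_mul,
    intervalIntegral.integral_const_mul] at key
  set X := ∫ v in α..V, r v ^ (-m - 1) * (ψ v ^ 2 + ψu v ^ 2)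
  set Y := ∫ v in α..V, r v ^ (1 - m) * ψv v ^ 2
  set L := ∫ v in α..α + 1, (ψ v ^ 2 + ψu v ^ 2 + ψv v ^ 2)
  have h5 := mul_le_mul_of_nonneg_left hH (by positivity : 0 ≤ a * m)
  have e6 : a * m * (6 / m ^ 2 * Y + 9 / m * L) = 6 * (a / m) * Y + 9 * a * L := by
    field_simp
  have h6 : a / m ≤ 1 / 100 := by rw [div_le_iff₀ hm]; linarith
  have h7 : (2 * a + 8 * (a / m)) * Y ≤ (2 / 5) * Y :=
    mul_le_mul_of_nonneg_right (by linarith) hY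
  have h8 : 9 * a * L ≤ 1 * L := mul_le_mul_of_nonneg_right (by linarith) hL
  have e7 : 2 * a / m = 2 * (a / m) := by ring
  rw [e7] at key
  linarith

set_option maxHeartbeats 400000 in
/-- The `r^q`-weighted energy density for `2 ≤ q < 3`. -/
theorem integral_rate_le_high (h : Slice a α V r ru rv ψ ψu ψv F) (hm : 0 < m) (hm1 : m ≤ 1)
    (ha : a ≤ m ^ 2 / 100) {s : ℝ} (hs : 0 < s) : ∫ v in α..V, rate (3 - m) r ru ψv F v ≤
      -(∫ v in α..V, r v ^ (2 - m) * ψv v ^ 2) + a / s * (∫ v in α..V, r v ^ (3 - m) * ψv v ^ 2)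
        + 1 / 8 * s * (∫ v in α..V, r v ^ (1 - m) * ψv v ^ 2)
        + s * ∫ v in α..α + 1, (ψ v ^ 2 + ψu v ^ 2 + ψv v ^ 2) := by
  have c0 := h.cont_rpow (-m - 1)
  have c1 := h.cont_rpow (2 - m)
  have c2 := h.cont_rpow (3 - m)
  have cp := h.cont_ψ
  have cq := h.cont_ψv
  have cu := h.cont_ψu
  have ha0 := h.a_nonneg
  have hm2 : m ^ 2 ≤ m := by nlinarith
  have hH := h.hardy hm hm1 (by linarith)
  have hle : α ≤ V := by linarith [h.le]
  have hY (q : ℝ) : 0 ≤ ∫ v in α..V, r v ^ q * ψv v ^ 2 :=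
    intervalIntegral.integral_nonneg hle fun v hv =>
      mul_nonneg (Real.rpow_nonneg (by linarith [h.one_le v hv]) _) (sq_nonneg _)
  have hL : 0 ≤ ∫ v in α..α + 1, (ψ v ^ 2 + ψu v ^ 2 + ψv v ^ 2) :=
    intervalIntegral.integral_nonneg (by linarith) fun v hv => by positivity
  have key : ∫ v in α..V, rate (3 - m) r ru ψv F v ≤
      ∫ v in α..V, ((-(9 / 5) + 2 * a) * (r v ^ (2 - m) * ψv v ^ 2)
        + a / s * (r v ^ (3 - m) * ψv v ^ 2)
        + 2 * a * s * (r v ^ (-m - 1) * (ψ v ^ 2 + ψu v ^ 2))) := by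
    refine intervalIntegral.integral_mono_on hle (h.intervalIntegrable (h.cont_rate _))
      (h.intervalIntegrable (by fun_prop)) fun v hv => ?_
    have hr := h.one_le v hv
    have hru := h.ru_le v hv
    have hr0 : 0 < r v := by linarith
    obtain ⟨-, -, e2, e3⟩ := rpow_eq hr0 m
    have e4 : 3 - m - 1 = 2 - m := by ring
    rw [rate, e4, e3, e2]
    have hz : 0 < r v ^ (-m - 1) := Real.rpow_pos_of_pos hr0 _
    set z := r v ^ (-m - 1)
    -- A length independent of r keeps the weight r^{-m-1} on ψ², so Hardy still applies; the price
    -- is the full weight r^{3-m} on ψ_v², with the factor a/s. The Hardy constant 6/m² now meets no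
    -- compensating m, which is why a ≤ m²/100 is required.
    have h1 := h.two_mul_le hv (l := s) hs
    have h2 := mul_le_mul_of_nonneg_left h1 (mul_nonneg hz.le (sq_nonneg (r v)))
    have e5 : z * r v ^ 2 * (2 * a * r v * ψv v ^ 2 + a / s * r v ^ 2 * ψv v ^ 2
        + 2 * a * s / r v ^ 2 * (ψ v ^ 2 + ψu v ^ 2))
        = 2 * a * (z * r v ^ 3 * ψv v ^ 2) + a / s * (z * r v ^ 4 * ψv v ^ 2)
          + 2 * a * s * (z * (ψ v ^ 2 + ψu v ^ 2)) := by
      field_simp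
    have h3 : (3 - m) * ru v ≤ -(9 / 5) := by nlinarith
    have h4 := mul_le_mul_of_nonneg_right h3 (by positivity : 0 ≤ z * r v ^ 3 * ψv v ^ 2)
    linarith
  rw [intervalIntegral.integral_add (h.intervalIntegrable (by fun_prop))
    (h.intervalIntegrable (by fun_prop)), intervalIntegral.integral_add
    (h.intervalIntegrable (by fun_prop)) (h.intervalIntegrable (by fun_prop)),
    intervalIntegral.integral_const_mul, intervalIntegral.integral_const_mul,
    intervalIntegral.integral_const_mul] at key
  have hY1 := hY (1 - m)
  have hY2 := hY (2 - m)
  set X := ∫ v in α..V, r v ^ (-m - 1) * (ψ v ^ 2 + ψu v ^ 2)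
  set Y := ∫ v in α..V, r v ^ (1 - m) * ψv v ^ 2
  set Y2 := ∫ v in α..V, r v ^ (2 - m) * ψv v ^ 2
  set L := ∫ v in α..α + 1, (ψ v ^ 2 + ψu v ^ 2 + ψv v ^ 2)
  have h5 := mul_le_mul_of_nonneg_left hH (by positivity : 0 ≤ 2 * a * s)
  have e6 : 2 * a * s * (6 / m ^ 2 * Y + 9 / m * L)
      = 12 * (a / m ^ 2) * (s * Y) + 18 * (a / m) * (s * L) := by
    field_simp
    ring
  have h6 : a / m ^ 2 ≤ 1 / 100 := by rw [div_le_iff₀ (by positivity)]; linarith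
  have h6' : a / m ≤ 1 / 100 := by rw [div_le_iff₀ hm]; linarith
  have h7 : 12 * (a / m ^ 2) * (s * Y) ≤ 1 / 8 * (s * Y) :=
    mul_le_mul_of_nonneg_right (by linarith) (by positivity)
  have h8 : 18 * (a / m) * (s * L) ≤ 1 * (s * L) :=
    mul_le_mul_of_nonneg_right (by linarith) (by positivity)
  have h9 : 2 * a * Y2 ≤ 4 / 5 * Y2 := mul_le_mul_of_nonneg_right (by linarith) hY2
  linarith

end Slice

/-! ### Transport along ingoing lines -/

/-- The part `u₀ ≤ u ≤ U`, `v ≥ u + R` of the plane. -/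
def farRegion (u₀ U R : ℝ) : Set (ℝ × ℝ) := {x | u₀ ≤ x.1 ∧ x.1 ≤ U ∧ x.1 + R ≤ x.2}

section
variable {u₀ U R V : ℝ} {f g g' : ℝ → ℝ → ℝ}

theorem continuousOn_slice (hf : ContinuousOn (fun x : ℝ × ℝ => f x.1 x.2) (farRegion u₀ U R))
    {u : ℝ} (hu : u ∈ Icc u₀ U) : ContinuousOn (f u) (Ici (u + R)) :=
  hf.comp (f := fun v => (u, v)) (by fun_prop) fun _ hv => ⟨hu.1, hu.2, hv⟩

/-- Clamping u to [u₀, U] and v to v ≥ u + R extends the integrand to a continuous function on the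
plane without changing it on the region of integration. -/
theorem continuousOn_integral_slice (h0 : u₀ ≤ U)
    (hf : ContinuousOn (fun x : ℝ × ℝ => f x.1 x.2) (farRegion u₀ U R)) {β : ℝ → ℝ}
    (hβ : Continuous β) (hβ' : ∀ u ∈ Icc u₀ U, u + R ≤ β u) :
    ContinuousOn (fun u => ∫ v in (u + R)..β u, f u v) (Icc u₀ U) := by
  let c : ℝ → ℝ := fun u => max u₀ (min U u)
  have hc : Continuous c := by fun_prop
  have hc0 (u : ℝ) : u₀ ≤ c u := le_max_left _ _
  have hc1 (u : ℝ) : c u ≤ U := max_le h0 (min_le_left _ _)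
  have hF : Continuous (fun x : ℝ × ℝ => f (c x.1) (max x.2 (c x.1 + R))) := by
    refine hf.comp_continuous (f := fun x : ℝ × ℝ => (c x.1, max x.2 (c x.1 + R)))
      (by fun_prop) fun x => ⟨hc0 _, hc1 _, le_max_right _ _⟩
  have h1 : Continuous fun u => ∫ v in (0 : ℝ)..β u, f (c u) (max v (c u + R)) :=
    intervalIntegral.continuous_parametric_intervalIntegral_of_continuous (a₀ := 0) hF hβ
  have h2 : Continuous fun u => ∫ v in (0 : ℝ)..(u + R), f (c u) (max v (c u + R)) :=
    intervalIntegral.continuous_parametric_intervalIntegral_of_continuous (a₀ := 0) hF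
      (by fun_prop)
  refine (h1.sub h2).continuousOn.congr fun u hu => ?_
  simp only [Pi.sub_apply]
  have hcu : c u = u := by simp [c, hu.1, hu.2]
  have hi (x y : ℝ) : IntervalIntegrable (fun v => f (c u) (max v (c u + R))) volume x y :=
    (hF.comp (by fun_prop : Continuous fun v => (u, v))).intervalIntegrable x y
  rw [intervalIntegral.integral_interval_sub_left (hi _ _) (hi _ _)]
  refine intervalIntegral.integral_congr fun v hv => ?_
  rw [uIcc_of_le (hβ' u hu)] at hv
  simp only [hcu, max_eq_left hv.1]

/-- Transport estimate: the flux through the boundary `v = u + R` has a sign. -/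
theorem transport (h0 : u₀ ≤ U) (hV : U + R ≤ V)
    (hg : ContinuousOn (fun x : ℝ × ℝ => g x.1 x.2) (farRegion u₀ U R))
    (hg' : ContinuousOn (fun x : ℝ × ℝ => g' x.1 x.2) (farRegion u₀ U R))
    (hd : ∀ u v, (u, v) ∈ farRegion u₀ U R → HasDerivAt (fun s => g s v) (g' u v) u)
    (hpos : ∀ u v, (u, v) ∈ farRegion u₀ U R → 0 ≤ g u v) :
    ∫ v in (U + R)..V, g U v ≤
      (∫ v in (u₀ + R)..V, g u₀ v) + ∫ u in u₀..U, ∫ v in (u + R)..V, g' u v := by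
  -- The derivative is integrated over this compact trapezoid in both orders; Fubini for its
  -- extension by zero replaces a divergence theorem.
  let K : Set (ℝ × ℝ) := (Icc u₀ U ×ˢ Icc (u₀ + R) V) ∩ {x | x.1 + R ≤ x.2}
  have hKc : IsCompact K := (isCompact_Icc.prod isCompact_Icc).inter_right
    (isClosed_le (by fun_prop) (by fun_prop))
  have hKs : K ⊆ farRegion u₀ U R := fun x hx => ⟨hx.1.1.1, hx.1.1.2, hx.2⟩
  let G : ℝ → ℝ → ℝ := fun u v => K.indicator (fun x => g' x.1 x.2) (u, v)
  have hGi : Integrable (Function.uncurry G) (volume.prod volume) := by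
    have := ((hg'.mono hKs).integrableOn_compact hKc (μ := volume.prod volume)).integrable_indicator
      hKc.measurableSet
    exact this
  have swap := integral_integral_swap hGi
  have hL : (fun u => ∫ v, G u v) =
      (Icc u₀ U).indicator (fun u => ∫ v in (u + R)..V, g' u v) := by
    ext u
    by_cases hu : u ∈ Icc u₀ U
    · rw [indicator_of_mem hu, intervalIntegral.integral_of_le (by linarith [hu.2]),
        ← integral_Icc_eq_integral_Ioc, ← integral_indicator measurableSet_Icc]
      congr 1; ext v
      by_cases hv : v ∈ Icc (u + R) V
      · rw [indicator_of_mem hv]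
        exact indicator_of_mem (s := K) ⟨⟨hu, by linarith [hu.1, hv.1], hv.2⟩, hv.1⟩ _
      · rw [indicator_of_notMem hv]
        exact indicator_of_notMem (fun h => hv ⟨h.2, h.1.2.2⟩) _
    · rw [indicator_of_notMem hu]
      have : ∀ v, G u v = 0 := fun v => indicator_of_notMem (fun h => hu h.1.1) _
      simp [this]
  -- The ingoing line at height v leaves the region at u = min(U, v - R): either at the final time
  -- or through the curve v = u + R.
  have hRt : (fun v => ∫ u, G u v) =
      (Icc (u₀ + R) V).indicator (fun v => g (min U (v - R)) v - g u₀ v) := by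
    ext v
    by_cases hv : v ∈ Icc (u₀ + R) V
    · have hτ : u₀ ≤ min U (v - R) := le_min h0 (by linarith [hv.1])
      have hmem : ∀ u ∈ Icc u₀ (min U (v - R)), (u, v) ∈ farRegion u₀ U R := fun u hu =>
        ⟨hu.1, hu.2.trans (min_le_left _ _), by linarith [hu.2.trans (min_le_right _ _)]⟩
      have hcont : ContinuousOn (fun u => g' u v) (Icc u₀ (min U (v - R))) :=
        hg'.comp (f := fun u => (u, v)) (by fun_prop) hmem
      rw [indicator_of_mem hv, ← intervalIntegral.integral_eq_sub_of_hasDerivAt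
        (f := fun u => g u v) (f' := fun u => g' u v)
        (by rw [uIcc_of_le hτ]; exact fun u hu => hd u v (hmem u hu))
        (hcont.intervalIntegrable_of_Icc hτ),
        intervalIntegral.integral_of_le hτ,
        ← integral_Icc_eq_integral_Ioc, ← integral_indicator measurableSet_Icc]
      congr 1; ext u
      by_cases hu : u ∈ Icc u₀ (min U (v - R))
      · rw [indicator_of_mem hu]
        exact indicator_of_mem (s := K) ⟨⟨⟨hu.1, (hmem u hu).2.1⟩, hv⟩, (hmem u hu).2.2⟩ _
      · rw [indicator_of_notMem hu]
        exact indicator_of_notMem (fun h => hu ⟨h.1.1.1, le_min h.1.1.2 (by linarith [h.2.out])⟩) _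
    · rw [indicator_of_notMem hv]
      have : ∀ u, G u v = 0 := fun u => indicator_of_notMem (fun h => hv h.1.2) _
      simp [this]
  rw [hL, hRt, integral_indicator measurableSet_Icc, integral_indicator measurableSet_Icc,
    integral_Icc_eq_integral_Ioc, integral_Icc_eq_integral_Ioc,
    ← intervalIntegral.integral_of_le h0, ← intervalIntegral.integral_of_le (by linarith)] at swap
  have hu₀ : u₀ ∈ Icc u₀ U := ⟨le_rfl, h0⟩
  have c1 : ContinuousOn (g u₀) (Icc (u₀ + R) V) :=
    (continuousOn_slice hg hu₀).mono Icc_subset_Ici_self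
  have hmem : ∀ v ∈ Icc (u₀ + R) V, (min U (v - R), v) ∈ farRegion u₀ U R := fun v hv =>
    ⟨le_min h0 (by linarith [hv.1]), min_le_left _ _, by linarith [min_le_right U (v - R)]⟩
  have c2 : ContinuousOn (fun v => g (min U (v - R)) v) (Icc (u₀ + R) V) :=
    hg.comp (f := fun v => (min U (v - R), v)) (by fun_prop) hmem
  have hle : u₀ + R ≤ V := by linarith
  have i1 := c1.intervalIntegrable_of_Icc (μ := volume) hle
  have i2 := c2.intervalIntegrable_of_Icc (μ := volume) hle
  rw [intervalIntegral.integral_sub i2 i1] at swap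
  -- For v < U + R the line exits through the curve; that contribution is nonnegative and is
  -- dropped.
  have hsplit : ∫ v in (U + R)..V, g U v ≤ ∫ v in (u₀ + R)..V, g (min U (v - R)) v := by
    have e : ∫ v in (U + R)..V, g U v = ∫ v in (U + R)..V, g (min U (v - R)) v := by
      refine intervalIntegral.integral_congr fun v hv => ?_
      rw [uIcc_of_le hV] at hv
      simp only [min_eq_left (by linarith [hv.1] : U ≤ v - R)]
    rw [e]
    refine intervalIntegral.integral_mono_interval (by linarith) hV le_rfl ?_ i2
    refine (ae_restrict_iff' measurableSet_Ioc).2 (ae_of_all _ fun v hv => ?_)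
    exact hpos _ _ (hmem v (Ioc_subset_Icc_self hv))
  linarith

end

/-- A radiation field `ψ` on the far region, together with its derivatives `ψ_u`, `ψ_v` and
`ψ_{uv} = F`; here `F` is a scale-critical perturbation of size `a`. -/
structure RadialWave (u₀ U R a : ℝ) (r ru rv ψ ψu ψv F : ℝ → ℝ → ℝ) : Prop where
  one_le_u₀ : 1 ≤ u₀
  le : u₀ ≤ U
  a_nonneg : 0 ≤ a
  cont_r : ContinuousOn (fun x : ℝ × ℝ => r x.1 x.2) (farRegion u₀ U R)
  cont_ru : ContinuousOn (fun x : ℝ × ℝ => ru x.1 x.2) (farRegion u₀ U R)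
  cont_ψ : ContinuousOn (fun x : ℝ × ℝ => ψ x.1 x.2) (farRegion u₀ U R)
  cont_ψu : ContinuousOn (fun x : ℝ × ℝ => ψu x.1 x.2) (farRegion u₀ U R)
  cont_ψv : ContinuousOn (fun x : ℝ × ℝ => ψv x.1 x.2) (farRegion u₀ U R)
  cont_F : ContinuousOn (fun x : ℝ × ℝ => F x.1 x.2) (farRegion u₀ U R)
  dur : ∀ u v, (u, v) ∈ farRegion u₀ U R → HasDerivAt (fun s => r s v) (ru u v) u
  dvr : ∀ u v, (u, v) ∈ farRegion u₀ U R → HasDerivAt (fun s => r u s) (rv u v) v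
  dvψ : ∀ u v, (u, v) ∈ farRegion u₀ U R → HasDerivAt (fun s => ψ u s) (ψv u v) v
  dvψu : ∀ u v, (u, v) ∈ farRegion u₀ U R → HasDerivAt (fun s => ψu u s) (F u v) v
  duψv : ∀ u v, (u, v) ∈ farRegion u₀ U R → HasDerivAt (fun s => ψv s v) (F u v) u
  one_le : ∀ u v, (u, v) ∈ farRegion u₀ U R → 1 ≤ r u v
  ru_le : ∀ u v, (u, v) ∈ farRegion u₀ U R → ru u v ≤ -(9 / 10)
  le_rv : ∀ u v, (u, v) ∈ farRegion u₀ U R → 9 / 10 ≤ rv u v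
  F_le : ∀ u v, (u, v) ∈ farRegion u₀ U R →
    |F u v| ≤ a * (|ψv u v| / r u v + |ψ u v| / r u v ^ 2 + |ψu u v| / r u v ^ 2)

/-- The truncated `r^q`-weighted energy. -/
def truncEnergy (R : ℝ) (r ψv : ℝ → ℝ → ℝ) (q V u : ℝ) : ℝ :=
  ∫ v in (u + R)..V, r u v ^ q * ψv u v ^ 2

/-- The local energy near the curve `v = u + R`. -/
def nearEnergy (R : ℝ) (ψ ψu ψv : ℝ → ℝ → ℝ) (u : ℝ) : ℝ :=
  ∫ v in (u + R)..(u + R + 1), (ψ u v ^ 2 + ψu u v ^ 2 + ψv u v ^ 2)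

namespace RadialWave
variable {u₀ U R a m b V : ℝ} {r ru rv ψ ψu ψv F : ℝ → ℝ → ℝ}

theorem slice (h : RadialWave u₀ U R a r ru rv ψ ψu ψv F) {u : ℝ} (hu : u ∈ Icc u₀ U)
    (hV : u + R + 1 ≤ V) :
    Slice a (u + R) V (r u) (ru u) (rv u) (ψ u) (ψu u) (ψv u) (F u) := by
  have hm {v : ℝ} (hv : v ∈ Icc (u + R) V) : (u, v) ∈ farRegion u₀ U R := ⟨hu.1, hu.2, hv.1⟩
  have hc {f : ℝ → ℝ → ℝ} (hf : ContinuousOn (fun x : ℝ × ℝ => f x.1 x.2) (farRegion u₀ U R)) :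
      ContinuousOn (f u) (Icc (u + R) V) := (continuousOn_slice hf hu).mono Icc_subset_Ici_self
  exact ⟨hV, h.a_nonneg, hc h.cont_r, hc h.cont_ru, hc h.cont_ψ, hc h.cont_ψu, hc h.cont_ψv,
    hc h.cont_F, fun v hv => h.dvr u v (hm hv), fun v hv => h.dvψ u v (hm hv),
    fun v hv => h.dvψu u v (hm hv), fun v hv => h.one_le u v (hm hv),
    fun v hv => h.ru_le u v (hm hv), fun v hv => h.le_rv u v (hm hv),
    fun v hv => h.F_le u v (hm hv)⟩

theorem cont_density (h : RadialWave u₀ U R a r ru rv ψ ψu ψv F) (q : ℝ) :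
    ContinuousOn (fun x : ℝ × ℝ => r x.1 x.2 ^ q * ψv x.1 x.2 ^ 2) (farRegion u₀ U R) :=
  (h.cont_r.rpow_const fun x hx => Or.inl (by linarith [h.one_le x.1 x.2 hx])).mul
    (h.cont_ψv.pow 2)

theorem cont_rate (h : RadialWave u₀ U R a r ru rv ψ ψu ψv F) (q : ℝ) :
    ContinuousOn (fun x : ℝ × ℝ => Slice.rate q (r x.1) (ru x.1) (ψv x.1) (F x.1) x.2)
      (farRegion u₀ U R) := by
  have h1 := h.cont_r.rpow_const (p := q - 1)
    fun x hx => Or.inl (by linarith [h.one_le x.1 x.2 hx])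
  have h2 := h.cont_r.rpow_const (p := q) fun x hx => Or.inl (by linarith [h.one_le x.1 x.2 hx])
  have h3 := h.cont_ru
  have h4 := h.cont_ψv
  have h5 := h.cont_F
  unfold Slice.rate
  fun_prop

theorem hasDerivAt_density (h : RadialWave u₀ U R a r ru rv ψ ψu ψv F) (q : ℝ) {u v : ℝ}
    (hx : (u, v) ∈ farRegion u₀ U R) : HasDerivAt (fun s => r s v ^ q * ψv s v ^ 2)
      (Slice.rate q (r u) (ru u) (ψv u) (F u) v) u :=
  Slice.hasDerivAt_weighted (h.dur u v hx) (by linarith [h.one_le u v hx]) (h.duψv u v hx) q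

theorem density_nonneg (h : RadialWave u₀ U R a r ru rv ψ ψu ψv F) (q : ℝ) {u v : ℝ}
    (hx : (u, v) ∈ farRegion u₀ U R) : 0 ≤ r u v ^ q * ψv u v ^ 2 :=
  mul_nonneg (Real.rpow_nonneg (by linarith [h.one_le u v hx]) _) (sq_nonneg _)

theorem truncEnergy_nonneg (h : RadialWave u₀ U R a r ru rv ψ ψu ψv F) (q : ℝ) {u : ℝ}
    (hu : u ∈ Icc u₀ U) (hV : u + R ≤ V) : 0 ≤ truncEnergy R r ψv q V u :=
  intervalIntegral.integral_nonneg hV fun _ hv => h.density_nonneg q ⟨hu.1, hu.2, hv.1⟩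

theorem nearEnergy_nonneg (u : ℝ) : 0 ≤ nearEnergy R ψ ψu ψv u :=
  intervalIntegral.integral_nonneg (by linarith) fun v _ => by positivity

theorem cont_truncEnergy (h : RadialWave u₀ U R a r ru rv ψ ψu ψv F) (q : ℝ)
    (hV : U + R ≤ V) : ContinuousOn (truncEnergy R r ψv q V) (Icc u₀ U) :=
  continuousOn_integral_slice h.le (f := fun u v => r u v ^ q * ψv u v ^ 2) (h.cont_density q)
    continuous_const fun u hu => by linarith [hu.2]

theorem cont_near (h : RadialWave u₀ U R a r ru rv ψ ψu ψv F) :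
    ContinuousOn (fun x : ℝ × ℝ => ψ x.1 x.2 ^ 2 + ψu x.1 x.2 ^ 2 + ψv x.1 x.2 ^ 2)
      (farRegion u₀ U R) := by
  have h3 := h.cont_ψ
  have h4 := h.cont_ψv
  have h5 := h.cont_ψu
  fun_prop

theorem cont_nearEnergy (h : RadialWave u₀ U R a r ru rv ψ ψu ψv F) :
    ContinuousOn (nearEnergy R ψ ψu ψv) (Icc u₀ U) :=
  continuousOn_integral_slice h.le (f := fun u v => ψ u v ^ 2 + ψu u v ^ 2 + ψv u v ^ 2)
    h.cont_near (β := fun u => u + R + 1) (by fun_prop) fun u _ => by linarith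

theorem cont_rpow (h : RadialWave u₀ U R a r ru rv ψ ψu ψv F) (b : ℝ) :
    ContinuousOn (fun s : ℝ => s ^ b) (Icc u₀ U) :=
  continuousOn_id.rpow_const fun s hs => Or.inl (by
    have := hs.1; have := h.one_le_u₀; simp only [id]; linarith)

theorem intervalIntegrable (h : RadialWave u₀ U R a r ru rv ψ ψu ψv F) {f : ℝ → ℝ}
    (hf : ContinuousOn f (Icc u₀ U)) : IntervalIntegrable f volume u₀ U :=
  hf.intervalIntegrable_of_Icc h.le

/-- Transport of the energy density with the weight `u^b`. -/
theorem weighted_density (h : RadialWave u₀ U R a r ru rv ψ ψu ψv F) (q b : ℝ) :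
    ContinuousOn (fun x : ℝ × ℝ => x.1 ^ b * (r x.1 x.2 ^ q * ψv x.1 x.2 ^ 2))
      (farRegion u₀ U R) ∧
    ContinuousOn (fun x : ℝ × ℝ => b * x.1 ^ (b - 1) * (r x.1 x.2 ^ q * ψv x.1 x.2 ^ 2)
      + x.1 ^ b * Slice.rate q (r x.1) (ru x.1) (ψv x.1) (F x.1) x.2) (farRegion u₀ U R) ∧
    (∀ u v, (u, v) ∈ farRegion u₀ U R →
      HasDerivAt (fun s => s ^ b * (r s v ^ q * ψv s v ^ 2))
        (b * u ^ (b - 1) * (r u v ^ q * ψv u v ^ 2)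
          + u ^ b * Slice.rate q (r u) (ru u) (ψv u) (F u) v) u) ∧
    (∀ u v, (u, v) ∈ farRegion u₀ U R → 0 ≤ u ^ b * (r u v ^ q * ψv u v ^ 2)) := by
  have h1 := h.one_le_u₀
  have hw (c : ℝ) : ContinuousOn (fun x : ℝ × ℝ => x.1 ^ c) (farRegion u₀ U R) :=
    continuousOn_fst.rpow_const fun x hx => Or.inl (by linarith [hx.1])
  have hdens := h.cont_density q
  have hrate := h.cont_rate q
  have hw1 := hw b
  have hw2 := hw (b - 1)
  refine ⟨by fun_prop, by fun_prop, fun u v hx => ?_, fun u v hx => ?_⟩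
  · have hu : u ≠ 0 := by have := hx.1; simp only at this; linarith
    exact (Real.hasDerivAt_rpow_const (p := b) (Or.inl hu)).mul (h.hasDerivAt_density q hx)
  · refine mul_nonneg (Real.rpow_nonneg ?_ _) (h.density_nonneg q hx)
    have := hx.1; simp only at this; linarith

theorem integral_weighted_rate (h : RadialWave u₀ U R a r ru rv ψ ψu ψv F) (q b : ℝ) {u : ℝ}
    (hu : u ∈ Icc u₀ U) (hV : u + R + 1 ≤ V) :
    ∫ v in (u + R)..V, (b * u ^ (b - 1) * (r u v ^ q * ψv u v ^ 2)
      + u ^ b * Slice.rate q (r u) (ru u) (ψv u) (F u) v)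
    = b * u ^ (b - 1) * truncEnergy R r ψv q V u
      + u ^ b * ∫ v in (u + R)..V, Slice.rate q (r u) (ru u) (ψv u) (F u) v := by
  have hs := h.slice hu hV
  have c1 := hs.cont_rate q
  have c2 := hs.cont_rpow q
  have c3 := hs.cont_ψv
  rw [intervalIntegral.integral_add (hs.intervalIntegrable (by fun_prop))
    (hs.intervalIntegrable (by fun_prop)), intervalIntegral.integral_const_mul,
    intervalIntegral.integral_const_mul]
  rfl

/-- The weighted `r^q`-estimate for `1 ≤ q < 2`. -/
theorem weighted_estimate (h : RadialWave u₀ U R a r ru rv ψ ψu ψv F) (hm : 0 < m) (hm1 : m ≤ 1)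
    (ha : a ≤ m / 100) (hV : U + R + 1 ≤ V) (b : ℝ) :
    1 / 2 * (∫ s in u₀..U, s ^ b * truncEnergy R r ψv (1 - m) V s) ≤
      u₀ ^ b * truncEnergy R r ψv (2 - m) V u₀
        + (∫ s in u₀..U, b * s ^ (b - 1) * truncEnergy R r ψv (2 - m) V s)
        + ∫ s in u₀..U, s ^ b * nearEnergy R ψ ψu ψv s := by
  obtain ⟨w1, w2, w3, w4⟩ := h.weighted_density (2 - m) b
  have hle := h.le
  have h1 := h.one_le_u₀
  have key := transport (V := V) (g := fun u v => u ^ b * (r u v ^ (2 - m) * ψv u v ^ 2))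
    (g' := fun u v => b * u ^ (b - 1) * (r u v ^ (2 - m) * ψv u v ^ 2)
          + u ^ b * Slice.rate (2 - m) (r u) (ru u) (ψv u) (F u) v)
    hle (by linarith) w1 w2 w3 w4
  have hU : 0 ≤ ∫ v in (U + R)..V, U ^ b * (r U v ^ (2 - m) * ψv U v ^ 2) :=
    intervalIntegral.integral_nonneg (by linarith) fun v hv => w4 _ _ ⟨hle, le_rfl, hv.1⟩
  have e0 : ∫ v in (u₀ + R)..V, u₀ ^ b * (r u₀ v ^ (2 - m) * ψv u₀ v ^ 2)
      = u₀ ^ b * truncEnergy R r ψv (2 - m) V u₀ := by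
    rw [intervalIntegral.integral_const_mul]; rfl
  rw [e0] at key
  have cT1 := h.cont_truncEnergy (1 - m) (V := V) (by linarith)
  have cT2 := h.cont_truncEnergy (2 - m) (V := V) (by linarith)
  have cL := h.cont_nearEnergy
  have cw := h.cont_rpow b
  have cw' := h.cont_rpow (b - 1)
  have hmono : ∫ u in u₀..U, ∫ v in (u + R)..V, (b * u ^ (b - 1) * (r u v ^ (2 - m) * ψv u v ^ 2)
      + u ^ b * Slice.rate (2 - m) (r u) (ru u) (ψv u) (F u) v) ≤
      ∫ s in u₀..U, (b * s ^ (b - 1) * truncEnergy R r ψv (2 - m) V s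
        + (-(1 / 2) * (s ^ b * truncEnergy R r ψv (1 - m) V s)
        + s ^ b * nearEnergy R ψ ψu ψv s)) := by
    refine intervalIntegral.integral_mono_on hle (h.intervalIntegrable ?_)
      (h.intervalIntegrable (by fun_prop)) fun s hs => ?_
    · exact continuousOn_integral_slice hle w2 continuous_const fun u hu => by linarith [hu.2]
    · have hsV : s + R + 1 ≤ V := by linarith [hs.2]
      rw [h.integral_weighted_rate _ _ hs hsV]
      have hr := (h.slice hs hsV).integral_rate_le hm hm1 ha
      have := mul_le_mul_of_nonneg_left hr (Real.rpow_nonneg (by linarith [hs.1] : 0 ≤ s) b)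
      have e : s ^ b * (-(1 / 2) * (∫ v in (s + R)..V, r s v ^ (1 - m) * ψv s v ^ 2)
        + ∫ v in (s + R)..(s + R + 1), (ψ s v ^ 2 + ψu s v ^ 2 + ψv s v ^ 2))
        = -(1 / 2) * (s ^ b * truncEnergy R r ψv (1 - m) V s)
        + s ^ b * nearEnergy R ψ ψu ψv s := by
        rw [truncEnergy, nearEnergy]; ring
      linarith
  rw [intervalIntegral.integral_add (h.intervalIntegrable (by fun_prop))
    (h.intervalIntegrable (by fun_prop)), intervalIntegral.integral_add
    (h.intervalIntegrable (by fun_prop)) (h.intervalIntegrable (by fun_prop)),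
    intervalIntegral.integral_const_mul (-(1 / 2) : ℝ)] at hmono
  linarith

/-- The top-order estimate: the energy with weight `r^{3-m}` grows at most like `u^γ`. -/
theorem top_estimate (h : RadialWave u₀ U R a r ru rv ψ ψu ψv F) (hm : 0 < m) (hm1 : m ≤ 1)
    (ha : a ≤ m ^ 2 / 100) {γ : ℝ} (hγ : a ≤ γ) (hV : U + R + 1 ≤ V) :
    2 * truncEnergy R r ψv (3 - m) V U + U * truncEnergy R r ψv (2 - m) V U
      + 1 / 4 * (∫ s in u₀..U, (truncEnergy R r ψv (2 - m) V s
        + s * truncEnergy R r ψv (1 - m) V s)) ≤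
    U ^ γ * (2 * truncEnergy R r ψv (3 - m) V u₀ + u₀ * truncEnergy R r ψv (2 - m) V u₀
      + 3 * ∫ s in u₀..U, s * nearEnergy R ψ ψu ψv s) := by
  obtain ⟨w1, w2, w3, w4⟩ := h.weighted_density (3 - m) (-γ)
  obtain ⟨x1, x2, x3, x4⟩ := h.weighted_density (2 - m) (1 - γ)
  have hle := h.le
  have h1 := h.one_le_u₀
  have ha0 := h.a_nonneg
  have hU0 : 0 < U := by linarith
  -- The transported density is u^{-γ}(2r^{3-m} + u r^{2-m})ψ_v². The weight u^{-γ} is the Grönwall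
  -- integrating factor, and the additional factor u makes the r^{2-m} estimate scale like the
  -- r^{3-m} one.
  have key := transport (V := V)
    (g := fun u v => 2 * (u ^ (-γ) * (r u v ^ (3 - m) * ψv u v ^ 2))
      + u ^ (1 - γ) * (r u v ^ (2 - m) * ψv u v ^ 2))
    (g' := fun u v => 2 * (-γ * u ^ (-γ - 1) * (r u v ^ (3 - m) * ψv u v ^ 2)
          + u ^ (-γ) * Slice.rate (3 - m) (r u) (ru u) (ψv u) (F u) v)
        + ((1 - γ) * u ^ (1 - γ - 1) * (r u v ^ (2 - m) * ψv u v ^ 2)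
          + u ^ (1 - γ) * Slice.rate (2 - m) (r u) (ru u) (ψv u) (F u) v))
    hle (by linarith) ((w1.const_mul 2).add x1) ((w2.const_mul 2).add x2)
    (fun u v hx => ((w3 u v hx).const_mul 2).add (x3 u v hx))
    (fun u v hx => add_nonneg (mul_nonneg zero_le_two (w4 u v hx)) (x4 u v hx))
  have hend {u : ℝ} (hu : u ∈ Icc u₀ U) :
      ∫ v in (u + R)..V, (2 * (u ^ (-γ) * (r u v ^ (3 - m) * ψv u v ^ 2))
        + u ^ (1 - γ) * (r u v ^ (2 - m) * ψv u v ^ 2))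
      = u ^ (-γ) * (2 * truncEnergy R r ψv (3 - m) V u + u * truncEnergy R r ψv (2 - m) V u) := by
    have hs := h.slice hu (V := V) (by linarith [hu.2])
    have c2 := hs.cont_rpow (3 - m)
    have c2' := hs.cont_rpow (2 - m)
    have c3 := hs.cont_ψv
    have hu0 : 0 < u := by linarith [hu.1]
    rw [intervalIntegral.integral_add (hs.intervalIntegrable (by fun_prop))
      (hs.intervalIntegrable (by fun_prop)), intervalIntegral.integral_const_mul,
      intervalIntegral.integral_const_mul, intervalIntegral.integral_const_mul,
      truncEnergy, truncEnergy, (by ring : 1 - γ = -γ + 1), Real.rpow_add_one hu0.ne']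
    ring
  rw [hend ⟨hle, le_rfl⟩, hend ⟨le_rfl, hle⟩] at key
  have cT1 := h.cont_truncEnergy (1 - m) (V := V) (by linarith)
  have cT2 := h.cont_truncEnergy (2 - m) (V := V) (by linarith)
  have cL := h.cont_nearEnergy
  have hmono : ∫ u in u₀..U, ∫ v in (u + R)..V,
      (2 * (-γ * u ^ (-γ - 1) * (r u v ^ (3 - m) * ψv u v ^ 2)
          + u ^ (-γ) * Slice.rate (3 - m) (r u) (ru u) (ψv u) (F u) v)
        + ((1 - γ) * u ^ (1 - γ - 1) * (r u v ^ (2 - m) * ψv u v ^ 2)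
          + u ^ (1 - γ) * Slice.rate (2 - m) (r u) (ru u) (ψv u) (F u) v)) ≤
      ∫ s in u₀..U, (-(1 / 4 * U ^ (-γ)) * (truncEnergy R r ψv (2 - m) V s
        + s * truncEnergy R r ψv (1 - m) V s) + 3 * (s * nearEnergy R ψ ψu ψv s)) := by
    refine intervalIntegral.integral_mono_on hle (h.intervalIntegrable ?_)
      (h.intervalIntegrable (by fun_prop)) fun s hs => ?_
    · exact continuousOn_integral_slice hle ((w2.const_mul 2).add x2) continuous_const
        fun u hu => by linarith [hu.2]
    · have hsV : s + R + 1 ≤ V := by linarith [hs.2]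
      have hs0 : 0 < s := by linarith [hs.1]
      have hsl := h.slice hs hsV
      have hi (q b : ℝ) : IntervalIntegrable (fun v => b * s ^ (b - 1) * (r s v ^ q * ψv s v ^ 2)
          + s ^ b * Slice.rate q (r s) (ru s) (ψv s) (F s) v) volume (s + R) V := by
        have c1 := hsl.cont_rate q
        have c2 := hsl.cont_rpow q
        have c3 := hsl.cont_ψv
        exact hsl.intervalIntegrable (by fun_prop)
      rw [intervalIntegral.integral_add ((hi _ _).const_mul 2) (hi _ _),
        intervalIntegral.integral_const_mul, h.integral_weighted_rate _ _ hs hsV,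
        h.integral_weighted_rate _ _ hs hsV]
      have hr := hsl.integral_rate_le hm hm1 (by nlinarith)
      have hr' := hsl.integral_rate_le_high hm hm1 ha hs0
      have hT2 := h.truncEnergy_nonneg (2 - m) hs (V := V) (by linarith)
      have hT1 := h.truncEnergy_nonneg (1 - m) hs (V := V) (by linarith)
      have hT3 := h.truncEnergy_nonneg (3 - m) hs (V := V) (by linarith)
      have hL : 0 ≤ nearEnergy R ψ ψu ψv s := nearEnergy_nonneg s
      simp only [← truncEnergy.eq_1 R r ψv, ← nearEnergy.eq_1 R ψ ψu ψv] at hr hr'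
      set D3 := ∫ v in (s + R)..V, Slice.rate (3 - m) (r s) (ru s) (ψv s) (F s) v
      set D2 := ∫ v in (s + R)..V, Slice.rate (2 - m) (r s) (ru s) (ψv s) (F s) v
      set T1 := truncEnergy R r ψv (1 - m) V s
      set T2 := truncEnergy R r ψv (2 - m) V s
      set T3 := truncEnergy R r ψv (3 - m) V s
      set L := nearEnergy R ψ ψu ψv s
      have e1 : s ^ (-γ - 1) = s ^ (-γ) / s := Real.rpow_sub_one hs0.ne' _
      have e2 : s ^ (1 - γ - 1) = s ^ (-γ) := by congr 1; ring
      have e3 : s ^ (1 - γ) = s ^ (-γ) * s := by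
        rw [(by ring : 1 - γ = -γ + 1), Real.rpow_add_one hs0.ne']
      rw [e1, e2, e3]
      have hz : 0 < s ^ (-γ) := Real.rpow_pos_of_pos hs0 _
      have hz1 : s ^ (-γ) ≤ 1 :=
        Real.rpow_le_one_of_one_le_of_nonpos (by linarith [hs.1]) (by linarith)
      have hz2 : U ^ (-γ) ≤ s ^ (-γ) :=
        Real.rpow_le_rpow_of_nonpos hs0 hs.2 (by linarith)
      set z := s ^ (-γ)
      have hd : a / s * T3 ≤ γ / s * T3 :=
        mul_le_mul_of_nonneg_right (div_le_div_of_nonneg_right hγ hs0.le) hT3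
      -- The balance of the two estimates: γ ≥ a removes T3; T2 receives -2 from the upper estimate
      -- and at most 1 from differentiating s^{1-γ}; s·T1 receives 2 · 1/8 = 1/4 against -1/2.
      have hsum : 2 * (-γ / s * T3 + D3) + ((1 - γ) * T2 + s * D2)
          ≤ -(1 / 4) * (T2 + s * T1) + 3 * (s * L) := by
        have h2 := mul_le_mul_of_nonneg_left hr hs0.le
        have h3 : 0 ≤ γ * T2 := mul_nonneg (by linarith) hT2
        have e4 : -γ / s * T3 = -(γ / s * T3) := by ring
        have h4 : 0 ≤ s * T1 := mul_nonneg hs0.le hT1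
        have h5 : 0 ≤ s * L := mul_nonneg hs0.le hL
        rw [e4]
        linarith
      have h6 := mul_le_mul_of_nonneg_left hsum hz.le
      have h7 : U ^ (-γ) * (T2 + s * T1) ≤ z * (T2 + s * T1) :=
        mul_le_mul_of_nonneg_right hz2 (by positivity)
      have h8 : z * (3 * (s * L)) ≤ 1 * (3 * (s * L)) :=
        mul_le_mul_of_nonneg_right hz1 (by positivity)
      have e5 : 2 * (-γ * (z / s) * T3 + z * D3) + ((1 - γ) * z * T2 + z * s * D2)
        = z * (2 * (-γ / s * T3 + D3) + ((1 - γ) * T2 + s * D2)) := by ring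
      rw [e5]
      linarith
  rw [intervalIntegral.integral_add (h.intervalIntegrable (by fun_prop))
    (h.intervalIntegrable (by fun_prop)), intervalIntegral.integral_const_mul,
    intervalIntegral.integral_const_mul] at hmono
  have hu0T : 0 ≤ 2 * truncEnergy R r ψv (3 - m) V u₀ + u₀ * truncEnergy R r ψv (2 - m) V u₀ := by
    have hT2 := h.truncEnergy_nonneg (2 - m) (u := u₀) ⟨le_rfl, hle⟩ (V := V) (by linarith)
    have hT3 := h.truncEnergy_nonneg (3 - m) (u := u₀) ⟨le_rfl, hle⟩ (V := V) (by linarith)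
    have := mul_nonneg (by linarith : 0 ≤ u₀) hT2
    linarith
  have hu0z : u₀ ^ (-γ) ≤ 1 := Real.rpow_le_one_of_one_le_of_nonpos h1 (by linarith)
  have h9 := mul_le_mul_of_nonneg_right hu0z hu0T
  have hUz : 0 < U ^ γ := Real.rpow_pos_of_pos hU0 _
  have hUU : U ^ γ * U ^ (-γ) = 1 := by
    rw [← Real.rpow_add hU0, add_neg_cancel, Real.rpow_zero]
  set A := 2 * truncEnergy R r ψv (3 - m) V U + U * truncEnergy R r ψv (2 - m) V U
  set I := ∫ s in u₀..U, (truncEnergy R r ψv (2 - m) V s + s * truncEnergy R r ψv (1 - m) V s)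
  have h10 : U ^ (-γ) * (A + 1 / 4 * I) ≤
      2 * truncEnergy R r ψv (3 - m) V u₀ + u₀ * truncEnergy R r ψv (2 - m) V u₀
      + 3 * ∫ s in u₀..U, s * nearEnergy R ψ ψu ψv s := by linarith
  have h11 := mul_le_mul_of_nonneg_left h10 hUz.le
  rwa [← mul_assoc, hUU, one_mul] at h11

end RadialWave

/-! ### Passing from truncated to full cones -/

theorem lintegral_Icc_ofReal {f : ℝ → ℝ} {a b : ℝ} (hab : a ≤ b) (hf : ContinuousOn f (Icc a b))
    (h0 : ∀ x ∈ Icc a b, 0 ≤ f x) :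
    ∫⁻ x in Icc a b, ENNReal.ofReal (f x) = ENNReal.ofReal (∫ x in a..b, f x) := by
  rw [intervalIntegral.integral_of_le hab, ← integral_Icc_eq_integral_Ioc,
    ofReal_integral_eq_lintegral_ofReal hf.integrableOn_Icc]
  exact (ae_restrict_iff' measurableSet_Icc).2 (ae_of_all _ h0)

/-- The base point β of the truncation is independent of α, so one sequence of truncations can serve
all cones u ≤ U at once. -/
theorem setLIntegral_Ici_eq_iSup (f : ℝ → ℝ≥0∞) (α β : ℝ) :
    ∫⁻ v in Ici α, f v = ⨆ n : ℕ, ∫⁻ v in Icc α (β + n), f v := by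
  rw [← setLIntegral_iUnion_of_directed]
  · congr 2
    ext v
    simp only [mem_Ici, mem_iUnion, mem_Icc]
    refine ⟨fun hv => ?_, fun ⟨_, hv⟩ => hv.1⟩
    obtain ⟨n, hn⟩ := exists_nat_ge (v - β)
    exact ⟨n, hv, by linarith⟩
  · refine Monotone.directed_le fun n k hnk => Icc_subset_Icc_right ?_
    have : (n : ℝ) ≤ k := by exact_mod_cast hnk
    linarith

/-- The `r^q`-weighted energy on an outgoing cone. -/
def coneEnergy (R : ℝ) (r ψv : ℝ → ℝ → ℝ) (q u : ℝ) : ℝ≥0∞ :=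
  ∫⁻ v in Ici (u + R), ENNReal.ofReal (r u v ^ q * ψv u v ^ 2)

namespace RadialWave
variable {u₀ U R a m b V q : ℝ} {r ru rv ψ ψu ψv F : ℝ → ℝ → ℝ}

theorem ofReal_truncEnergy (h : RadialWave u₀ U R a r ru rv ψ ψu ψv F) (q : ℝ) {u : ℝ}
    (hu : u ∈ Icc u₀ U) (hV : u + R ≤ V) : ENNReal.ofReal (truncEnergy R r ψv q V u)
      = ∫⁻ v in Icc (u + R) V, ENNReal.ofReal (r u v ^ q * ψv u v ^ 2) := by
  refine (lintegral_Icc_ofReal hV ?_ fun v hv => h.density_nonneg q ⟨hu.1, hu.2, hv.1⟩).symm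
  exact (continuousOn_slice (f := fun u v => r u v ^ q * ψv u v ^ 2)
    (h.cont_density q) hu).mono Icc_subset_Ici_self

theorem ofReal_truncEnergy_le (h : RadialWave u₀ U R a r ru rv ψ ψu ψv F) (q : ℝ) {u : ℝ}
    (hu : u ∈ Icc u₀ U) (hV : u + R ≤ V) :
    ENNReal.ofReal (truncEnergy R r ψv q V u) ≤ coneEnergy R r ψv q u := by
  rw [h.ofReal_truncEnergy q hu hV]
  exact lintegral_mono_set Icc_subset_Ici_self

theorem coneEnergy_eq_iSup (h : RadialWave u₀ U R a r ru rv ψ ψu ψv F) (q : ℝ) {u : ℝ}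
    (hu : u ∈ Icc u₀ U) : coneEnergy R r ψv q u
      = ⨆ n : ℕ, ENNReal.ofReal (truncEnergy R r ψv q (U + R + 1 + n) u) := by
  rw [coneEnergy, setLIntegral_Ici_eq_iSup _ _ (U + R + 1)]
  congr 1; ext n
  rw [h.ofReal_truncEnergy q hu]
  have : (0 : ℝ) ≤ n := n.cast_nonneg
  linarith [hu.2]

theorem weight_nonneg (h : RadialWave u₀ U R a r ru rv ψ ψu ψv F) (b : ℝ) :
    ∀ s ∈ Icc u₀ U, 0 ≤ s ^ b := fun s hs =>
  Real.rpow_nonneg (by linarith [hs.1, h.one_le_u₀]) b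

theorem lintegral_weight_trunc (h : RadialWave u₀ U R a r ru rv ψ ψu ψv F) {w : ℝ → ℝ}
    (hw : ContinuousOn w (Icc u₀ U)) (hw0 : ∀ s ∈ Icc u₀ U, 0 ≤ w s) (q : ℝ)
    (hV : U + R ≤ V) :
    ∫⁻ s in Icc u₀ U, ENNReal.ofReal (w s) * ENNReal.ofReal (truncEnergy R r ψv q V s)
      = ENNReal.ofReal (∫ s in u₀..U, w s * truncEnergy R r ψv q V s) := by
  have hc := h.cont_truncEnergy q hV
  rw [← lintegral_Icc_ofReal h.le (by fun_prop) fun s hs =>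
    mul_nonneg (hw0 s hs) (h.truncEnergy_nonneg q hs (by linarith [hs.2]))]
  refine setLIntegral_congr_fun measurableSet_Icc fun s hs => ?_
  exact (ENNReal.ofReal_mul (hw0 s hs)).symm

theorem lintegral_weight_trunc_le (h : RadialWave u₀ U R a r ru rv ψ ψu ψv F) {w : ℝ → ℝ}
    (hw : ContinuousOn w (Icc u₀ U)) (hw0 : ∀ s ∈ Icc u₀ U, 0 ≤ w s) (q : ℝ)
    (hV : U + R ≤ V) :
    ENNReal.ofReal (∫ s in u₀..U, w s * truncEnergy R r ψv q V s) ≤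
    ∫⁻ s in Icc u₀ U, ENNReal.ofReal (w s) * coneEnergy R r ψv q s := by
  rw [← h.lintegral_weight_trunc hw hw0 q hV]
  refine setLIntegral_mono' measurableSet_Icc fun s hs => ?_
  gcongr
  exact h.ofReal_truncEnergy_le q hs (by linarith [hs.2])

theorem lintegral_weight_near (h : RadialWave u₀ U R a r ru rv ψ ψu ψv F) {w : ℝ → ℝ}
    (hw : ContinuousOn w (Icc u₀ U)) (hw0 : ∀ s ∈ Icc u₀ U, 0 ≤ w s) :
    ENNReal.ofReal (∫ s in u₀..U, w s * nearEnergy R ψ ψu ψv s) =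
    ∫⁻ s in Icc u₀ U, ENNReal.ofReal (w s) * ENNReal.ofReal (nearEnergy R ψ ψu ψv s) := by
  have hc := h.cont_nearEnergy
  rw [← lintegral_Icc_ofReal h.le (by fun_prop) fun s hs =>
    mul_nonneg (hw0 s hs) (nearEnergy_nonneg s)]
  refine setLIntegral_congr_fun measurableSet_Icc fun s hs => ?_
  exact ENNReal.ofReal_mul (hw0 s hs)

/-- Monotone convergence: a bound uniform in the truncation V passes to the whole cone, without
knowing in advance that the weighted energy is finite at later times. -/
theorem lintegral_coneEnergy_le (h : RadialWave u₀ U R a r ru rv ψ ψu ψv F) {w : ℝ → ℝ}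
    (hw : ContinuousOn w (Icc u₀ U)) (hw0 : ∀ s ∈ Icc u₀ U, 0 ≤ w s) (q : ℝ) {K : ℝ≥0∞}
    (hK : ∀ V, U + R + 1 ≤ V →
      ENNReal.ofReal (∫ s in u₀..U, w s * truncEnergy R r ψv q V s) ≤ K) :
    ∫⁻ s in Icc u₀ U, ENNReal.ofReal (w s) * coneEnergy R r ψv q s ≤ K := by
  have hn (n : ℕ) : U + R + 1 ≤ U + R + 1 + n := by linarith [(n.cast_nonneg : (0 : ℝ) ≤ n)]
  have e : ∫⁻ s in Icc u₀ U, ENNReal.ofReal (w s) * coneEnergy R r ψv q s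
      = ∫⁻ s in Icc u₀ U, ⨆ n : ℕ, ENNReal.ofReal (w s)
        * ENNReal.ofReal (truncEnergy R r ψv q (U + R + 1 + n) s) := by
    refine setLIntegral_congr_fun measurableSet_Icc fun s hs => ?_
    simp only [h.coneEnergy_eq_iSup q hs, ENNReal.mul_iSup]
  rw [e, lintegral_iSup']
  · refine iSup_le fun n => ?_
    rw [h.lintegral_weight_trunc hw hw0 q (by linarith [hn n])]
    exact hK _ (hn n)
  · intro n
    have hc := h.cont_truncEnergy q (V := U + R + 1 + n) (by linarith [hn n])
    exact (hw.aemeasurable measurableSet_Icc).ennreal_ofReal.mul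
      (hc.aemeasurable measurableSet_Icc).ennreal_ofReal
  · refine (ae_restrict_iff' measurableSet_Icc).2 (ae_of_all _ fun s hs n k hnk => ?_)
    have hnk' : (n : ℝ) ≤ k := by exact_mod_cast hnk
    refine mul_le_mul' le_rfl ?_
    rw [h.ofReal_truncEnergy q hs (by linarith [hn n, hs.2]),
      h.ofReal_truncEnergy q hs (by linarith [hn k, hs.2])]
    exact lintegral_mono_set (Icc_subset_Icc_right (by linarith))

theorem coneEnergy_le (h : RadialWave u₀ U R a r ru rv ψ ψu ψv F) (q : ℝ) {u : ℝ}
    (hu : u ∈ Icc u₀ U) {K : ℝ≥0∞}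
    (hK : ∀ V, U + R + 1 ≤ V → ENNReal.ofReal (truncEnergy R r ψv q V u) ≤ K) :
    coneEnergy R r ψv q u ≤ K := by
  rw [h.coneEnergy_eq_iSup q hu]
  exact iSup_le fun n => hK _ (by linarith [(n.cast_nonneg : (0 : ℝ) ≤ n)])

theorem coneEnergy_mono (h : RadialWave u₀ U R a r ru rv ψ ψu ψv F) {q q' : ℝ} (hq : q ≤ q')
    {u : ℝ} (hu : u ∈ Icc u₀ U) : coneEnergy R r ψv q u ≤ coneEnergy R r ψv q' u := by
  refine setLIntegral_mono' measurableSet_Ici fun v hv => ENNReal.ofReal_le_ofReal ?_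
  have := h.one_le u v ⟨hu.1, hu.2, hv⟩
  gcongr

/-- Interpolation between weighted energies at a given scale `s`. -/
theorem coneEnergy_interpolate (h : RadialWave u₀ U R a r ru rv ψ ψu ψv F) {q₁ q q₂ : ℝ}
    (h1 : q₁ ≤ q) (h2 : q ≤ q₂) {u s : ℝ} (hs : 0 < s) (hu : u ∈ Icc u₀ U) :
    coneEnergy R r ψv q u ≤ ENNReal.ofReal (s ^ (q - q₁)) * coneEnergy R r ψv q₁ u
      + ENNReal.ofReal (s ^ (q - q₂)) * coneEnergy R r ψv q₂ u := by
  have hm (q : ℝ) : AEMeasurable (fun v => ENNReal.ofReal (r u v ^ q * ψv u v ^ 2))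
      (volume.restrict (Ici (u + R))) :=
    ((continuousOn_slice (f := fun u v => r u v ^ q * ψv u v ^ 2)
      (h.cont_density q) hu).aemeasurable measurableSet_Ici).ennreal_ofReal
  unfold coneEnergy
  rw [← lintegral_const_mul'' _ (hm q₁), ← lintegral_const_mul'' _ (hm q₂),
    ← lintegral_add_left' ((hm q₁).const_mul _)]
  refine setLIntegral_mono' measurableSet_Ici fun v hv => ?_
  have hr : 0 < r u v := by linarith [h.one_le u v ⟨hu.1, hu.2, hv⟩]
  rw [← ENNReal.ofReal_mul (by positivity), ← ENNReal.ofReal_mul (by positivity),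
    ← ENNReal.ofReal_add (by positivity) (by positivity)]
  apply ENNReal.ofReal_le_ofReal
  rw [← mul_assoc, ← mul_assoc, ← add_mul]
  refine mul_le_mul_of_nonneg_right ?_ (sq_nonneg _)
  have e1 (p : ℝ) : s ^ (q - p) * r u v ^ p = s ^ q * (r u v / s) ^ p := by
    rw [Real.div_rpow hr.le hs.le, Real.rpow_sub hs]
    field_simp
  have e2 : r u v ^ q = s ^ q * (r u v / s) ^ q := by
    rw [Real.div_rpow hr.le hs.le]
    field_simp
  rw [e1, e1, e2, ← mul_add]
  refine mul_le_mul_of_nonneg_left ?_ (by positivity)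
  have hx : 0 < r u v / s := by positivity
  -- In the variable x = r/s the claim is x^q ≤ x^{q₁} + x^{q₂}: the larger exponent dominates for x
  -- ≥ 1 and the smaller one for x ≤ 1.
  rcases le_total 1 (r u v / s) with h3 | h3
  · have := Real.rpow_le_rpow_of_exponent_le h3 h2
    have : 0 ≤ (r u v / s) ^ q₁ := by positivity
    linarith
  · have := Real.rpow_le_rpow_of_exponent_ge hx h3 h1
    have : 0 ≤ (r u v / s) ^ q₂ := by positivity
    linarith

theorem lintegral_weighted_estimate (h : RadialWave u₀ U R a r ru rv ψ ψu ψv F) (hm : 0 < m)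
    (hm1 : m ≤ 1) (ha : a ≤ m / 100) (hb : 0 ≤ b) :
    ∫⁻ s in Icc u₀ U, ENNReal.ofReal (s ^ b) * coneEnergy R r ψv (1 - m) s ≤
      2 * (ENNReal.ofReal (u₀ ^ b) * coneEnergy R r ψv (2 - m) u₀
        + (∫⁻ s in Icc u₀ U, ENNReal.ofReal (b * s ^ (b - 1)) * coneEnergy R r ψv (2 - m) s)
        + ∫⁻ s in Icc u₀ U, ENNReal.ofReal (s ^ b)
            * ENNReal.ofReal (nearEnergy R ψ ψu ψv s)) := by
  refine h.lintegral_coneEnergy_le (h.cont_rpow b) (h.weight_nonneg b) _ fun V hV => ?_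
  have key := h.weighted_estimate hm hm1 ha hV b
  have hle := h.le
  have h1 := h.one_le_u₀
  have hub : 0 ≤ u₀ ^ b := Real.rpow_nonneg (by linarith) b
  have cw' := h.cont_rpow (b - 1)
  rw [← h.lintegral_weight_near (h.cont_rpow b) (h.weight_nonneg b)]
  have k1 : ∫ s in u₀..U, s ^ b * truncEnergy R r ψv (1 - m) V s ≤
      2 * (u₀ ^ b * truncEnergy R r ψv (2 - m) V u₀
        + (∫ s in u₀..U, b * s ^ (b - 1) * truncEnergy R r ψv (2 - m) V s)
        + ∫ s in u₀..U, s ^ b * nearEnergy R ψ ψu ψv s) := by linarith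
  have hT := h.truncEnergy_nonneg (2 - m) (V := V) (u := u₀) ⟨le_rfl, hle⟩ (by linarith)
  have n1 : 0 ≤ ∫ s in u₀..U, b * s ^ (b - 1) * truncEnergy R r ψv (2 - m) V s :=
    intervalIntegral.integral_nonneg hle fun s hs => mul_nonneg
      (mul_nonneg hb (h.weight_nonneg _ s hs)) (h.truncEnergy_nonneg _ hs (by linarith [hs.2]))
  have n2 : 0 ≤ ∫ s in u₀..U, s ^ b * nearEnergy R ψ ψu ψv s :=
    intervalIntegral.integral_nonneg hle fun s hs => mul_nonneg
      (h.weight_nonneg _ s hs) (nearEnergy_nonneg s)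
  refine (ENNReal.ofReal_le_ofReal k1).trans ?_
  rw [ENNReal.ofReal_mul zero_le_two, ENNReal.ofReal_ofNat,
    ENNReal.ofReal_add (by positivity) n2, ENNReal.ofReal_add (by positivity) n1,
    ENNReal.ofReal_mul hub]
  gcongr
  · exact h.ofReal_truncEnergy_le _ ⟨le_rfl, hle⟩ (by linarith)
  · exact h.lintegral_weight_trunc_le (w := fun s => b * s ^ (b - 1)) (by fun_prop)
      (fun s hs => mul_nonneg hb (h.weight_nonneg _ s hs)) _ (by linarith)

theorem lintegral_top_estimate (h : RadialWave u₀ U R a r ru rv ψ ψu ψv F) (hm : 0 < m)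
    (hm1 : m ≤ 1) (ha : a ≤ m ^ 2 / 100) {γ : ℝ} (hγ : a ≤ γ) {K : ℝ≥0∞}
    (hK : ENNReal.ofReal (U ^ γ) * (12 * (coneEnergy R r ψv (3 - m) u₀
      + ENNReal.ofReal u₀ * coneEnergy R r ψv (2 - m) u₀
      + ∫⁻ s in Icc u₀ U, ENNReal.ofReal s * ENNReal.ofReal (nearEnergy R ψ ψu ψv s))) ≤ K) :
    coneEnergy R r ψv (3 - m) U ≤ K ∧ ENNReal.ofReal U * coneEnergy R r ψv (2 - m) U ≤ K ∧
    (∫⁻ s in Icc u₀ U, coneEnergy R r ψv (2 - m) s) ≤ K ∧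
    (∫⁻ s in Icc u₀ U, ENNReal.ofReal s * coneEnergy R r ψv (1 - m) s) ≤ K := by
  have hle := h.le
  have h1 := h.one_le_u₀
  have hU : 0 < U := by linarith
  have hs0 : ∀ s ∈ Icc u₀ U, 0 ≤ s := fun s hs => by linarith [hs.1]
  have hUγ : 0 ≤ U ^ γ := Real.rpow_nonneg hU.le _
  have hn : 0 ≤ ∫ s in u₀..U, s * nearEnergy R ψ ψu ψv s :=
    intervalIntegral.integral_nonneg hle fun s hs => mul_nonneg (hs0 s hs) (nearEnergy_nonneg s)
  have hw := h.lintegral_weight_near (w := fun s => s) continuousOn_id hs0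
  rw [← hw] at hK
  -- The factor 4 undoes the coefficient 1/4 of the bulk integrals. All terms on the left are
  -- nonnegative, so each is bounded separately; 12 is four times the largest coefficient of the
  -- data.
  have main (V : ℝ) (hV : U + R + 1 ≤ V) {x : ℝ}
      (hx : x ≤ 4 * (2 * truncEnergy R r ψv (3 - m) V U + U * truncEnergy R r ψv (2 - m) V U
      + 1 / 4 * (∫ s in u₀..U, (truncEnergy R r ψv (2 - m) V s
        + s * truncEnergy R r ψv (1 - m) V s)))) : ENNReal.ofReal x ≤ K := by
    have key := h.top_estimate hm hm1 ha hγ hV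
    have t3 := h.truncEnergy_nonneg (3 - m) (V := V) (u := u₀) ⟨le_rfl, hle⟩ (by linarith)
    have t2 := h.truncEnergy_nonneg (2 - m) (V := V) (u := u₀) ⟨le_rfl, hle⟩ (by linarith)
    refine le_trans ?_ hK
    have hx2 : x ≤ U ^ γ * (12 * (truncEnergy R r ψv (3 - m) V u₀
        + u₀ * truncEnergy R r ψv (2 - m) V u₀ + ∫ s in u₀..U, s * nearEnergy R ψ ψu ψv s)) := by
      have t4 : 0 ≤ u₀ * truncEnergy R r ψv (2 - m) V u₀ := mul_nonneg (by linarith) t2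
      have : U ^ γ * (4 * (2 * truncEnergy R r ψv (3 - m) V u₀
        + u₀ * truncEnergy R r ψv (2 - m) V u₀ + 3 * ∫ s in u₀..U, s * nearEnergy R ψ ψu ψv s))
        ≤ U ^ γ * (12 * (truncEnergy R r ψv (3 - m) V u₀
        + u₀ * truncEnergy R r ψv (2 - m) V u₀ + ∫ s in u₀..U, s * nearEnergy R ψ ψu ψv s)) :=
        mul_le_mul_of_nonneg_left (by linarith) hUγ
      linarith
    refine (ENNReal.ofReal_le_ofReal hx2).trans ?_
    have t4 : 0 ≤ u₀ * truncEnergy R r ψv (2 - m) V u₀ := mul_nonneg (by linarith) t2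
    rw [ENNReal.ofReal_mul hUγ, ENNReal.ofReal_mul (by norm_num), ENNReal.ofReal_ofNat,
      ENNReal.ofReal_add (by positivity) hn, ENNReal.ofReal_add t3 t4,
      ENNReal.ofReal_mul (by linarith)]
    gcongr
    · exact h.ofReal_truncEnergy_le _ ⟨le_rfl, hle⟩ (by linarith)
    · exact h.ofReal_truncEnergy_le _ ⟨le_rfl, hle⟩ (by linarith)
  have hpos (V : ℝ) (hV : U + R + 1 ≤ V) : 0 ≤ truncEnergy R r ψv (3 - m) V U ∧
      0 ≤ U * truncEnergy R r ψv (2 - m) V U ∧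
      0 ≤ (∫ s in u₀..U, truncEnergy R r ψv (2 - m) V s) ∧
      0 ≤ (∫ s in u₀..U, s * truncEnergy R r ψv (1 - m) V s) ∧
      (∫ s in u₀..U, (truncEnergy R r ψv (2 - m) V s + s * truncEnergy R r ψv (1 - m) V s))
      = (∫ s in u₀..U, truncEnergy R r ψv (2 - m) V s)
        + ∫ s in u₀..U, s * truncEnergy R r ψv (1 - m) V s := by
    have cT1 := h.cont_truncEnergy (1 - m) (V := V) (by linarith)
    have cT2 := h.cont_truncEnergy (2 - m) (V := V) (by linarith)
    refine ⟨h.truncEnergy_nonneg _ ⟨hle, le_rfl⟩ (by linarith),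
      mul_nonneg hU.le (h.truncEnergy_nonneg _ ⟨hle, le_rfl⟩ (by linarith)),
      intervalIntegral.integral_nonneg hle fun s hs =>
        h.truncEnergy_nonneg _ hs (by linarith [hs.2]),
      intervalIntegral.integral_nonneg hle fun s hs => mul_nonneg (hs0 s hs)
        (h.truncEnergy_nonneg _ hs (by linarith [hs.2])),
      intervalIntegral.integral_add (h.intervalIntegrable (by fun_prop))
        (h.intervalIntegrable (by fun_prop))⟩
  refine ⟨?_, ?_, ?_, ?_⟩
  · refine h.coneEnergy_le _ ⟨hle, le_rfl⟩ fun V hV => main V hV ?_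
    obtain ⟨p1, p2, p3, p4, e⟩ := hpos V hV
    rw [e]; linarith
  · rw [h.coneEnergy_eq_iSup _ ⟨hle, le_rfl⟩, ENNReal.mul_iSup]
    refine iSup_le fun n => ?_
    rw [← ENNReal.ofReal_mul hU.le]
    have hV : U + R + 1 ≤ U + R + 1 + n := by linarith [(n.cast_nonneg : (0 : ℝ) ≤ n)]
    refine main _ hV ?_
    obtain ⟨p1, p2, p3, p4, e⟩ := hpos _ hV
    rw [e]; linarith
  · have := h.lintegral_coneEnergy_le (w := fun _ => 1) continuousOn_const
      (fun _ _ => zero_le_one) (2 - m) (K := K) fun V hV => main V hV ?_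
    · simpa using this
    · obtain ⟨p1, p2, p3, p4, e⟩ := hpos V hV
      simp only [one_mul]
      rw [e]; linarith
  · refine h.lintegral_coneEnergy_le (w := fun s => s) continuousOn_id hs0 _
      fun V hV => main V hV ?_
    obtain ⟨p1, p2, p3, p4, e⟩ := hpos V hV
    rw [e]; linarith

end RadialWave

/-! ### Comparing the flux of `ψ / r` with the unweighted energy of `ψ` -/

namespace Slice
variable {a α V m : ℝ} {r ru rv ψ ψu ψv F : ℝ → ℝ}

/-- The integrand is (r ∂_vφ)² for φ = ψ/r. The term ψ²/r² is handled by the Hardy inequality with m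
= 1. -/
theorem lintegral_flux_le (h : Slice a α V r ru rv ψ ψu ψv F) (ha : a ≤ 1 / 50)
    (hrv : ∀ v ∈ Icc α V, rv v ≤ 11 / 10) :
    ∫⁻ v in Icc α V, ENNReal.ofReal ((ψv v - rv v * ψ v / r v) ^ 2) ≤
      ENNReal.ofReal (23 * ((∫ v in α..V, r v ^ (0 : ℝ) * ψv v ^ 2)
        + ∫ v in α..α + 1, (ψ v ^ 2 + ψu v ^ 2 + ψv v ^ 2))) := by
  have hle : α ≤ V := by linarith [h.le]
  have hH := h.hardy one_pos le_rfl ha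
  have c0 := h.cont_rpow (-1 - 1)
  have c1 := h.cont_rpow 0
  have cp := h.cont_ψ
  have cq := h.cont_ψv
  have cu := h.cont_ψu
  have hY : 0 ≤ ∫ v in α..V, r v ^ (0 : ℝ) * ψv v ^ 2 :=
    intervalIntegral.integral_nonneg hle fun v hv =>
      mul_nonneg (Real.rpow_nonneg (by linarith [h.one_le v hv]) _) (sq_nonneg _)
  have hL : 0 ≤ ∫ v in α..α + 1, (ψ v ^ 2 + ψu v ^ 2 + ψv v ^ 2) :=
    intervalIntegral.integral_nonneg (by linarith) fun v hv => by positivity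
  simp only [sub_self] at hH
  have hpos : ∀ v ∈ Icc α V, 0 ≤ 2 * (r v ^ (0 : ℝ) * ψv v ^ 2)
        + 5 / 2 * (r v ^ (-1 - 1 : ℝ) * (ψ v ^ 2 + ψu v ^ 2)) := fun v hv => by
    have : 0 < r v := by linarith [h.one_le v hv]
    positivity
  calc ∫⁻ v in Icc α V, ENNReal.ofReal ((ψv v - rv v * ψ v / r v) ^ 2)
      ≤ ∫⁻ v in Icc α V, ENNReal.ofReal (2 * (r v ^ (0 : ℝ) * ψv v ^ 2)
        + 5 / 2 * (r v ^ (-1 - 1 : ℝ) * (ψ v ^ 2 + ψu v ^ 2))) := by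
        refine setLIntegral_mono' measurableSet_Icc fun v hv => ENNReal.ofReal_le_ofReal ?_
        have hr : 0 < r v := by linarith [h.one_le v hv]
        have e : r v ^ (-1 - 1 : ℝ) = 1 / r v ^ 2 := by
          rw [(by norm_num : (-1 - 1 : ℝ) = -(2 : ℕ)), Real.rpow_neg hr.le, Real.rpow_natCast,
            one_div]
        rw [e, Real.rpow_zero, one_mul]
        have h1 : (rv v * ψ v / r v) ^ 2 ≤ 5 / 4 * (1 / r v ^ 2 * ψ v ^ 2) := by
          have e2 : (rv v * ψ v / r v) ^ 2 = rv v ^ 2 * (1 / r v ^ 2 * ψ v ^ 2) := by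
            field_simp
          rw [e2]
          refine mul_le_mul_of_nonneg_right ?_ (by positivity)
          nlinarith [hrv v hv, h.le_rv v hv]
        have h2 : 0 ≤ 1 / r v ^ 2 * ψu v ^ 2 := by positivity
        nlinarith [sq_nonneg (ψv v + rv v * ψ v / r v)]
    _ = ENNReal.ofReal (∫ v in α..V, (2 * (r v ^ (0 : ℝ) * ψv v ^ 2)
        + 5 / 2 * (r v ^ (-1 - 1 : ℝ) * (ψ v ^ 2 + ψu v ^ 2)))) :=
        lintegral_Icc_ofReal hle (by fun_prop) hpos
    _ ≤ _ := by
        apply ENNReal.ofReal_le_ofReal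
        rw [intervalIntegral.integral_add (h.intervalIntegrable (by fun_prop))
          (h.intervalIntegrable (by fun_prop)), intervalIntegral.integral_const_mul,
          intervalIntegral.integral_const_mul]
        linarith

/-- With x = r ∂_vφ and y = ψ/r = φ one has ψ_v = x + r_v y, and the derivative of -5ψ²/r is -10xy -
5r_v y². The last term absorbs the y² coming from ψ_v². What remains is the outer boundary term
ψ²/r. -/
theorem energy_le_flux (h : Slice a α V r ru rv ψ ψu ψv F) (hrv : ∀ v ∈ Icc α V, rv v ≤ 11 / 10)
    (hcrv : ContinuousOn rv (Icc α V)) :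
    ∫ v in α..V, r v ^ (0 : ℝ) * ψv v ^ 2 ≤
      15 * (∫ v in α..V, (ψv v - rv v * ψ v / r v) ^ 2) + 5 * (ψ V ^ 2 / r V) := by
  have hle : α ≤ V := by linarith [h.le]
  have cp := h.cont_ψ
  have cq := h.cont_ψv
  have cr := h.cont_r
  have hr0 : ∀ v ∈ Icc α V, 0 < r v := fun v hv => by linarith [h.one_le v hv]
  have cX : ContinuousOn (fun v => ψv v - rv v * ψ v / r v) (Icc α V) :=
    cq.sub ((hcrv.mul cp).div cr fun v hv => (hr0 v hv).ne')
  have key := le_integral_of_hasDerivAt hle (f := fun v => -(5 * (ψ v ^ 2 / r v)))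
    (k := fun v => 15 * (ψv v - rv v * ψ v / r v) ^ 2 - r v ^ (0 : ℝ) * ψv v ^ 2)
    (fun v hv => ((((h.dψ v hv).fun_pow 2).fun_div (h.dr v hv) (hr0 v hv).ne').const_mul 5).fun_neg)
    (((cX.pow 2).const_mul 15).sub ((h.cont_rpow 0).mul (cq.pow 2))) (fun v hv => by
      have h1 := h.le_rv v hv
      have h2 := hrv v hv
      have hr := hr0 v hv
      set x := ψv v - rv v * ψ v / r v with hx
      have ev : ψv v = x + rv v * (ψ v / r v) := by rw [hx]; ring
      rw [Real.rpow_zero, one_mul]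
      have e : -(5 * ((((2 : ℕ) : ℝ) * ψ v ^ (2 - 1) * ψv v * r v - ψ v ^ 2 * rv v) / r v ^ 2))
        = -(5 * (2 * (ψ v / r v) * ψv v - (ψ v / r v) ^ 2 * rv v)) := by
        push_cast; field_simp
      rw [e, ev]
      generalize ψ v / r v = y
      have h3 : 0 ≤ (rv v - 9 / 10) * y ^ 2 := mul_nonneg (by linarith) (sq_nonneg _)
      have h4 : rv v ^ 2 * y ^ 2 ≤ 11 / 10 * rv v * y ^ 2 :=
        mul_le_mul_of_nonneg_right (by nlinarith) (sq_nonneg _)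
      have h5 : 2 * (rv v * (x * y)) ≤ x ^ 2 + rv v ^ 2 * y ^ 2 := by
        nlinarith [sq_nonneg (x - rv v * y)]
      nlinarith [sq_nonneg (2 * x + y), sq_nonneg x, sq_nonneg y])
  have i1 : IntervalIntegrable (fun v => 15 * (ψv v - rv v * ψ v / r v) ^ 2) volume α V :=
    h.intervalIntegrable ((cX.pow 2).const_mul 15)
  have i2 : IntervalIntegrable (fun v => r v ^ (0 : ℝ) * ψv v ^ 2) volume α V :=
    h.intervalIntegrable ((h.cont_rpow 0).mul (cq.pow 2))
  rw [intervalIntegral.integral_sub i1 i2, intervalIntegral.integral_const_mul] at key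
  have : 0 ≤ 5 * (ψ α ^ 2 / r α) := by
    have := hr0 α ⟨le_rfl, hle⟩
    positivity
  linarith

/-- Pointwise |ψ_v| is at most r²ψ_v² plus a multiple of r^{-2}, and the latter is integrable along
the cone with primitive a multiple of -1/r. The two signs of ψ are treated together through σ = ±1.
-/
theorem abs_psi_le (h : Slice a α V r ru rv ψ ψu ψv F) :
    |ψ V| ≤ |ψ α| + 1 + ∫ v in α..V, r v ^ (2 : ℝ) * ψv v ^ 2 := by
  have hle : α ≤ V := by linarith [h.le]
  have cq := h.cont_ψv
  have c2 := h.cont_rpow 2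
  have hr0 : ∀ v ∈ Icc α V, 0 < r v := fun v hv => by linarith [h.one_le v hv]
  have aux (σ : ℝ) (hσ : σ ^ 2 = 1) :
      σ * ψ V ≤ σ * ψ α + 1 + ∫ v in α..V, r v ^ (2 : ℝ) * ψv v ^ 2 := by
    have key := le_integral_of_hasDerivAt hle (f := fun v => σ * ψ v + 5 / 9 * (1 / r v))
      (k := fun v => r v ^ (2 : ℝ) * ψv v ^ 2)
      (fun v hv => ((h.dψ v hv).const_mul σ).fun_add
        (((hasDerivAt_const v (1 : ℝ)).fun_div (h.dr v hv) (hr0 v hv).ne').const_mul (5 / 9)))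
      (by fun_prop) (fun v hv => by
        have hr := hr0 v hv
        have hrv := h.le_rv v hv
        rw [Real.rpow_ofNat]
        have e1 : 5 / 9 * ((0 * r v - 1 * rv v) / r v ^ 2) ≤ -(1 / 2) * (1 / r v) ^ 2 := by
          have : 5 / 9 * ((0 * r v - 1 * rv v) / r v ^ 2) = -(5 / 9 * rv v) * (1 / r v) ^ 2 := by
            field_simp; ring
          rw [this]
          exact mul_le_mul_of_nonneg_right (by linarith) (sq_nonneg _)
        have e2 : σ * ψv v = 1 / r v * (σ * (r v * ψv v)) := by field_simp
        have e3 : r v ^ 2 * ψv v ^ 2 = (σ * (r v * ψv v)) ^ 2 := by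
          rw [mul_pow σ, hσ]; ring
        rw [e2, e3]
        nlinarith [sq_nonneg (1 / r v - σ * (r v * ψv v)), sq_nonneg (σ * (r v * ψv v))])
    have h1 : 0 ≤ 5 / 9 * (1 / r V) := by
      have := hr0 V ⟨hle, le_rfl⟩
      positivity
    have h2 : 5 / 9 * (1 / r α) ≤ 1 := by
      have h3 : 1 / r α ≤ 1 := by
        rw [div_le_one (hr0 α ⟨le_rfl, hle⟩)]
        exact h.one_le α ⟨le_rfl, hle⟩
      linarith
    linarith
  have h1 := aux 1 (by norm_num)
  have h2 := aux (-1) (by norm_num)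
  rw [abs_le]
  constructor <;> linarith [le_abs_self (ψ α), neg_abs_le (ψ α)]

theorem le_r (h : Slice a α V r ru rv ψ ψu ψv F) : 9 / 10 * (V - α) ≤ r V := by
  have hle : α ≤ V := by linarith [h.le]
  have key := le_integral_of_hasDerivAt hle (f := fun v => -r v) (k := fun _ => -(9 / 10))
    (fun v hv => (h.dr v hv).fun_neg) continuousOn_const (fun v hv => by linarith [h.le_rv v hv])
  simp only [intervalIntegral.integral_const, smul_eq_mul] at key
  have := h.one_le α ⟨le_rfl, hle⟩
  linarith

end Slice

/-- The energy flux of `φ = ψ / r` through an outgoing cone. -/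
def fluxEnergy (R : ℝ) (r rv ψ ψv : ℝ → ℝ → ℝ) (u : ℝ) : ℝ≥0∞ :=
  ∫⁻ v in Ici (u + R), ENNReal.ofReal ((ψv u v - rv u v * ψ u v / r u v) ^ 2)

namespace RadialWave
variable {u₀ U R a m b V q : ℝ} {r ru rv ψ ψu ψv F : ℝ → ℝ → ℝ}

theorem fluxEnergy_le (h : RadialWave u₀ U R a r ru rv ψ ψu ψv F) (ha : a ≤ 1 / 50)
    (hrv : ∀ u v, (u, v) ∈ farRegion u₀ U R → rv u v ≤ 11 / 10) {u : ℝ} (hu : u ∈ Icc u₀ U) :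
    fluxEnergy R r rv ψ ψv u ≤
      23 * (coneEnergy R r ψv 0 u + ENNReal.ofReal (nearEnergy R ψ ψu ψv u)) := by
  rw [fluxEnergy, setLIntegral_Ici_eq_iSup _ _ (u + R + 1)]
  refine iSup_le fun n => ?_
  have hV : u + R + 1 ≤ u + R + 1 + n := by linarith [(n.cast_nonneg : (0 : ℝ) ≤ n)]
  refine ((h.slice hu hV).lintegral_flux_le ha
    fun v hv => hrv u v ⟨hu.1, hu.2, hv.1⟩).trans ?_
  have hT := h.truncEnergy_nonneg 0 hu (V := u + R + 1 + n) (by linarith)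
  have hL := nearEnergy_nonneg (R := R) (ψ := ψ) (ψu := ψu) (ψv := ψv) u
  rw [← truncEnergy.eq_1 R r ψv, ← nearEnergy.eq_1 R ψ ψu ψv, ENNReal.ofReal_mul (by norm_num),
    ENNReal.ofReal_add hT hL, ENNReal.ofReal_ofNat]
  gcongr
  exact h.ofReal_truncEnergy_le 0 hu (by linarith)

/-- Finiteness of the r²-energy bounds ψ along the cone while r grows linearly, so the boundary term
ψ²/r of `energy_le_flux` disappears as V → ∞. The bound M may be arbitrarily large: it does not
enter the final constant. -/
theorem coneEnergy_zero_le (h : RadialWave u₀ U R a r ru rv ψ ψu ψv F)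
    (hrv : ∀ u v, (u, v) ∈ farRegion u₀ U R → rv u v ≤ 11 / 10)
    (hcrv : ContinuousOn (fun x : ℝ × ℝ => rv x.1 x.2) (farRegion u₀ U R))
    {u : ℝ} (hu : u ∈ Icc u₀ U) (hfin : coneEnergy R r ψv 2 u ≠ ⊤) :
    coneEnergy R r ψv 0 u ≤ 15 * fluxEnergy R r rv ψ ψv u := by
  by_cases hΦ : fluxEnergy R r rv ψ ψv u = ⊤
  · rw [hΦ]; simp
  have hmem {v : ℝ} (hv : u + R ≤ v) : (u, v) ∈ farRegion u₀ U R := ⟨hu.1, hu.2, hv⟩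
  set Φ := (fluxEnergy R r rv ψ ψv u).toReal with hΦr
  set M := |ψ u (u + R)| + 1 + (coneEnergy R r ψv 2 u).toReal with hM
  have hM0 : 0 ≤ M := by positivity
  have bound (V : ℝ) (hV : u + R + 1 ≤ V) :
      truncEnergy R r ψv 0 V u ≤ 15 * Φ + 5 * M ^ 2 / (9 / 10 * (V - (u + R))) := by
    have hs := h.slice hu hV
    have cX : ContinuousOn (fun v => (ψv u v - rv u v * ψ u v / r u v) ^ 2) (Icc (u + R) V) := by
      have crv : ContinuousOn (rv u) (Icc (u + R) V) :=
        (continuousOn_slice hcrv hu).mono Icc_subset_Ici_self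
      exact (hs.cont_ψv.sub ((crv.mul hs.cont_ψ).div hs.cont_r
        fun v hv => by linarith [hs.one_le v hv])).pow 2
    have h1 := hs.energy_le_flux (fun v hv => hrv u v (hmem hv.1))
      ((continuousOn_slice hcrv hu).mono Icc_subset_Ici_self)
    have h2 : ∫ v in (u + R)..V, (ψv u v - rv u v * ψ u v / r u v) ^ 2 ≤ Φ := by
      rw [hΦr, ← ENNReal.ofReal_le_iff_le_toReal hΦ,
        ← lintegral_Icc_ofReal (by linarith) cX fun _ _ => sq_nonneg _]
      exact lintegral_mono_set Icc_subset_Ici_self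
    have h3 : |ψ u V| ≤ M := by
      refine hs.abs_psi_le.trans ?_
      rw [hM]
      gcongr
      rw [← ENNReal.ofReal_le_iff_le_toReal hfin]
      exact h.ofReal_truncEnergy_le 2 hu (by linarith)
    have h4 : ψ u V ^ 2 ≤ M ^ 2 := by
      rw [← sq_abs]; gcongr
    have h5 : ψ u V ^ 2 / r u V ≤ M ^ 2 / (9 / 10 * (V - (u + R))) :=
      div_le_div₀ (sq_nonneg _) h4 (by linarith) hs.le_r
    have h6 : 5 * M ^ 2 / (9 / 10 * (V - (u + R))) = 5 * (M ^ 2 / (9 / 10 * (V - (u + R)))) := by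
      ring
    rw [h6, truncEnergy]
    linarith
  -- The truncated energy increases with V, so the bound at V follows from the bounds at W ≥ V in
  -- the limit W → ∞.
  have hlim (V : ℝ) (hV : u + R + 1 ≤ V) : truncEnergy R r ψv 0 V u ≤ 15 * Φ := by
    have hmono (W : ℝ) (hW : V ≤ W) : truncEnergy R r ψv 0 V u ≤ truncEnergy R r ψv 0 W u := by
      have hp := h.truncEnergy_nonneg 0 hu (V := W) (by linarith)
      rw [← ENNReal.ofReal_le_ofReal_iff hp, h.ofReal_truncEnergy 0 hu (by linarith),
        h.ofReal_truncEnergy 0 hu (by linarith)]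
      exact lintegral_mono_set (Icc_subset_Icc_right hW)
    have ht : Tendsto (fun W : ℝ => 15 * Φ + 5 * M ^ 2 / (9 / 10 * (W - (u + R)))) atTop
        (𝓝 (15 * Φ + 0)) := by
      refine tendsto_const_nhds.add (Tendsto.const_div_atTop ?_ _)
      exact Tendsto.const_mul_atTop (by norm_num) (tendsto_atTop_add_const_right _ _ tendsto_id)
    rw [add_zero] at ht
    refine ge_of_tendsto ht ?_
    filter_upwards [eventually_ge_atTop V] with W hW
    exact (hmono W hW).trans (bound W (by linarith))
  rw [coneEnergy, setLIntegral_Ici_eq_iSup _ _ (u + R + 1)]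
  refine iSup_le fun n => ?_
  have hV : u + R + 1 ≤ u + R + 1 + n := by linarith [(n.cast_nonneg : (0 : ℝ) ≤ n)]
  rw [← h.ofReal_truncEnergy 0 hu (by linarith)]
  refine (ENNReal.ofReal_le_ofReal (hlim _ hV)).trans ?_
  rw [ENNReal.ofReal_mul (by norm_num), hΦr, ENNReal.ofReal_toReal hΦ, ENNReal.ofReal_ofNat]

end RadialWave

/-! ### From the hierarchy of estimates to decay -/

/-- Weighted integrals in terms of tail integrals. -/
theorem lintegral_rpow_mul_le_of_tail {u₀ U b : ℝ} (hu₀ : 1 ≤ u₀) (hb : 0 ≤ b)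
    {N Q : ℝ → ℝ≥0∞} (hN : AEMeasurable N (volume.restrict (Icc u₀ U)))
    (hQ : ∀ τ ∈ Icc u₀ U, ∫⁻ s in Icc τ U, N s ≤ Q τ) :
    ∫⁻ s in Icc u₀ U, ENNReal.ofReal (s ^ b) * N s ≤ ENNReal.ofReal (u₀ ^ b) * Q u₀
      + ∫⁻ τ in Icc u₀ U, ENNReal.ofReal (b * τ ^ (b - 1)) * Q τ := by
  rcases lt_or_ge U u₀ with hlt | hle
  · simp [Icc_eq_empty_of_lt hlt]
  have hc : ContinuousOn (fun s : ℝ => s ^ (b - 1)) (Icc u₀ U) :=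
    continuousOn_id.rpow_const fun s hs => Or.inl (by
      have := hs.1; simp only [id]; linarith)
  have hk0 : ∀ s ∈ Icc u₀ U, 0 ≤ b * s ^ (b - 1) := fun s hs =>
    mul_nonneg hb (Real.rpow_nonneg (by linarith [hs.1]) _)
  let k : ℝ → ℝ≥0∞ := fun τ => ENNReal.ofReal (b * τ ^ (b - 1))
  have hk : AEMeasurable k (volume.restrict (Icc u₀ U)) :=
    ((hc.const_mul b).aemeasurable measurableSet_Icc).ennreal_ofReal
  -- Write s^b = u₀^b + ∫ bτ^{b-1} dτ over [u₀, s]. Exchanging the integrals over the triangle τ ≤ s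
  -- then leaves exactly the tails of N.
  have hsplit : ∀ s ∈ Icc u₀ U, ENNReal.ofReal (s ^ b) * N s
      = ENNReal.ofReal (u₀ ^ b) * N s
        + ∫⁻ τ in Icc u₀ U, {p : ℝ × ℝ | p.2 ≤ p.1}.indicator (fun p => k p.2 * N p.1) (s, τ) := by
    intro s hs
    have h1 : ∫⁻ τ in Icc u₀ U, {p : ℝ × ℝ | p.2 ≤ p.1}.indicator (fun p => k p.2 * N p.1) (s, τ)
        = ∫⁻ τ in Icc u₀ s, k τ * N s := by
      have : Icc u₀ s = Iic s ∩ Icc u₀ U := by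
        ext τ; simp only [mem_Icc, mem_inter_iff, mem_Iic]
        exact ⟨fun h => ⟨h.2, h.1, h.2.trans hs.2⟩, fun h => ⟨h.2.1, h.1⟩⟩
      rw [this, ← Measure.restrict_restrict measurableSet_Iic,
        ← lintegral_indicator measurableSet_Iic]
      rfl
    have h2 : ∫⁻ τ in Icc u₀ s, k τ = ENNReal.ofReal (s ^ b - u₀ ^ b) := by
      have hsub : Icc u₀ s ⊆ Icc u₀ U := Icc_subset_Icc_right hs.2
      rw [lintegral_Icc_ofReal hs.1 ((hc.const_mul b).mono hsub) fun x hx => hk0 x (hsub hx)]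
      congr 1
      refine intervalIntegral.integral_eq_sub_of_hasDerivAt (f := fun τ => τ ^ b) (fun τ hτ => ?_)
        (((hc.const_mul b).mono hsub).intervalIntegrable_of_Icc hs.1)
      rw [uIcc_of_le hs.1] at hτ
      exact Real.hasDerivAt_rpow_const (Or.inl (by linarith [hτ.1]))
    have h3 : u₀ ^ b ≤ s ^ b := Real.rpow_le_rpow (by linarith) hs.1 hb
    rw [h1, lintegral_mul_const'' _ (hk.mono_measure (Measure.restrict_mono
      (Icc_subset_Icc_right hs.2) le_rfl)), h2, ← add_mul,
      ← ENNReal.ofReal_add (Real.rpow_nonneg (by linarith) _) (by linarith)]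
    congr 2; ring
  rw [setLIntegral_congr_fun measurableSet_Icc hsplit, lintegral_add_left' (hN.const_mul _),
    lintegral_const_mul'' _ hN]
  refine add_le_add (mul_le_mul' le_rfl (hQ u₀ ⟨le_rfl, hle⟩)) ?_
  rw [lintegral_lintegral_swap (f := fun s τ =>
    {p : ℝ × ℝ | p.2 ≤ p.1}.indicator (fun p => k p.2 * N p.1) (s, τ))]
  · refine setLIntegral_mono' measurableSet_Icc fun τ hτ => ?_
    have : ∫⁻ s in Icc u₀ U, {p : ℝ × ℝ | p.2 ≤ p.1}.indicator (fun p => k p.2 * N p.1) (s, τ)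
        = ∫⁻ s in Icc τ U, k τ * N s := by
      have : Icc τ U = Ici τ ∩ Icc u₀ U := by
        ext s; simp only [mem_Icc, mem_inter_iff, mem_Ici]
        exact ⟨fun h => ⟨h.1, hτ.1.trans h.1, h.2⟩, fun h => ⟨h.1, h.2.2⟩⟩
      rw [this, ← Measure.restrict_restrict measurableSet_Ici,
        ← lintegral_indicator measurableSet_Ici]
      rfl
    rw [this, lintegral_const_mul'' _ (hN.mono_measure (Measure.restrict_mono
      (Icc_subset_Icc_left hτ.1) le_rfl))]
    exact mul_le_mul' le_rfl (hQ τ hτ)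
  · refine AEMeasurable.indicator ?_ (measurableSet_le measurable_snd measurable_fst)
    exact hk.comp_snd.mul hN.comp_fst

/-- The estimates satisfied by the weighted energies `E q`, the local and ingoing contributions `N`
and the energy `En` between `u₀` and `U`. -/
structure Hierarchy (u₀ U m γ : ℝ) (D C : ℝ≥0∞) (E : ℝ → ℝ → ℝ≥0∞) (N En : ℝ → ℝ≥0∞) :
    Prop where
  one_le : 1 ≤ u₀
  le : u₀ ≤ U
  m_pos : 0 < m
  m_le : m ≤ 1
  γ_nonneg : 0 ≤ γ
  meas_E : ∀ q, AEMeasurable (E q) (volume.restrict (Icc u₀ U))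
  meas_N : AEMeasurable N (volume.restrict (Icc u₀ U))
  mono : ∀ q q', q ≤ q' → ∀ s ∈ Icc u₀ U, E q s ≤ E q' s
  interp : ∀ q₁ q q₂, q₁ ≤ q → q ≤ q₂ → ∀ s ∈ Icc u₀ U, E q s ≤
    ENNReal.ofReal (s ^ (q - q₁)) * E q₁ s + ENNReal.ofReal (s ^ (q - q₂)) * E q₂ s
  bounded : ∀ τ ∈ Icc u₀ U, En U ≤ D * En τ
  tail : ∀ τ ∈ Icc u₀ U, ∫⁻ s in Icc τ U, N s ≤ C * En τ
  energy_le : ∀ s ∈ Icc u₀ U, En s ≤ C * (E 0 s + N s)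
  weighted : ∀ b, 0 ≤ b → ∫⁻ s in Icc u₀ U, ENNReal.ofReal (s ^ b) * E 0 s ≤
    2 * (ENNReal.ofReal (u₀ ^ b) * E 1 u₀
      + (∫⁻ s in Icc u₀ U, ENNReal.ofReal (b * s ^ (b - 1)) * E 1 s)
      + ∫⁻ s in Icc u₀ U, ENNReal.ofReal (s ^ b) * N s)
  top : ∀ K : ℝ≥0∞, ENNReal.ofReal (U ^ γ) * (12 * (E (3 - m) u₀
      + ENNReal.ofReal u₀ * E (2 - m) u₀ + ∫⁻ s in Icc u₀ U, ENNReal.ofReal s * N s)) ≤ K →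
    E (3 - m) U ≤ K ∧ ENNReal.ofReal U * E (2 - m) U ≤ K ∧
    (∫⁻ s in Icc u₀ U, E (2 - m) s) ≤ K ∧
    (∫⁻ s in Icc u₀ U, ENNReal.ofReal s * E (1 - m) s) ≤ K

namespace Hierarchy
variable {u₀ U m γ : ℝ} {D C : ℝ≥0∞} {E : ℝ → ℝ → ℝ≥0∞} {N En : ℝ → ℝ≥0∞}

/-- A weighted integral of the energy in terms of integrals with a weight of lower order. -/
theorem weighted_energy_le (h : Hierarchy u₀ U m γ D C E N En) {b : ℝ} (hb : 0 ≤ b)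
    {c M X Y : ℝ≥0∞} (hc : ENNReal.ofReal (u₀ ^ b) ≤ c) (hE : E 1 u₀ ≤ M) (hM : En u₀ ≤ M)
    (hX : ∫⁻ s in Icc u₀ U, ENNReal.ofReal (b * s ^ (b - 1)) * E 1 s ≤ X) (hCt : C ≠ ⊤)
    (hY : ∫⁻ s in Icc u₀ U, ENNReal.ofReal (b * s ^ (b - 1)) * En s ≤ Y) :
    (∫⁻ s in Icc u₀ U, ENNReal.ofReal (s ^ b) * N s ≤ C * (c * M + Y)) ∧
    ∫⁻ s in Icc u₀ U, ENNReal.ofReal (s ^ b) * En s ≤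
      C * (2 * (c * M + X) + 3 * (C * (c * M + Y))) := by
  have hw : AEMeasurable (fun s : ℝ => ENNReal.ofReal (s ^ b)) (volume.restrict (Icc u₀ U)) := by
    fun_prop
  have hN : ∫⁻ s in Icc u₀ U, ENNReal.ofReal (s ^ b) * N s ≤ C * (c * M + Y) := by
    refine (lintegral_rpow_mul_le_of_tail h.one_le hb h.meas_N h.tail).trans ?_
    have e : ∫⁻ s in Icc u₀ U, ENNReal.ofReal (b * s ^ (b - 1)) * (C * En s)
        = C * ∫⁻ s in Icc u₀ U, ENNReal.ofReal (b * s ^ (b - 1)) * En s := by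
      rw [← lintegral_const_mul' _ _ hCt]
      congr 1; ext s; ring
    rw [e, mul_add, mul_left_comm]
    gcongr
  refine ⟨hN, ?_⟩
  have hE0 := h.weighted b hb
  have e : ∫⁻ s in Icc u₀ U, ENNReal.ofReal (s ^ b) * En s ≤
      C * ((∫⁻ s in Icc u₀ U, ENNReal.ofReal (s ^ b) * E 0 s)
        + ∫⁻ s in Icc u₀ U, ENNReal.ofReal (s ^ b) * N s) := by
    have hm : AEMeasurable (fun s => ENNReal.ofReal (s ^ b) * E 0 s)
        (volume.restrict (Icc u₀ U)) := hw.mul (h.meas_E 0)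
    rw [← lintegral_add_left' hm, ← lintegral_const_mul' _ _ hCt]
    refine setLIntegral_mono' measurableSet_Icc fun s hs => ?_
    calc ENNReal.ofReal (s ^ b) * En s ≤ ENNReal.ofReal (s ^ b) * (C * (E 0 s + N s)) := by
          gcongr; exact h.energy_le s hs
      _ = _ := by ring
  refine e.trans (mul_le_mul' le_rfl ?_)
  refine (add_le_add (hE0.trans (mul_le_mul' le_rfl (add_le_add (add_le_add
    (mul_le_mul' hc hE) hX) hN))) hN).trans (le_of_eq ?_)
  ring

theorem ofReal_rpow_mul {U : ℝ} (hU : 0 < U) (x y : ℝ) :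
    ENNReal.ofReal (U ^ x) * ENNReal.ofReal (U ^ y) = ENNReal.ofReal (U ^ (x + y)) := by
  rw [← ENNReal.ofReal_mul (by positivity), ← Real.rpow_add hU]

/-- Interpolating at r ~ s gives s^{1-m}E_1 ≤ s E_{1-m} + E_{2-m}, the two bulk quantities of the
top estimate. This limits the usable weights to b ≤ 2-m. -/
theorem energy_one_le (h : Hierarchy u₀ U m γ D C E N En) {b : ℝ} {n : ℕ} (hb : b ≤ n)
    (hb1 : b ≤ 2 - m) {K : ℝ≥0∞} (hK : (∫⁻ s in Icc u₀ U, E (2 - m) s) ≤ K)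
    (hK' : (∫⁻ s in Icc u₀ U, ENNReal.ofReal s * E (1 - m) s) ≤ K) :
    ∫⁻ s in Icc u₀ U, ENNReal.ofReal (b * s ^ (b - 1)) * E 1 s ≤ n * (2 * K) := by
  have hm := h.m_pos
  have hm1 := h.m_le
  calc _ ≤ ∫⁻ s in Icc u₀ U, n * (E (2 - m) s + ENNReal.ofReal s * E (1 - m) s) := by
        refine setLIntegral_mono' measurableSet_Icc fun s hs => ?_
        have hs1 : 1 ≤ s := h.one_le.trans hs.1
        have hs0 : 0 < s := by linarith
        have key := h.interp (1 - m) 1 (2 - m) (by linarith) (by linarith) s hs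
        have e1 : ENNReal.ofReal (b * s ^ (b - 1)) ≤ n * ENNReal.ofReal (s ^ (1 - m)) := by
          rw [← ENNReal.ofReal_natCast, ← ENNReal.ofReal_mul (by positivity)]
          refine ENNReal.ofReal_le_ofReal ?_
          have := Real.rpow_le_rpow_of_exponent_le hs1 (show b - 1 ≤ 1 - m by linarith)
          gcongr
        refine (mul_le_mul' e1 key).trans ?_
        rw [mul_assoc, mul_add, ← mul_assoc (ENNReal.ofReal _), ← mul_assoc (ENNReal.ofReal _),
          ofReal_rpow_mul hs0, ofReal_rpow_mul hs0, add_comm (E (2 - m) s)]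
        have x1 : 1 - m + (1 - (1 - m)) = 1 := by ring
        have x2 : 1 - m + (1 - (2 - m)) = 0 := by ring
        rw [x1, x2, Real.rpow_one, Real.rpow_zero, ENNReal.ofReal_one, one_mul]
    _ ≤ n * (K + K) := by
        rw [lintegral_const_mul' _ _ (ENNReal.natCast_ne_top n), lintegral_add_left' (h.meas_E _)]
        gcongr
    _ = _ := by ring

/-- Growth of the top weighted energy and integrated decay of the energy. -/
theorem growth (h : Hierarchy u₀ U m γ D C E N En) (hCt : C ≠ ⊤) {c S K₁ K₂ M : ℝ≥0∞}
    (hc : c = ENNReal.ofReal (u₀ ^ (2 : ℝ))) (hS : S = C * (2 * c + 3 * (C * c)))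
    (hK₁ : K₁ = 12 * (1 + c + C * (c + S)))
    (hK₂ : K₂ = C * (2 * (c + 2 * K₁) + 3 * (C * (c + S)))) (hM : M = E (3 - m) u₀ + En u₀) :
    (E (3 - m) U ≤ K₁ * ENNReal.ofReal (U ^ γ) * M ∧
      ENNReal.ofReal U * E (2 - m) U ≤ K₁ * ENNReal.ofReal (U ^ γ) * M) ∧
    ∫⁻ s in Icc u₀ U, ENNReal.ofReal (s ^ (2 - m)) * En s ≤
      C * (2 * (c + 4 * K₁) + 3 * (C * (c + 2 * K₂))) * ENNReal.ofReal (U ^ γ) * M := by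
  have hm := h.m_pos
  have hm1 := h.m_le
  have h1 := h.one_le
  have hmem : u₀ ∈ Icc u₀ U := ⟨le_rfl, h.le⟩
  have hEM (q : ℝ) (hq : q ≤ 3 - m) : E q u₀ ≤ M :=
    (h.mono q (3 - m) hq u₀ hmem).trans (hM ▸ le_self_add)
  have hnM : En u₀ ≤ M := hM ▸ le_add_self
  have hcb (b : ℝ) (hb : b ≤ 2) : ENNReal.ofReal (u₀ ^ b) ≤ c :=
    hc ▸ ENNReal.ofReal_le_ofReal (Real.rpow_le_rpow_of_exponent_le h1 hb)
  set G := ENNReal.ofReal (U ^ γ) with hG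
  have hG1 : 1 ≤ G := by
    rw [hG, ← ENNReal.ofReal_one]
    exact ENNReal.ofReal_le_ofReal (Real.one_le_rpow (h1.trans h.le) h.γ_nonneg)
  have hMG : M ≤ G * M := le_mul_of_one_le_left' hG1
  -- First rung, b = 0: the derivative of the weight vanishes, so no lower-order integrals are
  -- needed.
  have s0 : ∫⁻ s in Icc u₀ U, En s ≤ S * M := by
    have := (h.weighted_energy_le le_rfl (hcb 0 (by norm_num)) (hEM 1 (by linarith)) hnM (X := 0)
      (by simp) hCt (Y := 0) (by simp)).2
    simp only [Real.rpow_zero, ENNReal.ofReal_one, one_mul] at this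
    refine this.trans (le_of_eq ?_)
    rw [hS]; ring
  have lower {b : ℝ} (hb : 0 ≤ b) (hb1 : b ≤ 1) :
      ∫⁻ s in Icc u₀ U, ENNReal.ofReal (b * s ^ (b - 1)) * En s ≤ S * M := by
    refine (setLIntegral_mono' measurableSet_Icc fun s hs => ?_).trans s0
    refine mul_le_of_le_one_left' (ENNReal.ofReal_le_one.2 ?_)
    have hs1 : 1 ≤ s := h1.trans hs.1
    have := Real.rpow_le_one_of_one_le_of_nonpos hs1 (show b - 1 ≤ 0 by linarith)
    have := Real.rpow_nonneg (show 0 ≤ s by linarith) (b - 1)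
    nlinarith
  -- The weight s on N, needed in the top estimate. Only the bound on N is used here, so the bound
  -- on the E_1 integral may be taken infinite.
  have sN : ∫⁻ s in Icc u₀ U, ENNReal.ofReal s * N s ≤ C * (c * M + S * M) := by
    have := (h.weighted_energy_le zero_le_one (hcb 1 (by norm_num)) (hEM 1 (by linarith)) hnM
      (X := ⊤) le_top hCt (lower zero_le_one le_rfl)).1
    simpa only [Real.rpow_one] using this
  obtain ⟨t1, t2, t3, t4⟩ := h.top (K₁ * G * M) (by
    calc _ ≤ G * (12 * (M + c * M + C * (c * M + S * M))) := by
          gcongr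
          · exact hEM _ le_rfl
          · simpa using hcb 1 (by norm_num)
          · exact hEM _ (by linarith)
      _ = _ := by rw [hK₁]; ring)
  refine ⟨⟨t1, t2⟩, ?_⟩
  have x1 : ∫⁻ s in Icc u₀ U, ENNReal.ofReal ((1 - m) * s ^ (1 - m - 1)) * E 1 s
      ≤ (1 : ℕ) * (2 * (K₁ * G * M)) :=
    h.energy_one_le (by push_cast; linarith) (by linarith) t3 t4
  -- Intermediate rung b = 1-m: differentiating the weight s^{2-m} of the last rung produces exactly
  -- s^{1-m}, up to the factor 2-m ≤ 2.
  have s1 : ∫⁻ s in Icc u₀ U, ENNReal.ofReal (s ^ (1 - m)) * En s ≤ K₂ * (G * M) := by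
    refine (h.weighted_energy_le (by linarith) (hcb _ (by linarith)) (hEM 1 (by linarith)) hnM
      x1 hCt (lower (by linarith) (by linarith))).2.trans ?_
    calc _ ≤ C * (2 * (c * (G * M) + (1 : ℕ) * (2 * (K₁ * G * M)))
          + 3 * (C * (c * (G * M) + S * (G * M)))) := by gcongr
      _ = _ := by rw [hK₂]; push_cast; ring
  have x2 : ∫⁻ s in Icc u₀ U, ENNReal.ofReal ((2 - m) * s ^ (2 - m - 1)) * E 1 s
      ≤ (2 : ℕ) * (2 * (K₁ * G * M)) :=
    h.energy_one_le (by push_cast; linarith) (by linarith) t3 t4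
  have y2 : ∫⁻ s in Icc u₀ U, ENNReal.ofReal ((2 - m) * s ^ (2 - m - 1)) * En s
      ≤ 2 * (K₂ * (G * M)) := by
    refine le_trans ?_ (mul_le_mul' le_rfl s1)
    rw [← lintegral_const_mul' _ _ ENNReal.ofNat_ne_top]
    refine setLIntegral_mono' measurableSet_Icc fun s hs => ?_
    have hs0 : 0 ≤ s := by linarith [hs.1]
    have e : (2 : ℝ) - m - 1 = 1 - m := by ring
    rw [← mul_assoc, ← ENNReal.ofReal_ofNat 2, ← ENNReal.ofReal_mul (by norm_num), e]
    gcongr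
    linarith
  refine (h.weighted_energy_le (by linarith) (hcb _ (by linarith)) (hEM 1 (by linarith)) hnM
    x2 hCt y2).2.trans ?_
  calc _ ≤ C * (2 * (c * (G * M) + (2 : ℕ) * (2 * (K₁ * G * M)))
        + 3 * (C * (c * (G * M) + 2 * (K₂ * (G * M))))) := by gcongr
    _ = _ := by push_cast; ring

/-- An integrated bound and boundedness give decay of the energy. -/
theorem energy_decay (h : Hierarchy u₀ U m γ D C E N En) (hDt : D ≠ ⊤) {K₃ M : ℝ≥0∞}
    (hM : En u₀ ≤ M)
    (hK : ∫⁻ s in Icc u₀ U, ENNReal.ofReal (s ^ (2 - m)) * En s ≤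
      K₃ * ENNReal.ofReal (U ^ γ) * M) :
    En U ≤ 8 * D * (K₃ + ENNReal.ofReal (u₀ ^ 3)) * ENNReal.ofReal (U ^ (-(3 - m) + γ)) * M := by
  have hm := h.m_pos
  have hm1 := h.m_le
  have h1 := h.one_le
  have hle := h.le
  have hU : 0 < U := by linarith
  have main : ENNReal.ofReal (U ^ (3 - m)) * En U ≤
      8 * D * (K₃ + ENNReal.ofReal (u₀ ^ 3)) * ENNReal.ofReal (U ^ γ) * M := by
    -- If U ≥ 2u₀, boundedness puts D · En(s) ≥ En(U) on all of [U/2, U], so the integral bound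
    -- gains U^{3-m} up to 2³. Otherwise U is comparable to u₀ and boundedness alone suffices.
    rcases le_or_gt (2 * u₀) U with h2 | h2
    · have hsub : Icc (U / 2) U ⊆ Icc u₀ U := Icc_subset_Icc_left (by linarith)
      have e1 : ∫⁻ s in Icc (U / 2) U, ENNReal.ofReal ((U / 2) ^ (2 - m)) * En U ≤
          D * (K₃ * ENNReal.ofReal (U ^ γ) * M) := by
        refine le_trans ?_ (mul_le_mul' le_rfl hK)
        rw [← lintegral_const_mul' _ _ hDt]
        refine le_trans (setLIntegral_mono' measurableSet_Icc fun s hs => ?_)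
          (lintegral_mono_set hsub)
        rw [mul_left_comm]
        have := hs.1
        gcongr
        · linarith
        · exact h.bounded s (hsub hs)
      rw [setLIntegral_const, Real.volume_Icc, mul_right_comm,
        ← ENNReal.ofReal_mul (by positivity)] at e1
      have e2 : U ^ (3 - m) ≤ 8 * ((U / 2) ^ (2 - m) * (U - U / 2)) := by
        have a1 : (U / 2) ^ (2 - m) * (U - U / 2) = (U / 2) ^ (3 - m) := by
          rw [show U - U / 2 = U / 2 by ring, ← Real.rpow_add_one (by positivity)]
          congr 1; ring
        have a2 : U ^ (3 - m) = 2 ^ (3 - m) * (U / 2) ^ (3 - m) := by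
          rw [← Real.mul_rpow (by norm_num) (by positivity)]
          congr 1; ring
        have a3 : (2 : ℝ) ^ (3 - m) ≤ 2 ^ (3 : ℝ) :=
          Real.rpow_le_rpow_of_exponent_le (by norm_num) (by linarith)
        rw [a1, a2]
        norm_num at a3
        gcongr
      calc _ ≤ 8 * (ENNReal.ofReal ((U / 2) ^ (2 - m) * (U - U / 2)) * En U) := by
            rw [← mul_assoc, ← ENNReal.ofReal_ofNat 8, ← ENNReal.ofReal_mul (by norm_num)]
            gcongr
        _ ≤ 8 * (D * (K₃ * ENNReal.ofReal (U ^ γ) * M)) := by gcongr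
        _ = 8 * D * K₃ * ENNReal.ofReal (U ^ γ) * M := by ring
        _ ≤ _ := by gcongr; exact le_self_add
    · have e2 : U ^ (3 - m) ≤ 8 * u₀ ^ 3 := by
        have a1 := Real.rpow_le_rpow_of_exponent_le (h1.trans hle) (show 3 - m ≤ (3 : ℝ) by linarith)
        calc _ ≤ U ^ (3 : ℝ) := a1
          _ = U ^ 3 := by norm_cast
          _ ≤ (2 * u₀) ^ 3 := by gcongr
          _ = _ := by ring
      have hG1 : 1 ≤ ENNReal.ofReal (U ^ γ) := by
        rw [← ENNReal.ofReal_one]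
        exact ENNReal.ofReal_le_ofReal (Real.one_le_rpow (h1.trans h.le) h.γ_nonneg)
      calc _ ≤ (8 * ENNReal.ofReal (u₀ ^ 3)) * (D * M) := by
            gcongr
            · rw [← ENNReal.ofReal_ofNat 8, ← ENNReal.ofReal_mul (by norm_num)]
              gcongr
            · exact (h.bounded u₀ ⟨le_rfl, hle⟩).trans (by gcongr)
        _ = 8 * D * ENNReal.ofReal (u₀ ^ 3) * 1 * M := by ring
        _ ≤ _ := by gcongr; exact le_add_self
  calc En U = ENNReal.ofReal (U ^ (-(3 - m))) * (ENNReal.ofReal (U ^ (3 - m)) * En U) := by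
        rw [← mul_assoc, ofReal_rpow_mul hU, neg_add_cancel, Real.rpow_zero, ENNReal.ofReal_one,
          one_mul]
    _ ≤ _ := mul_le_mul' le_rfl main
    _ = _ := by rw [← ofReal_rpow_mul hU]; ring

end Hierarchy

/-- The constant in the decay estimates. -/
def decayConst (u₀ : ℝ) (D C : ℝ≥0∞) : ℝ≥0∞ :=
  let c := ENNReal.ofReal (u₀ ^ (2 : ℝ))
  let S := C * (2 * c + 3 * (C * c))
  let K₁ := 12 * (1 + c + C * (c + S))
  let K₂ := C * (2 * (c + 2 * K₁) + 3 * (C * (c + S)))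
  let K₃ := C * (2 * (c + 4 * K₁) + 3 * (C * (c + 2 * K₂)))
  16 * (8 * D * (K₃ + ENNReal.ofReal (u₀ ^ 3))) + K₁

theorem decayConst_ne_top {u₀ : ℝ} {D C : ℝ≥0∞} (hD : D ≠ ⊤) (hC : C ≠ ⊤) :
    decayConst u₀ D C ≠ ⊤ := by
  lift D to NNReal using hD
  lift C to NNReal using hC
  unfold decayConst
  simp only [ENNReal.ofReal]
  exact_mod_cast ENNReal.coe_ne_top

namespace Hierarchy
variable {u₀ U m γ : ℝ} {D C : ℝ≥0∞} {E : ℝ → ℝ → ℝ≥0∞} {N En : ℝ → ℝ≥0∞}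

/-- The comparison E_0 ≤ 15 En is assumed only conditionally on E_2(U) < ∞; the growth bound for
E_{3-m} supplies this condition, since 2 ≤ 3-m. Decay for each q is then interpolation at r ~ U
between q = 0 and q = 2-m. -/
theorem decay (h : Hierarchy u₀ U m γ D C E N En) (hDt : D ≠ ⊤) (hCt : C ≠ ⊤)
    (hM : E (3 - m) u₀ + En u₀ ≠ ⊤) (h0 : E 2 U ≠ ⊤ → E 0 U ≤ 15 * En U) :
    E (3 - m) U + En U ≤
      decayConst u₀ D C * ENNReal.ofReal (U ^ γ) * (E (3 - m) u₀ + En u₀) ∧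
    ∀ q, 0 ≤ q → q ≤ 2 - m → E q U + En U ≤
      decayConst u₀ D C * ENNReal.ofReal (U ^ (-(3 - m) + γ + q)) * (E (3 - m) u₀ + En u₀) := by
  have hm := h.m_pos
  have hm1 := h.m_le
  have h1 := h.one_le
  have hle := h.le
  have hU1 : 1 ≤ U := h1.trans hle
  have hU : 0 < U := by linarith
  obtain ⟨⟨g1, g2⟩, g3⟩ := h.growth hCt rfl rfl rfl rfl rfl
  have g4 := h.energy_decay hDt le_add_self g3
  replace h0 := h0 (ne_top_of_le_ne_top (ENNReal.mul_ne_top (ENNReal.mul_ne_top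
    (decayConst_ne_top hDt hCt) ENNReal.ofReal_ne_top) hM)
    ((h.mono 2 (3 - m) (by linarith) U ⟨hle, le_rfl⟩).trans (g1.trans
      (by gcongr; exact le_add_self))))
  unfold decayConst
  dsimp only
  set M := E (3 - m) u₀ + En u₀
  set c := ENNReal.ofReal (u₀ ^ (2 : ℝ))
  set S := C * (2 * c + 3 * (C * c))
  set K₁ := 12 * (1 + c + C * (c + S))
  set K₂ := C * (2 * (c + 2 * K₁) + 3 * (C * (c + S)))
  set K₃ := C * (2 * (c + 4 * K₁) + 3 * (C * (c + 2 * K₂)))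
  set K₄ := 8 * D * (K₃ + ENNReal.ofReal (u₀ ^ 3))
  have mono {x y : ℝ} (hxy : x ≤ y) : ENNReal.ofReal (U ^ x) ≤ ENNReal.ofReal (U ^ y) :=
    ENNReal.ofReal_le_ofReal (Real.rpow_le_rpow_of_exponent_le hU1 hxy)
  constructor
  · calc _ ≤ K₁ * ENNReal.ofReal (U ^ γ) * M + 16 * K₄ * ENNReal.ofReal (U ^ γ) * M := by
          refine add_le_add g1 (g4.trans ?_)
          gcongr
          · exact le_mul_of_one_le_left' (by norm_num)
          · linarith
      _ = _ := by ring
  · intro q hq hq2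
    -- One power of U is gained here because the top estimate controls U · E_{2-m} by the same
    -- quantity as E_{3-m}.
    have k2 : E (2 - m) U ≤ ENNReal.ofReal (U ^ (-1 : ℝ)) * (K₁ * ENNReal.ofReal (U ^ γ) * M) := by
      calc E (2 - m) U = ENNReal.ofReal (U ^ (-1 : ℝ)) * (ENNReal.ofReal U * E (2 - m) U) := by
            nth_rw 3 [← Real.rpow_one U]
            rw [← mul_assoc, ofReal_rpow_mul hU, neg_add_cancel, Real.rpow_zero,
              ENNReal.ofReal_one, one_mul]
        _ ≤ _ := mul_le_mul' le_rfl g2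
    have k0 := h.interp 0 q (2 - m) hq hq2 U ⟨hle, le_rfl⟩
    rw [sub_zero] at k0
    have x1 : ENNReal.ofReal (U ^ q) * ENNReal.ofReal (U ^ (-(3 - m) + γ))
        = ENNReal.ofReal (U ^ (-(3 - m) + γ + q)) := by
      rw [ofReal_rpow_mul hU, add_comm]
    have x2 : ENNReal.ofReal (U ^ (q - (2 - m))) * (ENNReal.ofReal (U ^ (-1 : ℝ))
        * ENNReal.ofReal (U ^ γ)) = ENNReal.ofReal (U ^ (-(3 - m) + γ + q)) := by
      rw [ofReal_rpow_mul hU, ofReal_rpow_mul hU]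
      congr 2; ring
    set G := ENNReal.ofReal (U ^ (-(3 - m) + γ + q))
    calc E q U + En U
        ≤ (ENNReal.ofReal (U ^ q) * (15 * (K₄ * ENNReal.ofReal (U ^ (-(3 - m) + γ)) * M))
            + ENNReal.ofReal (U ^ (q - (2 - m))) * (ENNReal.ofReal (U ^ (-1 : ℝ))
              * (K₁ * ENNReal.ofReal (U ^ γ) * M))) + K₄ * G * M := by
          refine add_le_add (k0.trans ?_) (g4.trans ?_)
          · gcongr
            exact h0.trans (by gcongr)
          · gcongr
            exact mono (by linarith)
      _ = 15 * K₄ * (ENNReal.ofReal (U ^ q) * ENNReal.ofReal (U ^ (-(3 - m) + γ))) * M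
          + K₁ * (ENNReal.ofReal (U ^ (q - (2 - m))) * (ENNReal.ofReal (U ^ (-1 : ℝ))
              * ENNReal.ofReal (U ^ γ))) * M + K₄ * G * M := by ring
      _ = _ := by rw [x1, x2]; ring

end Hierarchy

/-! ### Radial solutions far out -/

/-- The bounds available in the region `v - u ≥ R`. -/
structure Background.FarBounds (B : Background) (ε κ R : ℝ) : Prop where
  mem : ∀ u v : ℝ, B.u0 ≤ u → (u : EReal) ≤ B.uF → R ≤ v - u → (u, v) ∈ B.dom
  one_le_r : ∀ u v : ℝ, (u, v) ∈ B.dom → R ≤ v - u → 1 ≤ B.r u v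
  pu_r : ∀ u v : ℝ, (u, v) ∈ B.dom → R ≤ v - u → |1 + CriticalWave.pu B.r u v| ≤ 1 / 10
  pv_r : ∀ u v : ℝ, (u, v) ∈ B.dom → R ≤ v - u → |1 - CriticalWave.pv B.r u v| ≤ 1 / 10
  puv_r : ∀ u v : ℝ, (u, v) ∈ B.dom → R ≤ v - u →
    B.r u v * |CriticalWave.pu (CriticalWave.pv B.r) u v| ≤ |ε|
  Om2_le : ∀ u v : ℝ, (u, v) ∈ B.dom → R ≤ v - u → B.Om2 u v ≤ 8
  coeff : ∀ u v : ℝ, (u, v) ∈ B.dom → R ≤ v - u →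
    |ε * B.w0 u v + B.W0 u v| ≤ κ ∧ |ε * B.w1 u v + B.W1 u v| ≤ κ ∧ |ε * B.q u v + B.Q u v| ≤ κ

theorem Background.AsympFlat.tendsto_r {B : Background} (h : B.AsympFlat) (A : ℝ) :
    ∃ R : ℝ, ∀ u v : ℝ, (u, v) ∈ B.dom → R ≤ v - u → A ≤ B.r u v := by
  obtain ⟨c, R, hc, hr⟩ := h.r_comparable
  refine ⟨max R (c * A), fun u v hd hv => ?_⟩
  have := (hr u v hd (Or.inr ((le_max_left _ _).trans hv))).1
  have := (le_max_right R (c * A)).trans hv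
  exact le_of_mul_le_mul_left (by linarith) hc

theorem Background.AsympFlat.of_bdd {B : Background} (h : B.AsympFlat) (hreg : B.Regular)
    {f : ℝ → ℝ → ℝ} (hf : B.Bdd fun u v => B.r u v * f u v) {η : ℝ} (hη : 0 < η) :
    ∃ R : ℝ, ∀ u v : ℝ, (u, v) ∈ B.dom → R ≤ v - u → |f u v| ≤ η := by
  obtain ⟨C, R, hC⟩ := hf
  obtain ⟨R', hR'⟩ := h.tendsto_r (C / η)
  refine ⟨max R R', fun u v hd hv => ?_⟩
  have h1 := hC u v hd ((le_max_left _ _).trans hv)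
  have h2 := hR' u v hd ((le_max_right _ _).trans hv)
  have h3 := hreg.r_pos u v hd
  rw [abs_mul, abs_of_pos h3] at h1
  rw [div_le_iff₀ hη] at h2
  exact le_of_mul_le_mul_left (h1.trans h2) h3

/-- The constant K is fixed before ε; only the threshold R depends on ε, being chosen so large that
the o(1) coefficient is at most |ε|. -/
theorem Background.coeff_bound {B : Background} {w W : ℝ → ℝ → ℝ} (hw : B.Bdd w) :
    ∃ K : ℝ, 0 ≤ K ∧ (B.Small W → ∀ ε : ℝ, ε ≠ 0 → ∃ R : ℝ, ∀ u v : ℝ, (u, v) ∈ B.dom →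
      R ≤ v - u → |ε * w u v + W u v| ≤ K * |ε|) := by
  obtain ⟨C, R, hC⟩ := hw
  refine ⟨|C| + 1, by positivity, fun hW ε hε => ?_⟩
  obtain ⟨R', hR'⟩ := hW |ε| (abs_pos.2 hε)
  refine ⟨max R R', fun u v hd hv => ?_⟩
  have h1 := hC u v hd ((le_max_left _ _).trans hv)
  have h2 := hR' u v hd ((le_max_right _ _).trans hv)
  have h3 := abs_add_le (ε * w u v) (W u v)
  rw [abs_mul] at h3
  have := le_abs_self C
  nlinarith [abs_nonneg ε]

theorem Background.exists_farBounds {B : Background} (hreg : B.Regular) (hflat : B.AsympFlat)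
    (hcrit : B.ScaleCritical) : ∃ K : ℝ, 0 ≤ K ∧ ∀ ε : ℝ, ε ≠ 0 → ∃ R₀ : ℝ, ∀ R, R₀ ≤ R →
      B.FarBounds ε (K * |ε|) R := by
  obtain ⟨K0, hK0, h0⟩ := Background.coeff_bound (W := B.W0) hcrit.w0_bdd
  obtain ⟨K1, hK1, h1⟩ := Background.coeff_bound (W := B.W1) hcrit.w1_bdd
  obtain ⟨K2, hK2, h2⟩ := Background.coeff_bound (W := B.Q) hcrit.q_bdd
  refine ⟨K0 + K1 + K2, by positivity, fun ε hε => ?_⟩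
  obtain ⟨R1, hR1⟩ := hreg.dom_far
  obtain ⟨R2, hR2⟩ := hflat.tendsto_r 1
  obtain ⟨R3, hR3⟩ := hflat.of_bdd hreg hflat.pu_r (η := 1 / 10) (by norm_num)
  obtain ⟨R4, hR4⟩ := hflat.of_bdd hreg hflat.pv_r (η := 1 / 10) (by norm_num)
  -- Since r|∂_u∂_v r| = O(1/r), this term too drops below |ε| far out and can be counted as part of
  -- the perturbation.
  obtain ⟨R5, hR5⟩ := hflat.of_bdd hreg (f := fun u v => B.r u v * pu (pv B.r) u v)
    (by simpa only [← mul_assoc, ← sq] using hflat.puv_r) (η := |ε|) (abs_pos.2 hε)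
  obtain ⟨R6, hR6⟩ := hflat.of_bdd hreg hflat.Om2_four (η := 4) (by norm_num)
  obtain ⟨R7, hR7⟩ := h0 hcrit.W0_small ε hε
  obtain ⟨R8, hR8⟩ := h1 hcrit.W1_small ε hε
  obtain ⟨R9, hR9⟩ := h2 hcrit.Q_small ε hε
  have e0 := abs_nonneg ε
  have a0 := mul_nonneg hK0 e0
  have a1 := mul_nonneg hK1 e0
  have a2 := mul_nonneg hK2 e0
  refine ⟨max (max (max R1 (max R2 R3)) (max (max R4 R5) (max R6 R7))) (max R8 R9),
    fun R hR => ?_⟩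
  simp only [max_le_iff] at hR
  obtain ⟨⟨⟨l1, l2, l3⟩, ⟨l4, l5⟩, l6, l7⟩, l8, l9⟩ := hR
  refine ⟨fun u v hu hF hv => hR1 u v hu hF (l1.trans hv),
    fun u v hd hv => hR2 u v hd (l2.trans hv), fun u v hd hv => hR3 u v hd (l3.trans hv),
    fun u v hd hv => hR4 u v hd (l4.trans hv), fun u v hd hv => ?_, fun u v hd hv => ?_,
    fun u v hd hv => ⟨?_, ?_, ?_⟩⟩
  · have := hR5 u v hd (l5.trans hv)
    rwa [abs_mul, abs_of_pos (hreg.r_pos u v hd)] at this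
  · linarith [le_abs_self (B.Om2 u v - 4), hR6 u v hd (l6.trans hv)]
  · linarith [hR7 u v hd (l7.trans hv)]
  · linarith [hR8 u v hd (l8.trans hv)]
  · linarith [hR9 u v hd (l9.trans hv)]

/-- A bound for the mixed derivative of the radiation field. -/
theorem abs_mixed_le {r ru rv ruv Om A₀ A₁ A₂ f fu fv fuv κ e : ℝ} (hr : 1 ≤ r)
    (hru : |1 + ru| ≤ 1 / 10) (hrv : |1 - rv| ≤ 1 / 10) (hruv : r * |ruv| ≤ e) (hOm : 0 < Om)
    (hOm8 : Om ≤ 8) (h0 : |A₀| ≤ κ) (h1 : |A₁| ≤ κ) (h2 : |A₂| ≤ κ)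
    (heq : -(4 / (Om * r)) * (r * fuv + ru * fv + rv * fu)
      = 1 / r ^ 2 * (A₀ * f + A₁ * fu + A₂ * (r * fv))) :
    |ruv * f + rv * fu + (ru * fv + r * fuv)| ≤
      (e + 7 * κ) * (|rv * f + r * fv| / r + |r * f| / r ^ 2 + |ru * f + r * fu| / r ^ 2) := by
  have hr0 : 0 < r := by linarith
  have hκ : 0 ≤ κ := (abs_nonneg _).trans h0
  have he : 0 ≤ e := le_trans (by positivity) hruv
  have hmain : r * fuv + ru * fv + rv * fu
      = -(Om / (4 * r)) * (A₀ * f + A₁ * fu + A₂ * (r * fv)) := by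
    have h4 : r * fuv + ru * fv + rv * fu
        = -(Om * r / 4) * (-(4 / (Om * r)) * (r * fuv + ru * fv + rv * fu)) := by
      field_simp
    rw [h4, heq]; field_simp
  have hru2 : |ru| ≤ 11 / 10 := by rw [abs_le] at *; constructor <;> linarith
  have hrv2 : |rv| ≤ 11 / 10 := by rw [abs_le] at *; constructor <;> linarith
  set X := |f| with hX
  set Y := |ru * f + r * fu| with hY
  set Z := |rv * f + r * fv| with hZ
  have X0 : 0 ≤ X := abs_nonneg _
  have Y0 : 0 ≤ Y := abs_nonneg _
  have Z0 : 0 ≤ Z := abs_nonneg _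
  have bu : r * |fu| ≤ Y + 11 / 10 * X := by
    have := abs_sub (ru * f + r * fu) (ru * f)
    rw [add_sub_cancel_left, abs_mul, abs_of_pos hr0, abs_mul] at this
    nlinarith
  have bv : r * |fv| ≤ Z + 11 / 10 * X := by
    have := abs_sub (rv * f + r * fv) (rv * f)
    rw [add_sub_cancel_left, abs_mul, abs_of_pos hr0, abs_mul] at this
    nlinarith
  have bs : |A₀ * f + A₁ * fu + A₂ * (r * fv)| ≤ κ * (X + |fu| + r * |fv|) := by
    have k1 := abs_add_le (A₀ * f + A₁ * fu) (A₂ * (r * fv))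
    have k2 := abs_add_le (A₀ * f) (A₁ * fu)
    rw [abs_mul, abs_mul, abs_of_pos hr0] at k1
    rw [abs_mul, abs_mul] at k2
    have j0 := mul_le_mul_of_nonneg_right h0 X0
    have j1 := mul_le_mul_of_nonneg_right h1 (abs_nonneg fu)
    have j2 := mul_le_mul_of_nonneg_right h2 (show 0 ≤ r * |fv| by positivity)
    linarith
  have hF : |ruv * f + rv * fu + (ru * fv + r * fuv)| ≤
      |ruv| * X + 2 / r * (κ * (X + |fu| + r * |fv|)) := by
    have e1 : ruv * f + rv * fu + (ru * fv + r * fuv)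
        = ruv * f + -(Om / (4 * r)) * (A₀ * f + A₁ * fu + A₂ * (r * fv)) := by
      rw [← hmain]; ring
    have e2 := abs_add_le (ruv * f) (-(Om / (4 * r)) * (A₀ * f + A₁ * fu + A₂ * (r * fv)))
    rw [abs_mul, abs_mul, abs_neg, abs_of_pos (show 0 < Om / (4 * r) by positivity)] at e2
    rw [e1]
    refine e2.trans ?_
    have e3 : Om / (4 * r) ≤ 2 / r := by
      rw [div_le_div_iff₀ (by positivity) hr0]
      nlinarith
    gcongr
  have hfu : |fu| ≤ (Y + 11 / 10 * X) / r := by rw [le_div_iff₀ hr0]; linarith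
  have hq : |ruv| ≤ e / r := by rw [le_div_iff₀ hr0]; linarith
  have hfu2 : (Y + 11 / 10 * X) / r ≤ Y / r + 11 / 10 * X := by
    rw [add_div]
    gcongr
    exact div_le_self (by positivity) hr
  rw [abs_mul, abs_of_pos hr0, ← hX]
  calc _ ≤ |ruv| * X + 2 / r * (κ * (X + |fu| + r * |fv|)) := hF
    _ ≤ e / r * X + 2 / r * (κ * (X + (Y / r + 11 / 10 * X) + (Z + 11 / 10 * X))) := by
        gcongr
        exact hfu.trans hfu2
    -- Ω²/4 ≤ 2, and f enters three times: directly with coefficient 1, and through f_u and f_v with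
    -- 11/10 each. Thus 2(1 + 11/10 + 11/10) = 32/5, rounded up to 7.
    _ = (e + 32 / 5 * κ) * (r * X / r ^ 2) + 2 * κ * (Z / r) + 2 * κ * (Y / r ^ 2) := by
        field_simp
        ring
    _ ≤ (e + 7 * κ) * (r * X / r ^ 2) + (e + 7 * κ) * (Z / r) + (e + 7 * κ) * (Y / r ^ 2) := by
        gcongr <;> linarith
    _ = _ := by ring

/-! ### The radiation field of a radial solution as a `RadialWave` -/

section
variable {B : Background} {k : ℕ∞} {ε κ R U : ℝ} {f : ℝ → ℝ → ℝ} {u v : ℝ}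

theorem CD.mul {n : WithTop ℕ∞} {f g : ℝ → ℝ → ℝ} (hf : CD n f u v) (hg : CD n g u v) :
    CD n (fun u v => f u v * g u v) u v := ContDiffAt.mul hf hg

theorem CD.continuousAt {n : WithTop ℕ∞} (h : CD n f u v) :
    ContinuousAt (fun y : ℝ × ℝ => f y.1 y.2) (u, v) := ContDiffAt.continuousAt h

theorem CD.pu_mul {f g : ℝ → ℝ → ℝ} (hf : CD 1 f u v) (hg : CD 1 g u v) :
    CriticalWave.pu (fun u v => f u v * g u v) u v
      = CriticalWave.pu f u v * g u v + f u v * CriticalWave.pu g u v :=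
  ((hf.hasDerivAt_pu one_ne_zero).mul (hg.hasDerivAt_pu one_ne_zero)).deriv

theorem CD.pv_mul {f g : ℝ → ℝ → ℝ} (hf : CD 1 f u v) (hg : CD 1 g u v) :
    CriticalWave.pv (fun u v => f u v * g u v) u v
      = CriticalWave.pv f u v * g u v + f u v * CriticalWave.pv g u v :=
  ((hf.hasDerivAt_pv one_ne_zero).mul (hg.hasDerivAt_pv one_ne_zero)).deriv

theorem CD.pu_pv_mul {f g : ℝ → ℝ → ℝ} (hf : CD 2 f u v) (hg : CD 2 g u v) :
    CriticalWave.pu (CriticalWave.pv fun u v => f u v * g u v) u v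
      = CriticalWave.pu (CriticalWave.pv f) u v * g u v
        + CriticalWave.pv f u v * CriticalWave.pu g u v
        + (CriticalWave.pu f u v * CriticalWave.pv g u v
          + f u v * CriticalWave.pu (CriticalWave.pv g) u v) := by
  have h1 : (1 : WithTop ℕ∞) ≤ 2 := by norm_num
  have h2 : (1 : WithTop ℕ∞) + 1 ≤ 2 := by norm_num
  rw [pu_congr (g := fun u v => CriticalWave.pv f u v * g u v + f u v * CriticalWave.pv g u v)]
  · have a := ((hf.pv h2).hasDerivAt_pu one_ne_zero).fun_mul
      ((hg.of_le h1).hasDerivAt_pu one_ne_zero)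
    have b := ((hf.of_le h1).hasDerivAt_pu one_ne_zero).fun_mul
      ((hg.pv h2).hasDerivAt_pu one_ne_zero)
    exact (a.fun_add b).deriv
  · filter_upwards [hf.eventually_one h1, hg.eventually_one h1] with y hy hy' using hy.pv_mul hy'

instance : Nonempty S2 := by
  by_contra hne
  rw [not_nonempty_iff] at hne
  exact NeZero.ne areaS2 (Measure.eq_zero_of_isEmpty _)

theorem Background.IsSolution.cd (h : B.IsSolution k ε R fun u v _ => f u v) (hk : 3 ≤ k)
    (hd : (u, v) ∈ B.dom) : CD 3 f u v := by
  exact SmoothAlong.cd (φ := fun u v _ => f u v) (h.smoothAlong_three hk hd)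
    (Classical.arbitrary S2)

theorem Background.IsSolution.abs_mixed_le (h : B.IsSolution k ε R fun u v _ => f u v)
    (hreg : B.Regular) (hk : 3 ≤ k) (hfar : B.FarBounds ε κ R) (hd : (u, v) ∈ B.dom)
    (hv : R ≤ v - u) :
    |pu (pv fun u v => B.r u v * f u v) u v| ≤ (|ε| + 7 * κ) *
      (|pv (fun u v => B.r u v * f u v) u v| / B.r u v + |B.r u v * f u v| / B.r u v ^ 2
        + |pu (fun u v => B.r u v * f u v) u v| / B.r u v ^ 2) := by
  have hr := (hreg.cd_r hd).of_le (m := 2) (by norm_num)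
  have hf := (h.cd hk hd).of_le (m := 2) (by norm_num)
  have h1 : (1 : WithTop ℕ∞) ≤ 2 := by norm_num
  rw [hr.pu_pv_mul hf, (hr.of_le h1).pu_mul (hf.of_le h1), (hr.of_le h1).pv_mul (hf.of_le h1)]
  have he := h.eqn u v hd (Classical.arbitrary S2)
  rw [B.box_eq (φ := fun u v _ => f u v) hr hf (hreg.r_pos u v hd).ne', Background.source, lapS2_const, zero_div,
    add_zero] at he
  obtain ⟨c0, c1, c2⟩ := hfar.coeff u v hd hv
  exact CriticalWave.abs_mixed_le (hfar.one_le_r u v hd hv) (hfar.pu_r u v hd hv)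
    (hfar.pv_r u v hd hv) (hfar.puv_r u v hd hv) (hreg.Om2_pos u v hd) (hfar.Om2_le u v hd hv)
    c0 c1 c2 he

theorem Background.FarBounds.mem_dom (hfar : B.FarBounds ε κ R) (hUF : (U : EReal) ≤ B.uF)
    (hx : (u, v) ∈ farRegion B.u0 U R) : (u, v) ∈ B.dom ∧ R ≤ v - u := by
  obtain ⟨h1, h2, h3⟩ := hx
  simp only at h1 h2 h3
  have h4 : R ≤ v - u := by linarith
  exact ⟨hfar.mem u v h1 ((EReal.coe_le_coe_iff.2 h2).trans hUF) h4, h4⟩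

theorem Background.IsSolution.radialWave (h : B.IsSolution k ε R fun u v _ => f u v)
    (hreg : B.Regular) (hk : 3 ≤ k) (hfar : B.FarBounds ε κ R) (hκ : 0 ≤ κ) (hU : B.u0 ≤ U)
    (hUF : (U : EReal) ≤ B.uF) :
    RadialWave B.u0 U R (|ε| + 7 * κ) B.r (pu B.r) (pv B.r) (fun u v => B.r u v * f u v)
      (pu fun u v => B.r u v * f u v) (pv fun u v => B.r u v * f u v)
      (pu (pv fun u v => B.r u v * f u v)) := by
  have hd {u v : ℝ} (hx : (u, v) ∈ farRegion B.u0 U R) := hfar.mem_dom hUF hx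
  have cr {u v : ℝ} (hx : (u, v) ∈ farRegion B.u0 U R) : CD 3 B.r u v := hreg.cd_r (hd hx).1
  have cψ {u v : ℝ} (hx : (u, v) ∈ farRegion B.u0 U R) :
      CD 3 (fun u v => B.r u v * f u v) u v := (cr hx).mul (h.cd hk (hd hx).1)
  have n0 : (3 : WithTop ℕ∞) ≠ 0 := by norm_num
  have n2 : (2 : WithTop ℕ∞) + 1 ≤ 3 := by norm_num
  have n1 : (1 : WithTop ℕ∞) + 1 ≤ 2 := by norm_num
  refine
    { one_le_u₀ := hreg.one_lt_u0.le, le := hU, a_nonneg := by positivity,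
      cont_r := fun x hx => (cr hx).continuousAt.continuousWithinAt
      cont_ru := fun x hx => ((cr hx).pu n2).continuousAt.continuousWithinAt
      cont_ψ := fun x hx => (cψ hx).continuousAt.continuousWithinAt
      cont_ψu := fun x hx => ((cψ hx).pu n2).continuousAt.continuousWithinAt
      cont_ψv := fun x hx => ((cψ hx).pv n2).continuousAt.continuousWithinAt
      cont_F := fun x hx => (((cψ hx).pv n2).pu n1).continuousAt.continuousWithinAt
      dur := fun u v hx => (cr hx).hasDerivAt_pu n0
      dvr := fun u v hx => (cr hx).hasDerivAt_pv n0
      dvψ := fun u v hx => (cψ hx).hasDerivAt_pv n0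
      dvψu := fun u v hx => ?_
      duψv := fun u v hx => ((cψ hx).pv n2).hasDerivAt_pu two_ne_zero
      one_le := fun u v hx => hfar.one_le_r u v (hd hx).1 (hd hx).2
      ru_le := fun u v hx => by linarith [(abs_le.1 (hfar.pu_r u v (hd hx).1 (hd hx).2)).2]
      le_rv := fun u v hx => by linarith [(abs_le.1 (hfar.pv_r u v (hd hx).1 (hd hx).2)).2]
      F_le := fun u v hx => h.abs_mixed_le hreg hk hfar (hd hx).1 (hd hx).2 }
  -- The same F must serve as ∂_uψ_v and as ∂_vψ_u; this is the symmetry of second derivatives.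
  rw [← (cψ hx).pv_pu (by norm_num)]
  exact ((cψ hx).pu n2).hasDerivAt_pv two_ne_zero

end

/-! ### Energies of radial functions -/

/-- The energy flux of `f` through the ingoing cone `v = u + R`. -/
def Background.inflow (B : Background) (R : ℝ) (f : ℝ → ℝ → ℝ) (u : ℝ) : ℝ≥0∞ :=
  ∫⁻ u' in {u' : ℝ | u ≤ u' ∧ (u', u + R) ∈ B.dom},
    ENNReal.ofReal (B.r u' (u + R) ^ 2 * pu f u' (u + R) ^ 2)

/-- The energy of a radial function, per unit solid angle. -/
def Background.radEnergy (B : Background) (R : ℝ) (f : ℝ → ℝ → ℝ) (u : ℝ) : ℝ≥0∞ :=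
  fluxEnergy R B.r (pv B.r) (fun u v => B.r u v * f u v) (pv fun u v => B.r u v * f u v) u
    + B.inflow R f u

/-- The density in the local energy estimate for a radial function. -/
def Background.density (B : Background) (σ : ℝ) (f : ℝ → ℝ → ℝ) (x : ℝ × ℝ) : ℝ :=
  (f x.1 x.2 ^ 2 + B.r x.1 x.2 ^ 2 * pu f x.1 x.2 ^ 2 + B.r x.1 x.2 ^ 2 * pv f x.1 x.2 ^ 2)
    / (1 + B.r x.1 x.2) ^ σ

theorem areaS2_univ_ne_top : areaS2 univ ≠ ⊤ := measure_ne_top _ _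

theorem areaS2_univ_ne_zero : areaS2 univ ≠ 0 := by
  simpa using NeZero.ne areaS2

section
variable {B : Background} {k : ℕ∞} {ε κ R U σ : ℝ} {f : ℝ → ℝ → ℝ} {u v : ℝ}

theorem atAngle_radial (f : ℝ → ℝ → ℝ) (θ : S2) : atAngle (fun u v _ => f u v) θ = f := rfl

theorem atAngle_rad_radial (f : ℝ → ℝ → ℝ) (θ : S2) :
    atAngle (B.rad fun u v _ => f u v) θ = fun u v => B.r u v * f u v := rfl

theorem Background.rpEnergy_radial (p : ℝ) (u : ℝ) :
    B.rpEnergy R p (B.rad fun u v _ => f u v) u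
      = coneEnergy R B.r (pv fun u v => B.r u v * f u v) p u * areaS2 univ := by
  rw [coneEnergy, ← lintegral_mul_const' _ _ areaS2_univ_ne_top]
  simp only [Background.rpEnergy, atAngle_rad_radial, lintegral_const]

/-- On the outgoing cone r ∂_vf = ψ_v - r_v ψ/r with ψ = rf. The area of the sphere is a common
factor and cancels from every estimate. -/
theorem Background.IsSolution.energy_radial (h : B.IsSolution k ε R fun u v _ => f u v)
    (hreg : B.Regular) (hk : 3 ≤ k) (hfar : B.FarBounds ε κ R) (hu : B.u0 ≤ u)
    (huF : (u : EReal) ≤ B.uF) :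
    B.energy R (fun u v _ => f u v) u = B.radEnergy R f u * areaS2 univ := by
  rw [Background.radEnergy, add_mul, fluxEnergy, Background.inflow,
    ← lintegral_mul_const' _ _ areaS2_univ_ne_top, ← lintegral_mul_const' _ _ areaS2_univ_ne_top]
  simp only [Background.energy, atAngle_radial, gradSqS2_const, add_zero, lintegral_const]
  congr 1
  refine setLIntegral_congr_fun measurableSet_Ici fun v hv => ?_
  have hd := hfar.mem u v hu huF (by linarith [mem_Ici.1 hv])
  have hr := hreg.r_pos u v hd
  have e := ((hreg.cd_r hd).of_le (m := 1) (by norm_num)).pv_mul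
    ((h.cd hk hd).of_le (m := 1) (by norm_num))
  rw [e]
  congr 2
  field_simp
  ring

theorem Background.lintegral_density_le {Cσ : ℝ}
    (h : B.LocalDecay R σ Cσ fun u v _ => f u v) (hu : B.u0 ≤ u) (huF : (u : EReal) ≤ B.uF)
    (hE : B.energy R (fun u v _ => f u v) u = B.radEnergy R f u * areaS2 univ) :
    ∫⁻ x in {x : ℝ × ℝ | x ∈ B.dom ∧ u ≤ x.1 ∧ u + R ≤ x.2}, ENNReal.ofReal (B.density σ f x)
      ≤ ENNReal.ofReal Cσ * B.radEnergy R f u := by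
  have key := h u hu huF
  simp only [atAngle_radial, lintegral_const] at key
  rw [lintegral_mul_const' _ _ areaS2_univ_ne_top, hE, ← mul_assoc] at key
  exact (ENNReal.mul_le_mul_iff_left areaS2_univ_ne_zero areaS2_univ_ne_top).1 key

theorem measurableSet_future (hreg : B.Regular) (R u : ℝ) :
    MeasurableSet {x : ℝ × ℝ | x ∈ B.dom ∧ u ≤ x.1 ∧ u + R ≤ x.2} :=
  hreg.dom_meas.inter ((measurableSet_le measurable_const measurable_fst).inter
    (measurableSet_le measurable_const measurable_snd))

theorem measurable_indicator_of_continuousOn {s : Set (ℝ × ℝ)} (hs : MeasurableSet s)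
    {g : ℝ × ℝ → ℝ} (hg : ContinuousOn g s) :
    Measurable (s.indicator fun x => ENNReal.ofReal (g x)) := by
  have h : ContinuousOn (fun x => ENNReal.ofReal (g x)) s :=
    ENNReal.continuous_ofReal.comp_continuousOn hg
  classical
  rw [← piecewise_eq_indicator]
  exact h.measurable_piecewise continuousOn_const hs

theorem Background.IsSolution.continuousOn_density (h : B.IsSolution k ε R fun u v _ => f u v)
    (hreg : B.Regular) (hk : 3 ≤ k) :
    ContinuousOn (fun x : ℝ × ℝ => B.r x.1 x.2 ^ 2 * pu f x.1 x.2 ^ 2) B.dom ∧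
    ContinuousOn (B.density σ f) B.dom := by
  have c0 : ContinuousOn (fun x : ℝ × ℝ => B.r x.1 x.2) B.dom := fun x hx =>
    (hreg.cd_r hx).continuousAt.continuousWithinAt
  have c1 : ContinuousOn (fun x : ℝ × ℝ => f x.1 x.2) B.dom := fun x hx =>
    (h.cd hk hx).continuousAt.continuousWithinAt
  have c2 : ContinuousOn (fun x : ℝ × ℝ => pu f x.1 x.2) B.dom := fun x hx =>
    ((h.cd hk hx).pu (m := 0) (by norm_num)).continuousAt.continuousWithinAt
  have c3 : ContinuousOn (fun x : ℝ × ℝ => pv f x.1 x.2) B.dom := fun x hx =>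
    ((h.cd hk hx).pv (m := 0) (by norm_num)).continuousAt.continuousWithinAt
  have hp : ∀ x ∈ B.dom, 0 < 1 + B.r x.1 x.2 := fun x hx => by
    linarith [hreg.r_pos x.1 x.2 hx]
  have c4 : ContinuousOn (fun x : ℝ × ℝ => (1 + B.r x.1 x.2) ^ σ) B.dom :=
    (continuousOn_const.add c0).rpow_const fun x hx => Or.inl (hp x hx).ne'
  refine ⟨by fun_prop, ?_⟩
  unfold Background.density
  exact ContinuousOn.div (by fun_prop) c4 fun x hx => (Real.rpow_pos_of_pos (hp x hx) _).ne'

/-- The domain is merely measurable, so the flux need not be continuous in u. It is written as a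
partial integral of a function measurable on the plane. -/
theorem Background.IsSolution.measurable_inflow (h : B.IsSolution k ε R fun u v _ => f u v)
    (hreg : B.Regular) (hk : 3 ≤ k) : Measurable (B.inflow R f) := by
  have hm := measurable_indicator_of_continuousOn hreg.dom_meas
    (h.continuousOn_density hreg hk (σ := 0)).1
  have e : B.inflow R f = fun u => ∫⁻ u', {p : ℝ × ℝ | p.1 ≤ p.2}.indicator (fun p =>
      (B.dom.indicator fun x : ℝ × ℝ =>
        ENNReal.ofReal (B.r x.1 x.2 ^ 2 * pu f x.1 x.2 ^ 2)) (p.2, p.1 + R)) (u, u') := by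
    ext u
    rw [Background.inflow, ← lintegral_indicator]
    · congr 1; ext u'
      simp only [indicator, mem_ofPred_eq]
      split_ifs <;> simp_all
    · exact (measurableSet_Ici (a := u)).inter
        ((by fun_prop : Measurable fun u' : ℝ => (u', u + R)) hreg.dom_meas)
  rw [e]
  refine Measurable.lintegral_prod_right' (f := {p : ℝ × ℝ | p.1 ≤ p.2}.indicator fun p =>
      (B.dom.indicator fun x : ℝ × ℝ =>
        ENNReal.ofReal (B.r x.1 x.2 ^ 2 * pu f x.1 x.2 ^ 2)) (p.2, p.1 + R)) ?_
  exact (hm.comp (by fun_prop : Measurable fun p : ℝ × ℝ => (p.2, p.1 + R))).indicator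
    (measurableSet_le measurable_fst measurable_snd)

/-- Where `r` is bounded, the density controls the function and its first derivatives. -/
theorem Background.le_density {b : ℝ} (hσ : 0 ≤ σ) {u v : ℝ} (hr0 : 0 < B.r u v)
    (hr : B.r u v ≤ b) : f u v ^ 2 + B.r u v ^ 2 * pu f u v ^ 2 + B.r u v ^ 2 * pv f u v ^ 2
      ≤ (1 + b) ^ σ * B.density σ f (u, v) := by
  unfold Background.density
  dsimp only
  rw [mul_div_assoc', le_div_iff₀ (by positivity), mul_comm]
  gcongr

/-- As s varies, the ingoing segments v = s + R, u' ≥ s sweep out part of the future where v - u' ≤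
R. There r is bounded, so the weight of the local decay estimate is harmless; Tonelli and the shift
v = s + R do the rest. -/
theorem Background.IsSolution.lintegral_inflow_le (h : B.IsSolution k ε R fun u v _ => f u v)
    (hreg : B.Regular) (hk : 3 ≤ k) (hσ : 0 ≤ σ) {b τ : ℝ} (hb : 0 ≤ b)
    (hcomp : ∀ u v, (u, v) ∈ B.dom → v - u ≤ R + 1 → B.r u v ≤ b) :
    ∫⁻ s in Icc τ U, B.inflow R f s ≤ ENNReal.ofReal ((1 + b) ^ σ) *
      ∫⁻ x in {x : ℝ × ℝ | x ∈ B.dom ∧ τ ≤ x.1 ∧ τ + R ≤ x.2},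
        ENNReal.ofReal (B.density σ f x) := by
  set S := {x : ℝ × ℝ | x ∈ B.dom ∧ τ ≤ x.1 ∧ τ + R ≤ x.2} with hS
  have hSm : MeasurableSet S := measurableSet_future hreg R τ
  have hm := measurable_indicator_of_continuousOn hSm
    ((h.continuousOn_density hreg hk (σ := σ)).2.mono fun x hx => hx.1)
  rw [← lintegral_indicator hSm, Measure.volume_eq_prod, lintegral_prod_symm' _ hm,
    ← lintegral_add_right_eq_self (fun v => ∫⁻ u, S.indicator
      (fun x => ENNReal.ofReal (B.density σ f x)) (u, v)) R,
    ← lintegral_const_mul' _ _ ENNReal.ofReal_ne_top, ← lintegral_indicator measurableSet_Icc]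
  refine lintegral_mono fun s => ?_
  refine indicator_apply_le' (fun hs => ?_) fun _ => zero_le
  rw [← lintegral_const_mul' _ _ ENNReal.ofReal_ne_top, Background.inflow, ← lintegral_indicator]
  · refine lintegral_mono fun u' => ?_
    refine indicator_apply_le' (fun hu' => ?_) fun _ => zero_le
    obtain ⟨h1, h2⟩ := hu'
    have hx : (u', s + R) ∈ S := ⟨h2, by simpa using hs.1.trans h1, by simpa using hs.1⟩
    rw [indicator_of_mem hx, ← ENNReal.ofReal_mul (by positivity)]
    refine ENNReal.ofReal_le_ofReal ?_
    have := Background.le_density (f := f) hσ (hreg.r_pos _ _ h2)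
      (hcomp _ _ h2 (by linarith))
    nlinarith [sq_nonneg (f u' (s + R)), sq_nonneg (B.r u' (s + R) * pv f u' (s + R))]
  · exact (measurableSet_Ici (a := s)).inter
      ((by fun_prop : Measurable fun u' : ℝ => (u', s + R)) hreg.dom_meas)

/-- Integrated over s, the near energy is a spacetime integral over the strip R ≤ v - u ≤ R + 1,
where r is bounded and local decay applies. The factor b² + 5 converts f and its derivatives to ψ =
rf. -/
theorem Background.IsSolution.lintegral_near_le (h : B.IsSolution k ε R fun u v _ => f u v)
    (hreg : B.Regular) (hk : 3 ≤ k) (hfar : B.FarBounds ε κ R) (hκ : 0 ≤ κ)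
    (hUF : (U : EReal) ≤ B.uF) (hσ : 0 ≤ σ) {b τ : ℝ} (hτ : B.u0 ≤ τ) (hτU : τ ≤ U) (hb : 0 ≤ b)
    (hcomp : ∀ u v, (u, v) ∈ B.dom → v - u ≤ R + 1 → B.r u v ≤ b) :
    ∫⁻ s in Icc τ U, ENNReal.ofReal (nearEnergy R (fun u v => B.r u v * f u v)
        (pu fun u v => B.r u v * f u v) (pv fun u v => B.r u v * f u v) s)
      ≤ ENNReal.ofReal ((b ^ 2 + 5) * (1 + b) ^ σ) *
      ∫⁻ x in {x : ℝ × ℝ | x ∈ B.dom ∧ τ ≤ x.1 ∧ τ + R ≤ x.2},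
        ENNReal.ofReal (B.density σ f x) := by
  set S := {x : ℝ × ℝ | x ∈ B.dom ∧ τ ≤ x.1 ∧ τ + R ≤ x.2} with hS
  have hSm : MeasurableSet S := measurableSet_future hreg R τ
  have hm := measurable_indicator_of_continuousOn hSm
    ((h.continuousOn_density hreg hk (σ := σ)).2.mono fun x hx => hx.1)
  have hw := h.radialWave hreg hk hfar hκ (hτ.trans hτU) hUF
  rw [← lintegral_indicator hSm, Measure.volume_eq_prod, lintegral_prod _ hm.aemeasurable,
    ← lintegral_const_mul' _ _ ENNReal.ofReal_ne_top, ← lintegral_indicator measurableSet_Icc]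
  refine lintegral_mono fun s => ?_
  refine indicator_apply_le' (fun hs => ?_) fun _ => zero_le
  have hmem {v : ℝ} (hv : s + R ≤ v) : (s, v) ∈ farRegion B.u0 U R := ⟨hτ.trans hs.1, hs.2, hv⟩
  rw [← lintegral_const_mul' _ _ ENNReal.ofReal_ne_top, nearEnergy, ← lintegral_Icc_ofReal
    (by linarith) ((continuousOn_slice (f := fun u v => (B.r u v * f u v) ^ 2
      + pu (fun u v => B.r u v * f u v) u v ^ 2 + pv (fun u v => B.r u v * f u v) u v ^ 2)
      hw.cont_near ⟨hτ.trans hs.1, hs.2⟩).mono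
      Icc_subset_Ici_self) (fun v _ => by positivity), ← lintegral_indicator measurableSet_Icc]
  refine lintegral_mono fun v => ?_
  refine indicator_apply_le' (fun hv => ?_) fun _ => zero_le
  obtain ⟨hd, hvR⟩ := hfar.mem_dom hUF (hmem hv.1)
  have hx : (s, v) ∈ S := ⟨hd, hs.1, by simp only; linarith [hs.1, hv.1]⟩
  rw [indicator_of_mem hx, ← ENNReal.ofReal_mul (by positivity)]
  refine ENNReal.ofReal_le_ofReal ?_
  have cr := (hreg.cd_r hd).of_le (m := 1) (by norm_num)
  have cf := (h.cd hk hd).of_le (m := 1) (by norm_num)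
  have hr0 := hreg.r_pos _ _ hd
  have hrb := hcomp s v hd (by linarith [hv.2])
  have key := Background.le_density (f := f) hσ hr0 hrb
  rw [cr.pu_mul cf, cr.pv_mul cf]
  have a1 : pu B.r s v ^ 2 ≤ 5 / 4 := by
    have := abs_le.1 (hfar.pu_r s v hd hvR); nlinarith
  have a2 : pv B.r s v ^ 2 ≤ 5 / 4 := by
    have := abs_le.1 (hfar.pv_r s v hd hvR); nlinarith
  have a3 : B.r s v ^ 2 ≤ b ^ 2 := by gcongr
  set Y := f s v ^ 2 + B.r s v ^ 2 * pu f s v ^ 2 + B.r s v ^ 2 * pv f s v ^ 2 with hY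
  have f0 := sq_nonneg (f s v)
  have b1 := mul_le_mul_of_nonneg_right a1 f0
  have b2 := mul_le_mul_of_nonneg_right a2 f0
  have b3 := mul_le_mul_of_nonneg_right a3 f0
  have b4 := sq_nonneg (pu B.r s v * f s v - B.r s v * pu f s v)
  have b5 := sq_nonneg (pv B.r s v * f s v - B.r s v * pv f s v)
  have b6 : 0 ≤ b ^ 2 * (B.r s v ^ 2 * pu f s v ^ 2) := by positivity
  have b7 : 0 ≤ b ^ 2 * (B.r s v ^ 2 * pv f s v ^ 2) := by positivity
  have b8 : 0 ≤ B.r s v ^ 2 * pu f s v ^ 2 := by positivity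
  have b9 : 0 ≤ B.r s v ^ 2 * pv f s v ^ 2 := by positivity
  calc _ ≤ (b ^ 2 + 5) * Y := by rw [hY]; nlinarith
    _ ≤ (b ^ 2 + 5) * ((1 + b) ^ σ * B.density σ f (s, v)) := by gcongr
    _ = _ := by ring

end

/-! ### Decay of radial solutions -/

section
variable {B : Background} {k : ℕ∞} {ε κ R U σ D Cσ m γ b : ℝ} {f : ℝ → ℝ → ℝ} {u : ℝ}

/-- The constant in the bound for the local and ingoing contributions. -/
def tailConst (σ Cσ b : ℝ) : ℝ≥0∞ :=
  23 + 2 * ENNReal.ofReal ((b ^ 2 + 5) * (1 + b) ^ σ) * ENNReal.ofReal Cσ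

theorem tailConst_ne_top (σ Cσ b : ℝ) : tailConst σ Cσ b ≠ ⊤ := by
  unfold tailConst
  finiteness

theorem RadialWave.aemeasurable_coneEnergy {u₀ a : ℝ} {r ru rv ψ ψu ψv F : ℝ → ℝ → ℝ}
    (h : RadialWave u₀ U R a r ru rv ψ ψu ψv F) (q : ℝ) :
    AEMeasurable (coneEnergy R r ψv q) (volume.restrict (Icc u₀ U)) := by
  have h1 : AEMeasurable (fun s => ⨆ n : ℕ, ENNReal.ofReal
      (truncEnergy R r ψv q (U + R + 1 + n) s)) (volume.restrict (Icc u₀ U)) := by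
    refine AEMeasurable.iSup fun n => ?_
    refine ((h.cont_truncEnergy q ?_).aemeasurable measurableSet_Icc).ennreal_ofReal
    linarith [(n.cast_nonneg : (0 : ℝ) ≤ n)]
  refine h1.congr ((ae_restrict_iff' measurableSet_Icc).2 (ae_of_all _ fun s hs => ?_))
  exact (h.coneEnergy_eq_iSup q hs).symm

theorem Background.IsSolution.lintegral_tail_le (h : B.IsSolution k ε R fun u v _ => f u v)
    (hreg : B.Regular) (hk : 3 ≤ k) (hfar : B.FarBounds ε κ R) (hκ : 0 ≤ κ)
    (hUF : (U : EReal) ≤ B.uF) (hσ : 0 ≤ σ) (hL : B.LocalDecay R σ Cσ fun u v _ => f u v)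
    (hb : 0 ≤ b) (hcomp : ∀ u v, (u, v) ∈ B.dom → v - u ≤ R + 1 → B.r u v ≤ b) {τ : ℝ}
    (hτ : B.u0 ≤ τ) (hτU : τ ≤ U) :
    ∫⁻ s in Icc τ U, (ENNReal.ofReal (nearEnergy R (fun u v => B.r u v * f u v)
        (pu fun u v => B.r u v * f u v) (pv fun u v => B.r u v * f u v) s) + B.inflow R f s)
      ≤ tailConst σ Cσ b * B.radEnergy R f τ := by
  have hτF : (τ : EReal) ≤ B.uF := (EReal.coe_le_coe_iff.2 hτU).trans hUF
  have h1 := h.lintegral_near_le hreg hk hfar hκ hUF hσ hτ hτU hb hcomp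
  have h2 := h.lintegral_inflow_le hreg hk (U := U) (τ := τ) hσ hb hcomp
  have h3 := Background.lintegral_density_le hL hτ hτF (h.energy_radial hreg hk hfar hτ hτF)
  rw [lintegral_add_right _ (h.measurable_inflow hreg hk)]
  have h4 : ENNReal.ofReal ((1 + b) ^ σ) ≤ ENNReal.ofReal ((b ^ 2 + 5) * (1 + b) ^ σ) :=
    ENNReal.ofReal_le_ofReal (le_mul_of_one_le_left (by positivity) (by nlinarith))
  calc _ ≤ ENNReal.ofReal ((b ^ 2 + 5) * (1 + b) ^ σ) * (ENNReal.ofReal Cσ * B.radEnergy R f τ)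
        + ENNReal.ofReal ((b ^ 2 + 5) * (1 + b) ^ σ) * (ENNReal.ofReal Cσ * B.radEnergy R f τ) :=
        add_le_add (h1.trans (by gcongr)) (h2.trans (mul_le_mul' h4 h3))
    _ = 2 * ENNReal.ofReal ((b ^ 2 + 5) * (1 + b) ^ σ) * ENNReal.ofReal Cσ
        * B.radEnergy R f τ := by ring
    _ ≤ _ := by
        unfold tailConst
        gcongr
        exact le_add_self

theorem Background.IsSolution.radEnergy_bounded (h : B.IsSolution k ε R fun u v _ => f u v)
    (hreg : B.Regular) (hk : 3 ≤ k) (hfar : B.FarBounds ε κ R) (hUF : (U : EReal) ≤ B.uF)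
    (hE : B.EnergyBounded R D fun u v _ => f u v) {τ : ℝ} (hτ : B.u0 ≤ τ) (hτU : τ ≤ U) :
    B.radEnergy R f U ≤ max 1 (ENNReal.ofReal D) * B.radEnergy R f τ := by
  -- Energy boundedness is only assumed between distinct times; at equal times the constant has to
  -- be at least 1, hence the maximum.
  rcases hτU.eq_or_lt with rfl | hlt
  · exact le_mul_of_one_le_left' (le_max_left _ _)
  have hτF : (τ : EReal) ≤ B.uF := (EReal.coe_le_coe_iff.2 hτU).trans hUF
  have key := hE τ U hτ hlt hUF
  rw [h.energy_radial hreg hk hfar hτ hτF, h.energy_radial hreg hk hfar (hτ.trans hτU) hUF,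
    ← mul_assoc] at key
  exact ((ENNReal.mul_le_mul_iff_left areaS2_univ_ne_zero areaS2_univ_ne_top).1 key).trans
    (by gcongr; exact le_max_right _ _)

theorem Background.IsSolution.hierarchy (h : B.IsSolution k ε R fun u v _ => f u v)
    (hreg : B.Regular) (hk : 3 ≤ k) (hfar : B.FarBounds ε κ R) (hκ : 0 ≤ κ) (hU : B.u0 ≤ U)
    (hUF : (U : EReal) ≤ B.uF) (hσ : 0 ≤ σ) (hE : B.EnergyBounded R D fun u v _ => f u v)
    (hL : B.LocalDecay R σ Cσ fun u v _ => f u v) (hb : 0 ≤ b)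
    (hcomp : ∀ u v, (u, v) ∈ B.dom → v - u ≤ R + 1 → B.r u v ≤ b) (hm : 0 < m) (hm1 : m ≤ 1)
    (ha : |ε| + 7 * κ ≤ m ^ 2 / 100) (hγ : |ε| + 7 * κ ≤ γ) :
    Hierarchy B.u0 U m γ (max 1 (ENNReal.ofReal D)) (tailConst σ Cσ b)
      (coneEnergy R B.r (pv fun u v => B.r u v * f u v))
      (fun s => ENNReal.ofReal (nearEnergy R (fun u v => B.r u v * f u v)
        (pu fun u v => B.r u v * f u v) (pv fun u v => B.r u v * f u v) s) + B.inflow R f s)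
      (B.radEnergy R f) := by
  have hw := h.radialWave hreg hk hfar hκ hU hUF
  have ha1 : |ε| + 7 * κ ≤ 1 / 100 := ha.trans (by nlinarith)
  have hrv : ∀ u v, (u, v) ∈ farRegion B.u0 U R → pv B.r u v ≤ 11 / 10 := fun u v hx => by
    have hd := hfar.mem_dom hUF hx
    linarith [(abs_le.1 (hfar.pv_r u v hd.1 hd.2)).1]
  have hpos : ∀ s ∈ Icc B.u0 U, 0 < s := fun s hs => by linarith [hreg.one_lt_u0, hs.1]
  refine
    { one_le := hreg.one_lt_u0.le, le := hU, m_pos := hm, m_le := hm1,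
      γ_nonneg := hw.a_nonneg.trans hγ
      meas_E := hw.aemeasurable_coneEnergy
      meas_N := ?_
      mono := fun q q' hq s hs => hw.coneEnergy_mono hq hs
      interp := fun q₁ q q₂ h1 h2 s hs => hw.coneEnergy_interpolate h1 h2 (hpos s hs) hs
      bounded := fun τ hτ => h.radEnergy_bounded hreg hk hfar hUF hE hτ.1 hτ.2
      tail := fun τ hτ => h.lintegral_tail_le hreg hk hfar hκ hUF hσ hL hb hcomp hτ.1 hτ.2
      energy_le := fun s hs => ?_
      weighted := fun b hb => ?_
      top := fun K hK => ?_ }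
  · exact ((hw.cont_nearEnergy.aemeasurable measurableSet_Icc).ennreal_ofReal).add
      (h.measurable_inflow hreg hk).aemeasurable
  · have h1 := hw.fluxEnergy_le (by linarith) hrv hs
    unfold Background.radEnergy tailConst
    calc _ ≤ 23 * (coneEnergy R B.r (pv fun u v => B.r u v * f u v) 0 s
            + ENNReal.ofReal (nearEnergy R (fun u v => B.r u v * f u v)
              (pu fun u v => B.r u v * f u v) (pv fun u v => B.r u v * f u v) s))
          + 23 * B.inflow R f s :=
          add_le_add h1 (le_mul_of_one_le_left' (by norm_num))
      _ = 23 * (coneEnergy R B.r (pv fun u v => B.r u v * f u v) 0 s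
            + (ENNReal.ofReal (nearEnergy R (fun u v => B.r u v * f u v)
              (pu fun u v => B.r u v * f u v) (pv fun u v => B.r u v * f u v) s)
            + B.inflow R f s)) := by ring
      _ ≤ _ := by gcongr; exact le_self_add
  -- The case m = 1 of the lower estimate, that is q = 1, independent of the small m of the top
  -- estimate.
  · have key := hw.lintegral_weighted_estimate one_pos le_rfl ha1 hb
    have e1 : (1 : ℝ) - 1 = 0 := by norm_num
    have e2 : (2 : ℝ) - 1 = 1 := by norm_num
    rw [e1, e2] at key
    refine key.trans ?_
    gcongr
    exact le_self_add
  · refine hw.lintegral_top_estimate hm hm1 ha hγ (le_trans ?_ hK)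
    gcongr
    exact le_self_add

/-- Growth and decay of the energies of a radial solution. -/
theorem Background.IsSolution.decay (h : B.IsSolution k ε R fun u v _ => f u v)
    (hreg : B.Regular) (hk : 3 ≤ k) (hfar : B.FarBounds ε κ R) (hκ : 0 ≤ κ) (hU : B.u0 ≤ U)
    (hUF : (U : EReal) ≤ B.uF) (hσ : 0 ≤ σ) (hE : B.EnergyBounded R D fun u v _ => f u v)
    (hL : B.LocalDecay R σ Cσ fun u v _ => f u v) (hb : 0 ≤ b)
    (hcomp : ∀ u v, (u, v) ∈ B.dom → v - u ≤ R + 1 → B.r u v ≤ b) (hm : 0 < m) (hm1 : m ≤ 1)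
    (ha : |ε| + 7 * κ ≤ m ^ 2 / 100) (hγ : |ε| + 7 * κ ≤ γ)
    (hfin : B.totEnergy R (3 - m) (fun u v _ => f u v) B.u0 < ⊤) :
    B.totEnergy R (3 - m) (fun u v _ => f u v) U ≤
      decayConst B.u0 (max 1 (ENNReal.ofReal D)) (tailConst σ Cσ b) * ENNReal.ofReal (U ^ γ)
        * B.totEnergy R (3 - m) (fun u v _ => f u v) B.u0 ∧
    ∀ q, 0 ≤ q → q ≤ 2 - m → B.totEnergy R q (fun u v _ => f u v) U ≤
      decayConst B.u0 (max 1 (ENNReal.ofReal D)) (tailConst σ Cσ b)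
        * ENNReal.ofReal (U ^ (-(3 - m) + γ + q))
        * B.totEnergy R (3 - m) (fun u v _ => f u v) B.u0 := by
  have hw := h.radialWave hreg hk hfar hκ hU hUF
  have hH := h.hierarchy hreg hk hfar hκ hU hUF hσ hE hL hb hcomp hm hm1 ha hγ
  have hrv : ∀ u v, (u, v) ∈ farRegion B.u0 U R → pv B.r u v ≤ 11 / 10 := fun u v hx => by
    have hd := hfar.mem_dom hUF hx
    linarith [(abs_le.1 (hfar.pv_r u v hd.1 hd.2)).1]
  have hcrv : ContinuousOn (fun x : ℝ × ℝ => pv B.r x.1 x.2) (farRegion B.u0 U R) := fun x hx =>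
    ((hreg.cd_r (hfar.mem_dom hUF hx).1).pv (m := 2) (by norm_num)).continuousAt.continuousWithinAt
  have e (q : ℝ) {s : ℝ} (hs : B.u0 ≤ s) (hsF : (s : EReal) ≤ B.uF) :
      B.totEnergy R q (fun u v _ => f u v) s
        = (coneEnergy R B.r (pv fun u v => B.r u v * f u v) q s + B.radEnergy R f s)
          * areaS2 univ := by
    rw [Background.totEnergy, Background.rpEnergy_radial, h.energy_radial hreg hk hfar hs hsF,
      add_mul]
  have h0F : (B.u0 : EReal) ≤ B.uF := (EReal.coe_le_coe_iff.2 hU).trans hUF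
  rw [e _ le_rfl h0F] at hfin ⊢
  obtain ⟨d1, d2⟩ := hH.decay (by finiteness) (tailConst_ne_top σ Cσ b)
    (fun ht => hfin.ne (by rw [ht, ENNReal.top_mul areaS2_univ_ne_zero]))
    fun h2 => (hw.coneEnergy_zero_le hrv hcrv ⟨hU, le_rfl⟩ h2).trans
      (by gcongr; exact le_self_add)
  refine ⟨?_, fun q hq hq2 => ?_⟩
  · rw [e _ hU hUF, ← mul_assoc]
    gcongr
  · rw [e _ hU hUF, ← mul_assoc]
    gcongr
    exact d2 q hq hq2

/-- The domain lies in v ≥ v₀, so the cone carrying the initial energy is part of the cone carrying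
the data, whose r^p-norms are finite for all p < 3. -/
theorem Background.IsSolution.totEnergy_lt_top (h : B.IsSolution k ε R fun u v _ => f u v)
    (hreg : B.Regular) (hfar : B.FarBounds ε κ R) {p : ℝ} (hp0 : 0 ≤ p) (hp3 : p < 3) :
    B.totEnergy R p (fun u v _ => f u v) B.u0 < ⊤ := by
  have h0F : (B.u0 : EReal) ≤ B.uF := (hreg.dom_sub _ _ (hreg.dom_cone B.v0 le_rfl)).2.1
  have hv0 : B.v0 ≤ B.u0 + R := (hreg.dom_sub _ _
    (hfar.mem B.u0 (B.u0 + R) le_rfl h0F (by linarith))).2.2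
  refine ENNReal.add_lt_top.2 ⟨lt_of_le_of_lt (lintegral_mono_set (Ici_subset_Ici.2 hv0)) ?_,
    h.finite B.u0 le_rfl h0F⟩
  have := h.data_radial p hp0 hp3 0 zero_le_one
  simpa only [Nat.cast_zero, mul_zero, add_zero, iteratedDeriv_one] using! this

end

/-! ### Choice of exponents and conclusion -/

/-- A choice of exponents. -/
theorem exists_exponents {pLow : ℝ → ℝ} {A : ℝ} (hA : 1 ≤ A)
    (hO : (fun ε : ℝ => 2 - pLow ε) =O[𝓝[≠] 0] fun ε : ℝ => Real.sqrt |ε|) :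
    ∃ (ε₀ : ℝ) (m : ℝ → ℝ), 0 < ε₀ ∧ ε₀ ≤ 1 ∧ (m =O[𝓝[≠] 0] fun ε : ℝ => Real.sqrt |ε|) ∧
      ∀ ε, 0 < |ε| → |ε| < ε₀ → 0 < m ε ∧ m ε ≤ 1 / 2 ∧ 2 - pLow ε ≤ m ε ∧
        A * |ε| ≤ m ε ^ 2 / 100 := by
  obtain ⟨K, hK⟩ := hO.bound
  obtain ⟨ε₁, hε₁, hball⟩ := Metric.eventually_nhds_iff.1 (eventually_nhdsWithin_iff.1 hK)
  set L := max K (10 * A) with hL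
  have hL0 : 0 < L := lt_of_lt_of_le (by linarith) (le_max_right _ _)
  have hbound (ε : ℝ) (h : 2 - pLow ε ≤ K * Real.sqrt |ε|) :
      max (2 - pLow ε) (10 * A * Real.sqrt |ε|) ≤ L * Real.sqrt |ε| := by
    refine max_le (h.trans ?_) ?_
    · gcongr; exact le_max_left _ _
    · gcongr; exact le_max_right _ _
  -- The first entry of the maximum gives p_high ≤ 1 + p_low; the second gives m² ≥ 100A²|ε| ≥
  -- 100A|ε|, using A ≥ 1. The last bound on ε₀ makes m ≤ L√|ε| ≤ 1/2.
  refine ⟨min (min ε₁ 1) ((1 / (2 * L)) ^ 2), fun ε => max (2 - pLow ε) (10 * A * Real.sqrt |ε|),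
    by positivity, (min_le_left _ _).trans (min_le_right _ _), ?_, fun ε h0 h1 => ?_⟩
  · refine IsBigO.of_bound L ?_
    filter_upwards [hK] with ε hε
    rw [Real.norm_of_nonneg (Real.sqrt_nonneg _)] at hε ⊢
    rw [Real.norm_of_nonneg (le_max_of_le_right (by positivity))]
    exact hbound ε ((le_abs_self _).trans hε)
  · have hs := Real.sqrt_pos.2 h0
    rw [lt_min_iff, lt_min_iff] at h1
    have hε := hball (y := ε) (by rw [Real.dist_eq, sub_zero]; exact h1.1.1) (abs_pos.1 h0)
    rw [Real.norm_of_nonneg hs.le] at hε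
    have h2 := hbound ε ((le_abs_self _).trans hε)
    have h3 : Real.sqrt |ε| ≤ 1 / (2 * L) := by
      rw [← Real.sqrt_sq (show 0 ≤ 1 / (2 * L) by positivity)]
      exact Real.sqrt_le_sqrt h1.2.le
    refine ⟨lt_max_of_lt_right (by positivity), h2.trans ?_, le_max_left _ _, ?_⟩
    · rw [le_div_iff₀ (by positivity)] at h3
      linarith
    · have h4 := le_max_right (2 - pLow ε) (10 * A * Real.sqrt |ε|)
      have h5 : (10 * A * Real.sqrt |ε|) ^ 2
          ≤ max (2 - pLow ε) (10 * A * Real.sqrt |ε|) ^ 2 := by gcongr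
      rw [mul_pow, Real.sq_sqrt h0.le] at h5
      nlinarith

/-- Comparability is also available where r alone is large, so a large r with v - u ≤ R + 1 would
still satisfy r ≤ c(R + 1). -/
theorem Background.AsympFlat.exists_near_bound {B : Background} (h : B.AsympFlat) (R : ℝ) :
    ∃ b : ℝ, 0 ≤ b ∧ ∀ u v, (u, v) ∈ B.dom → v - u ≤ R + 1 → B.r u v ≤ b := by
  obtain ⟨c, R', hc, hr⟩ := h.r_comparable
  refine ⟨max 0 (max R' (c * (R + 1))), le_max_left _ _, fun u v hd hv => ?_⟩
  rcases le_total R' (B.r u v) with hR | hR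
  · exact le_max_of_le_right (le_max_of_le_right
      ((hr u v hd (Or.inl hR)).2.trans (mul_le_mul_of_nonneg_left hv hc.le)))
  · exact le_max_of_le_right (le_max_of_le_left hR)

end CriticalWave

end

theorem mainTheorem2 (B : CriticalWave.Background) (hreg : B.Regular) (hflat : B.AsympFlat)
    (hcrit : B.ScaleCritical) (k : ℕ∞) (hk : 3 ≤ k)
    (pLow : ℝ → ℝ) (hpLow : ∀ ε : ℝ, ε ≠ 0 → pLow ε < 2)
    (hpLowO : (fun ε : ℝ => 2 - pLow ε) =O[𝓝[≠] 0] fun ε : ℝ => Real.sqrt |ε|) :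
    ∃ (ε₀ : ℝ) (pHigh δ R₀ : ℝ → ℝ), 0 < ε₀ ∧
      ((fun ε : ℝ => 3 - pHigh ε) =O[𝓝[≠] 0] fun ε : ℝ => Real.sqrt |ε|) ∧
      (δ =O[𝓝[≠] 0] fun ε : ℝ => Real.sqrt |ε|) ∧
      (∀ ε : ℝ, 0 < |ε| → |ε| < ε₀ → 2 < pHigh ε ∧ pHigh ε ≤ 1 + pLow ε) ∧
      ∀ R D σ Cσ : ℝ, 0 < D → 1 < σ → 0 < Cσ →
        ∃ C : ℝ, 0 < C ∧ ∀ ε : ℝ, 0 < |ε| → |ε| < ε₀ → R₀ ε ≤ R →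
          (∀ φ, B.IsSolution k ε R φ → B.EnergyBounded R D φ ∧ B.LocalDecay R σ Cσ φ) →
          ∀ φ, B.IsSolution k ε R φ →
            B.totEnergy R (pHigh ε) (CriticalWave.sphAvg φ) B.u0 < ⊤ ∧
            ∀ u : ℝ, B.u0 ≤ u → (u : EReal) ≤ B.uF →
              B.totEnergy R (pHigh ε) (CriticalWave.sphAvg φ) u
                  ≤ ENNReal.ofReal (C * u ^ (2 * δ ε))
                    * B.totEnergy R (pHigh ε) (CriticalWave.sphAvg φ) B.u0 ∧
              ∀ q : ℝ, 0 ≤ q → q ≤ pHigh ε - 1 →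
                B.totEnergy R q (CriticalWave.sphAvg φ) u
                  ≤ ENNReal.ofReal (C * u ^ (-pHigh ε + 2 * δ ε + q))
                    * B.totEnergy R (pHigh ε) (CriticalWave.sphAvg φ) B.u0 := by
  obtain ⟨K, hK0, hK⟩ := CriticalWave.Background.exists_farBounds hreg hflat hcrit
  choose! R₀ hR₀ using hK
  obtain ⟨ε₀, m, hε₀, hε₀1, hmO, hm⟩ :=
    CriticalWave.exists_exponents (A := 1 + 7 * K) (by linarith) hpLowO
  refine ⟨ε₀, fun ε => 3 - m ε, fun ε => (1 + 7 * K) * Real.sqrt |ε|, R₀, hε₀,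
    by simpa only [sub_sub_cancel] using hmO, isBigO_const_mul_self _ _ _, fun ε h0 h1 => ?_,
    fun R D σ Cσ hD hσ hCσ => ?_⟩
  · obtain ⟨a1, a2, a3, a4⟩ := hm ε h0 h1
    constructor <;> linarith
  -- The bound b, and with it the constant A, is fixed before ε is introduced; this gives uniformity
  -- of C in ε.
  obtain ⟨b, hb, hcomp⟩ := hflat.exists_near_bound R
  set A := CriticalWave.decayConst B.u0 (max 1 (ENNReal.ofReal D))
    (CriticalWave.tailConst σ Cσ b) with hA
  have hAt : A ≠ ⊤ := CriticalWave.decayConst_ne_top (by finiteness)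
    (CriticalWave.tailConst_ne_top σ Cσ b)
  have hAC : A ≤ ENNReal.ofReal (A.toReal + 1) := by
    rw [← ENNReal.ofReal_toReal hAt]
    exact ENNReal.ofReal_le_ofReal (by rw [ENNReal.ofReal_toReal hAt]; linarith)
  have hC0 : 0 < A.toReal + 1 := by positivity
  refine ⟨A.toReal + 1, hC0, fun ε h0 h1 hR hbb φ hφ => ?_⟩
  obtain ⟨a1, a2, a3, a4⟩ := hm ε h0 h1
  have hfar := hR₀ ε (abs_pos.1 h0) R hR
  have hΦ := hφ.sphAvg hreg hk hfar.mem
  -- The black-box estimates are assumed for every admissible solution, hence hold for the spherical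
  -- average.
  obtain ⟨hE, hL⟩ := hbb _ hΦ
  have hfin := hΦ.totEnergy_lt_top hreg hfar (p := 3 - m ε) (by linarith) (by linarith)
  refine ⟨hfin, fun u hu huF => ?_⟩
  have hκ : 0 ≤ K * |ε| := by positivity
  have e1 : |ε| + 7 * (K * |ε|) = (1 + 7 * K) * |ε| := by ring
  have hsq : |ε| ≤ Real.sqrt |ε| := Real.le_sqrt_of_sq_le (by nlinarith)
  -- The Grönwall exponent is γ = 2δ. It only has to exceed a, which is of order |ε|, and |ε| ≤ √|ε|
  -- because ε₀ ≤ 1.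
  have hγ : |ε| + 7 * (K * |ε|) ≤ 2 * ((1 + 7 * K) * Real.sqrt |ε|) := by
    rw [e1]
    have := mul_le_mul_of_nonneg_left hsq (show 0 ≤ 1 + 7 * K by linarith)
    have := h0.le.trans hsq
    nlinarith
  obtain ⟨d1, d2⟩ := hΦ.decay hreg hk hfar hκ hu huF (by linarith) hE hL hb hcomp a1
    (by linarith) (e1 ▸ a4) hγ hfin
  refine ⟨d1.trans ?_, fun q hq hq2 => (d2 q hq (by linarith)).trans ?_⟩
  all_goals
    rw [ENNReal.ofReal_mul hC0.le]
    exact mul_le_mul' (mul_le_mul' hAC le_rfl) le_rfl
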